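/- Let $G$ be a finite abelian group and $q:G\to\mathbb C^\times$ a quadratic form, i.e. $q(-g)=q(g)$ and $(g,h)\mapsto q(g+h)/(q(g)q(h))$ is bimultiplicative. Realize the pointed braided category $\mathcal C(G,q)$ as the category of finite-dimensional $G$-graded complex vector spaces, with associativity and braiding scalars given by a normalized abelian $3$-cocycle $(\omega,c)$ on $G$ with values in $\mathbb C^\times$ such that $c(g,g)=q(g)$ for all $g$; write $\mathbb C_g$ for the one-dimensional space in degree $g$. A *particle-hole action* is an action of $\mathbb Z_2=\{1,-1\}$ on this category by monoidal autoequivalences $T_\gamma$, where $T_{\gamma}$ relabels degree $g$ as $\gamma g$, where the tensor structure $T_\gamma V\otimes T_\gamma W\cong T_\gamma(V\otimes W)$ and the isomorphism $T_\gamma T_\delta\cong T_{\gamma\delta}$ are given on homogeneous components by scalars $\mu_\gamma(a,b)$ on $V_a\otimes W_b$ and $\nu_{\gamma,\delta}(a)$ on $V_a$, normalized so that the action is trivial on the objects supported on $\{b\in G: b=-b\}$ (that is, $\mu_\gamma(b,b')=1$ and $\nu_{\gamma,\delta}(b)=1$ for all $b=-b$, $b'=-b'$). Then: **(Existence)** There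 are such an $(\omega,c)$ and a particle-hole action on the corresponding category that preserves the braiding. **(Simple objects and fusion rules)** For every such $(\omega,c)$ and every particle-hole action, let $\mathcal C(G,q)^{\mathbb Z_2}$ be the equivariantization: objects are pairs $(V,u)$ with $u_\gamma:T_\gamma V\cong V$ and $u_{\gamma\delta}\circ\nu_{\gamma,\delta}=u_\gamma\circ T_\gamma(u_\delta)$. For $b=-b$ and $\epsilon=\pm1$ let $X_b^{\epsilon}=(\mathbb C_b,u)$ with $u_1=\mathrm{id}$, $u_{-1}=\epsilon\,\mathrm{id}$. For $a\in G$ let $Y_a=(\mathbb C_a\oplus\mathbb C_{-a},u)$, with basis vectors $e_1,e_{-1}$ of degrees $a,-a$ and $u_\gamma(e_\delta)=\nu_{\gamma,\delta}(a)\,e_{\gamma\delta}$ (so that $u_{-1}$ interchanges the two summands). 1. The objects $X_b^{\pm}$ (for $b=-b$) and $Y_a$ (for $a\ne -a$) are simple, and every simple object of $\mathcal C(G,q)^{\mathbb Z_2}$ is isomorphic to one of them. 2. $X_b^\epsilon\cong X_{b'}^{\epsilon'}$ only if $b=b'$ and $\epsilon=\epsilon'$; for $a\neq-a$ and $a'\neq-a'$,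 $Y_a\cong Y_{a'}$ if and only if $a'=\pm a$; and no $X_b^\epsilon$ is isomorphic to a $Y_a$ with $a\ne-a$. 3. $X_b^\epsilon$ has Frobenius–Perron dimension $1$, and $Y_a$ with $a\neq -a$ has Frobenius–Perron dimension $2$. 4. The unit object is $X_0^+$, and for $b=-b$ one has $Y_b\cong X_b^+\oplus X_b^-$. 5. For $b=-b$, $b'=-b'$, $a\neq -a$, $a'\neq -a'$ and $\epsilon,\epsilon'=\pm1$, $$X_b^\epsilon\otimes X_{b'}^{\epsilon'}\cong X_{b+b'}^{\epsilon\epsilon'},\qquad X_b^\epsilon\otimes Y_a\cong Y_{a+b},$$ $$Y_a\otimes Y_{a'}\cong\begin{cases}X_0^+\oplus X_0^-\oplus Y_{2a}, & a=\pm a',\\ Y_{a+a'}\oplus Y_{a-a'}, & a\neq\pm a',\end{cases}$$ where, by 4, $Y_c$ stands for $X_c^+\oplus X_c^-$ whenever $c=-c$. -/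

import Mathlib

open CategoryTheory MonoidalCategory CategoryTheory.Limits
open scoped TensorProduct

namespace Equivariantization

/-- An action of a group `Γ` on a `ℂ`-linear monoidal category `C`: a monoidal functor from `Γ`,
viewed as a discrete monoidal category, to the linear monoidal autoequivalences of `C`. It consists
of monoidal autoequivalences `T g` and monoidal isomorphisms `ν g h : T_g T_h ≅ T_{gh}` satisfying
the associativity constraint. The isomorphism `𝟭 ≅ T 1` is then determined by `ν 1 1`, as `T 1` is
an equivalence. -/
structure MonoidalAction (Γ : Type*) [Group Γ] (C : Type*) [Category C] [Preadditive C]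
    [Linear ℂ C] [MonoidalCategory C] where
  T : Γ → C ⥤ C
  isEquivalence : ∀ g, (T g).IsEquivalence
  additive : ∀ g, (T g).Additive
  linear : ∀ g, (T g).Linear ℂ
  monoidal : ∀ g, (T g).Monoidal
  ν : ∀ g h, T h ⋙ T g ≅ T (g * h)
  ν_monoidal : ∀ g h, NatTrans.IsMonoidal (ν g h).hom
  ν_assoc : ∀ (g h k : Γ) (X : C),
    (ν g h).hom.app ((T k).obj X) ≫ (ν (g * h) k).hom.app X ≫
        eqToHom (congrArg (fun x => (T x).obj X) (mul_assoc g h k)) =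
      (T g).map ((ν h k).hom.app X) ≫ (ν g (h * k)).hom.app X

attribute [instance] MonoidalAction.isEquivalence MonoidalAction.additive MonoidalAction.linear
  MonoidalAction.monoidal MonoidalAction.ν_monoidal

section General

variable {Γ : Type*} [Group Γ] {C : Type*} [Category C] [Preadditive C] [Linear ℂ C]
  [MonoidalCategory C]

/-- The functors `T g` of the action are braided. -/
def MonoidalAction.PreservesBraiding [BraidedCategory C] (A : MonoidalAction Γ C) : Prop :=
  ∀ (g : Γ) (X Y : C),
    Functor.LaxMonoidal.μ (A.T g) X Y ≫ (A.T g).map (β_ X Y).hom =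
      (β_ ((A.T g).obj X) ((A.T g).obj Y)).hom ≫ Functor.LaxMonoidal.μ (A.T g) Y X

/-- A `Γ`-equivariant object `(X, u)` of `C`: an object `X` with isomorphisms `u_g : T_g X ≅ X`
such that `u_{gh} ∘ ν_{g,h} = u_g ∘ T_g(u_h)`. These are the objects of the equivariantization
`C^Γ`. -/
structure EquivObj (A : MonoidalAction Γ C) where
  obj : C
  u : ∀ g, (A.T g).obj obj ≅ obj
  compat : ∀ g h, (A.ν g h).hom.app obj ≫ (u (g * h)).hom = (A.T g).map (u h).hom ≫ (u g).hom

namespace EquivObj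

variable {A : MonoidalAction Γ C}

/-- A morphism of equivariant objects: a morphism of `C` that commutes with the `u_g`. -/
@[ext]
structure Hom (X Y : EquivObj A) where
  hom : X.obj ⟶ Y.obj
  comm : ∀ g, (X.u g).hom ≫ hom = (A.T g).map hom ≫ (Y.u g).hom

instance : Category (EquivObj A) where
  Hom := Hom
  id X := ⟨𝟙 _, by simp⟩
  comp f g := ⟨f.hom ≫ g.hom, fun x => by
    rw [← Category.assoc, f.comm, Category.assoc, g.comm, Functor.map_comp, Category.assoc]⟩

@[simp] theorem id_hom (X : EquivObj A) : Hom.hom (𝟙 X) = 𝟙 X.obj := rfl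
@[simp] theorem comp_hom {X Y Z : EquivObj A} (f : X ⟶ Y) (g : Y ⟶ Z) :
    Hom.hom (f ≫ g) = f.hom ≫ g.hom := rfl

@[ext] theorem hom_ext {X Y : EquivObj A} {f g : X ⟶ Y} (h : f.hom = g.hom) : f = g :=
  Hom.ext h

/-- The forgetful functor to `C`. -/
def forget (A : MonoidalAction Γ C) : EquivObj A ⥤ C where
  obj X := X.obj
  map f := f.hom

instance : (forget A).Faithful where
  map_injective h := hom_ext h

/-- Isomorphisms of equivariant objects from isomorphisms in `C`. -/
@[simps]
def mkIso {X Y : EquivObj A} (e : X.obj ≅ Y.obj)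
    (h : ∀ g, (X.u g).hom ≫ e.hom = (A.T g).map e.hom ≫ (Y.u g).hom) : X ≅ Y where
  hom := ⟨e.hom, h⟩
  inv := ⟨e.inv, fun g => by
    rw [← cancel_mono e.hom, Category.assoc, Category.assoc, e.inv_hom_id, h, ← Category.assoc,
      ← Functor.map_comp, e.inv_hom_id, CategoryTheory.Functor.map_id, Category.id_comp,
      Category.comp_id]⟩

section Linear

variable (X Y : EquivObj A)

instance : Zero (X ⟶ Y) := ⟨⟨0, by simp⟩⟩
instance : Add (X ⟶ Y) := ⟨fun f g => ⟨f.hom + g.hom, fun x => by simp [f.comm, g.comm]⟩⟩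
instance : Neg (X ⟶ Y) := ⟨fun f => ⟨-f.hom, fun x => by simp [f.comm]⟩⟩
instance : Sub (X ⟶ Y) := ⟨fun f g => ⟨f.hom - g.hom, fun x => by simp [f.comm, g.comm]⟩⟩
instance : SMul ℕ (X ⟶ Y) :=
  ⟨fun n f => ⟨n • f.hom, fun x => by simp [f.comm]⟩⟩
instance : SMul ℤ (X ⟶ Y) :=
  ⟨fun n f => ⟨n • f.hom, fun x => by simp [f.comm]⟩⟩
instance : SMul ℂ (X ⟶ Y) := ⟨fun c f => ⟨c • f.hom, fun x => by simp [f.comm]⟩⟩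

instance : AddCommGroup (X ⟶ Y) :=
  Function.Injective.addCommGroup (fun f : X ⟶ Y => f.hom) (fun _ _ h => hom_ext h)
    rfl (fun _ _ => rfl) (fun _ => rfl) (fun _ _ => rfl) (fun _ _ => rfl) (fun _ _ => rfl)

variable {X Y}

@[simp] theorem zero_hom : Hom.hom (0 : X ⟶ Y) = 0 := rfl
@[simp] theorem add_hom (f g : X ⟶ Y) : Hom.hom (f + g) = f.hom + g.hom := rfl
@[simp] theorem smul_hom (c : ℂ) (f : X ⟶ Y) : Hom.hom (c • f) = c • f.hom := rfl

end Linear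

instance : Preadditive (EquivObj A) where
  add_comp _ _ _ f f' g := hom_ext (Preadditive.add_comp _ _ _ f.hom f'.hom g.hom)
  comp_add _ _ _ f g g' := hom_ext (Preadditive.comp_add _ _ _ f.hom g.hom g'.hom)

instance (X Y : EquivObj A) : Module ℂ (X ⟶ Y) :=
  Function.Injective.module ℂ (⟨⟨fun f : X ⟶ Y => f.hom, rfl⟩, fun _ _ => rfl⟩ :
    (X ⟶ Y) →+ (X.obj ⟶ Y.obj)) (fun _ _ h => hom_ext h) (fun _ _ => rfl)

instance : Linear ℂ (EquivObj A) where
  smul_comp _ _ _ c f g := hom_ext (Linear.smul_comp _ _ _ c f.hom g.hom)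
  comp_smul _ _ _ f c g := hom_ext (Linear.comp_smul _ _ _ f.hom c g.hom)

section DirectSum

variable [HasBinaryBiproducts C] (A) {X Y : C}

/-- The direct sum of `T_g X ≅ X` and `T_g Y ≅ Y`. -/
@[simps]
noncomputable def sumIso (g : Γ) (u : (A.T g).obj X ≅ X) (w : (A.T g).obj Y ≅ Y) :
    (A.T g).obj (X ⊞ Y) ≅ X ⊞ Y where
  hom := (A.T g).map biprod.fst ≫ u.hom ≫ biprod.inl +
    (A.T g).map biprod.snd ≫ w.hom ≫ biprod.inr
  inv := biprod.fst ≫ u.inv ≫ (A.T g).map biprod.inl +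
    biprod.snd ≫ w.inv ≫ (A.T g).map biprod.inr
  hom_inv_id := by simp [← Functor.map_comp, ← Functor.map_add, biprod.total]
  inv_hom_id := by
    simp only [Preadditive.comp_add, Preadditive.add_comp, Category.assoc,
      ← (A.T g).map_comp_assoc, biprod.inl_fst, biprod.inl_snd, biprod.inr_fst, biprod.inr_snd]
    simp [biprod.total]

theorem map_inl_sumIso (g : Γ) (u : (A.T g).obj X ≅ X) (w : (A.T g).obj Y ≅ Y) :
    (A.T g).map biprod.inl ≫ (sumIso A g u w).hom = u.hom ≫ biprod.inl := by
  simp only [sumIso_hom, Preadditive.comp_add, ← (A.T g).map_comp_assoc, biprod.inl_fst,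
    biprod.inl_snd]
  simp

theorem map_inr_sumIso (g : Γ) (u : (A.T g).obj X ≅ X) (w : (A.T g).obj Y ≅ Y) :
    (A.T g).map biprod.inr ≫ (sumIso A g u w).hom = w.hom ≫ biprod.inr := by
  simp only [sumIso_hom, Preadditive.comp_add, ← (A.T g).map_comp_assoc, biprod.inr_fst,
    biprod.inr_snd]
  simp

theorem sumIso_hom_fst (g : Γ) (u : (A.T g).obj X ≅ X) (w : (A.T g).obj Y ≅ Y) :
    (sumIso A g u w).hom ≫ biprod.fst = (A.T g).map biprod.fst ≫ u.hom := by simp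

theorem sumIso_hom_snd (g : Γ) (u : (A.T g).obj X ≅ X) (w : (A.T g).obj Y ≅ Y) :
    (sumIso A g u w).hom ≫ biprod.snd = (A.T g).map biprod.snd ≫ w.hom := by simp

/-- The direct sum of equivariant objects. -/
noncomputable def dsum (X Y : EquivObj A) : EquivObj A where
  obj := X.obj ⊞ Y.obj
  u g := sumIso A g (X.u g) (Y.u g)
  compat g h := by
    have e1 := (A.ν g h).hom.naturality (biprod.fst : X.obj ⊞ Y.obj ⟶ X.obj)
    have e2 := (A.ν g h).hom.naturality (biprod.snd : X.obj ⊞ Y.obj ⟶ Y.obj)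
    dsimp only [Functor.comp_map] at e1 e2
    have h1 := map_inl_sumIso A g (X.u g) (Y.u g)
    have h2 := map_inr_sumIso A g (X.u g) (Y.u g)
    rw [sumIso_hom A (g * h), sumIso_hom A h]
    simp only [Preadditive.comp_add, ← reassoc_of% e1, ← reassoc_of% e2, Functor.map_add,
      Functor.map_comp, Preadditive.add_comp, Category.assoc, h1, h2,
      reassoc_of% X.compat, reassoc_of% Y.compat]

instance : HasBinaryBiproducts (EquivObj A) where
  has_binary_biproduct X Y :=
    hasBinaryBiproduct_of_total
      { pt := dsum A X Y
        fst := ⟨(biprod.fst : X.obj ⊞ Y.obj ⟶ _), fun g => sumIso_hom_fst A g _ _⟩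
        snd := ⟨(biprod.snd : X.obj ⊞ Y.obj ⟶ _), fun g => sumIso_hom_snd A g _ _⟩
        inl := ⟨(biprod.inl : _ ⟶ X.obj ⊞ Y.obj), fun g => (map_inl_sumIso A g _ _).symm⟩
        inr := ⟨(biprod.inr : _ ⟶ X.obj ⊞ Y.obj), fun g => (map_inr_sumIso A g _ _).symm⟩
        inl_fst := hom_ext biprod.inl_fst
        inl_snd := hom_ext biprod.inl_snd
        inr_fst := hom_ext biprod.inr_fst
        inr_snd := hom_ext biprod.inr_snd } (hom_ext biprod.total)

end DirectSum

section Tensor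

open Functor.LaxMonoidal

variable (A)

/-- The isomorphism `(u ⊗ w) ∘ μ⁻¹ : T_g (X ⊗ Y) ≅ X ⊗ Y` for `u : T_g X ≅ X`, `w : T_g Y ≅ Y`. -/
def tensorU (g : Γ) {X Y : C} (u : (A.T g).obj X ≅ X) (w : (A.T g).obj Y ≅ Y) :
    (A.T g).obj (X ⊗ Y) ≅ X ⊗ Y :=
  (Functor.Monoidal.μIso (A.T g) X Y).symm ≪≫ (u ⊗ᵢ w)

theorem μ_tensorU (g : Γ) {X Y : C} (u : (A.T g).obj X ≅ X) (w : (A.T g).obj Y ≅ Y) :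
    μ (A.T g) X Y ≫ (tensorU A g u w).hom = u.hom ⊗ₘ w.hom := by
  simp [tensorU]

theorem tensorU_naturality (g : Γ) {X Y X' Y' : C} (u : (A.T g).obj X ≅ X)
    (w : (A.T g).obj Y ≅ Y) (u' : (A.T g).obj X' ≅ X') (w' : (A.T g).obj Y' ≅ Y')
    (f : X ⟶ X') (f' : Y ⟶ Y') (hf : u.hom ≫ f = (A.T g).map f ≫ u'.hom)
    (hf' : w.hom ≫ f' = (A.T g).map f' ≫ w'.hom) :
    (tensorU A g u w).hom ≫ (f ⊗ₘ f') = (A.T g).map (f ⊗ₘ f') ≫ (tensorU A g u' w').hom := by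
  rw [← cancel_epi (μ (A.T g) X Y), reassoc_of% (μ_tensorU A g u w), ← μ_natural_assoc,
    μ_tensorU, tensorHom_comp_tensorHom, tensorHom_comp_tensorHom, hf, hf']

theorem tensorU_associator (g : Γ) {X Y Z : C} (u : (A.T g).obj X ≅ X)
    (w : (A.T g).obj Y ≅ Y) (z : (A.T g).obj Z ≅ Z) :
    (tensorU A g (tensorU A g u w) z).hom ≫ (α_ X Y Z).hom =
      (A.T g).map (α_ X Y Z).hom ≫ (tensorU A g u (tensorU A g w z)).hom := by
  have h := associativity (A.T g) X Y Z
  rw [← cancel_epi (μ (A.T g) (X ⊗ Y) Z), ← cancel_epi (μ (A.T g) X Y ▷ (A.T g).obj Z),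
    reassoc_of% h, μ_tensorU, reassoc_of% (μ_tensorU A g (tensorU A g u w) z),
    ← tensorHom_id, tensorHom_comp_tensorHom_assoc, ← id_tensorHom, tensorHom_comp_tensorHom,
    μ_tensorU, μ_tensorU, Category.id_comp, Category.id_comp, associator_naturality]

theorem tensorU_leftUnitor (g : Γ) {X : C} (u : (A.T g).obj X ≅ X) :
    (tensorU A g (Functor.Monoidal.εIso (A.T g)).symm u).hom ≫ (λ_ X).hom =
      (A.T g).map (λ_ X).hom ≫ u.hom := by
  have h := left_unitality (A.T g) X
  rw [← cancel_epi (μ (A.T g) (𝟙_ C) X), ← cancel_epi (ε (A.T g) ▷ (A.T g).obj X),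
    ← reassoc_of% h, reassoc_of% (μ_tensorU A g (Functor.Monoidal.εIso (A.T g)).symm u),
    ← tensorHom_id, tensorHom_comp_tensorHom_assoc]
  simp

theorem tensorU_rightUnitor (g : Γ) {X : C} (u : (A.T g).obj X ≅ X) :
    (tensorU A g u (Functor.Monoidal.εIso (A.T g)).symm).hom ≫ (ρ_ X).hom =
      (A.T g).map (ρ_ X).hom ≫ u.hom := by
  have h := right_unitality (A.T g) X
  rw [← cancel_epi (μ (A.T g) X (𝟙_ C)), ← cancel_epi ((A.T g).obj X ◁ ε (A.T g)),
    ← reassoc_of% h, reassoc_of% (μ_tensorU A g u (Functor.Monoidal.εIso (A.T g)).symm),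
    ← id_tensorHom, tensorHom_comp_tensorHom_assoc]
  simp

variable {A}

/-- The tensor product `(X, u) ⊗ (Y, w) = (X ⊗ Y, u ⊗ w)`. -/
def tensor (X Y : EquivObj A) : EquivObj A where
  obj := X.obj ⊗ Y.obj
  u g := tensorU A g (X.u g) (Y.u g)
  compat g h := by
    have h1 := NatTrans.IsMonoidal.tensor (τ := (A.ν g h).hom) X.obj Y.obj
    rw [← cancel_epi (μ (A.T h ⋙ A.T g) X.obj Y.obj), reassoc_of% h1, μ_tensorU, comp_μ,
      Category.assoc, ← (A.T g).map_comp_assoc, μ_tensorU, ← μ_natural_assoc, μ_tensorU,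
      tensorHom_comp_tensorHom, tensorHom_comp_tensorHom, X.compat, Y.compat]

/-- The unit object of `C` with its canonical equivariant structure. -/
def unit (A : MonoidalAction Γ C) : EquivObj A where
  obj := 𝟙_ C
  u g := (Functor.Monoidal.εIso (A.T g)).symm
  compat g h := by
    have h1 := NatTrans.IsMonoidal.unit (τ := (A.ν g h).hom)
    rw [← cancel_epi (ε (A.T h ⋙ A.T g)), reassoc_of% h1]
    simp [comp_ε]

instance : MonoidalCategoryStruct (EquivObj A) where
  tensorObj := tensor
  tensorUnit := unit A
  tensorHom f f' := ⟨f.hom ⊗ₘ f'.hom, fun g =>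
    tensorU_naturality A g _ _ _ _ f.hom f'.hom (f.comm g) (f'.comm g)⟩
  whiskerLeft X _ _ f := ⟨X.obj ◁ f.hom, fun g => by
    have := tensorU_naturality A g (X.u g) _ (X.u g) _ (𝟙 _) f.hom (by simp) (f.comm g)
    rw [id_tensorHom] at this
    exact this⟩
  whiskerRight f Y := ⟨f.hom ▷ Y.obj, fun g => by
    have := tensorU_naturality A g _ (Y.u g) _ (Y.u g) f.hom (𝟙 _) (f.comm g) (by simp)
    rw [tensorHom_id] at this
    exact this⟩
  associator X Y Z := mkIso (α_ X.obj Y.obj Z.obj) fun g => tensorU_associator A g _ _ _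
  leftUnitor X := mkIso (λ_ X.obj) fun g => tensorU_leftUnitor A g _
  rightUnitor X := mkIso (ρ_ X.obj) fun g => tensorU_rightUnitor A g _

instance : MonoidalCategory (EquivObj A) where
  tensorHom_def f g := hom_ext (MonoidalCategory.tensorHom_def f.hom g.hom)
  id_tensorHom_id X Y := hom_ext (MonoidalCategory.id_tensorHom_id X.obj Y.obj)
  tensorHom_comp_tensorHom f f' g g' :=
    hom_ext (MonoidalCategory.tensorHom_comp_tensorHom f.hom f'.hom g.hom g'.hom)
  whiskerLeft_id X Y := hom_ext (MonoidalCategory.whiskerLeft_id X.obj Y.obj)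
  id_whiskerRight X Y := hom_ext (MonoidalCategory.id_whiskerRight X.obj Y.obj)
  associator_naturality f f' f'' :=
    hom_ext (MonoidalCategory.associator_naturality f.hom f'.hom f''.hom)
  leftUnitor_naturality f := hom_ext (MonoidalCategory.leftUnitor_naturality f.hom)
  rightUnitor_naturality f := hom_ext (MonoidalCategory.rightUnitor_naturality f.hom)
  pentagon W X Y Z := hom_ext (MonoidalCategory.pentagon W.obj X.obj Y.obj Z.obj)
  triangle X Y := hom_ext (MonoidalCategory.triangle X.obj Y.obj)

end Tensor

end EquivObj
end General

section Pointed

variable {G : Type*} [AddCommGroup G]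

/-- A normalized abelian 3-cocycle `(ω, c)` on `G` with values in `ℂˣ`, that is, the associativity
and commutativity scalars of a braided pointed category with group of simple objects `G`. Its
quadratic form is `g ↦ c g g`. -/
structure AbelianCocycle (G : Type*) [AddCommGroup G] where
  ω : G → G → G → ℂˣ
  c : G → G → ℂˣ
  normalized : ∀ a b, ω a 0 b = 1
  pentagon : ∀ a b c d, ω a b c * ω a (b + c) d * ω b c d = ω (a + b) c d * ω a b (c + d)
  hexagon_forward : ∀ x y z, ω x y z * c x (y + z) * ω y z x = c x y * ω y x z * c x z
  hexagon_reverse : ∀ x y z,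
    (ω x y z)⁻¹ * c (x + y) z * (ω z x y)⁻¹ = c y z * (ω x z y)⁻¹ * c x z

variable [Fintype G] [DecidableEq G]

/-- The objects of the pointed category of a finite abelian group `G` and an abelian 3-cocycle:
finite-dimensional `G`-graded vector spaces over `ℂ`. The grading `V = ⊕_g V_g` is given by the
projections onto its components. -/
structure PointedCat (A : AbelianCocycle G) where
  V : Type
  [addCommGroup : AddCommGroup V]
  [module : Module ℂ V]
  [finite : FiniteDimensional ℂ V]
  proj : G → V →ₗ[ℂ] V
  proj_proj : ∀ g h v, proj g (proj h v) = if g = h then proj h v else 0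
  sum_proj : ∀ v, ∑ g, proj g v = v

attribute [instance] PointedCat.addCommGroup PointedCat.module PointedCat.finite

namespace PointedCat

variable {A : AbelianCocycle G}

/-- `v` is homogeneous of degree `g`. -/
def IsHomog (X : PointedCat A) (g : G) (v : X.V) : Prop := X.proj g v = v

theorem isHomog_proj (X : PointedCat A) (g : G) (v : X.V) : X.IsHomog g (X.proj g v) := by
  simp [IsHomog, X.proj_proj]

theorem IsHomog.proj {X : PointedCat A} {g : G} {v : X.V} (h : X.IsHomog g v) (k : G) :
    X.proj k v = if k = g then v else 0 := by
  rw [← h, X.proj_proj]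

theorem isHomog_iff {X : PointedCat A} {g : G} {v : X.V} :
    X.IsHomog g v ↔ ∀ k, X.proj k v = if k = g then v else 0 :=
  ⟨fun h => h.proj, fun h => (h g).trans (if_pos rfl)⟩

theorem linearMap_ext {X : PointedCat A} {W : Type*} [AddCommGroup W] [Module ℂ W]
    {f f' : X.V →ₗ[ℂ] W} (h : ∀ g v, X.IsHomog g v → f v = f' v) : f = f' := by
  ext v
  rw [← X.sum_proj v, map_sum, map_sum]
  exact Finset.sum_congr rfl fun g _ => h g _ (X.isHomog_proj g v)

/-- Morphisms are the linear maps that preserve the grading. -/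
@[ext]
structure Hom (X Y : PointedCat A) where
  lin : X.V →ₗ[ℂ] Y.V
  comm : ∀ g v, Y.proj g (lin v) = lin (X.proj g v)

/-- A linear map that sends homogeneous vectors to homogeneous vectors of the same degree. -/
def Hom.mk' {X Y : PointedCat A} (f : X.V →ₗ[ℂ] Y.V)
    (h : ∀ g v, X.IsHomog g v → Y.IsHomog g (f v)) : Hom X Y where
  lin := f
  comm k v := by
    refine LinearMap.congr_fun (f := Y.proj k ∘ₗ f) (g := f ∘ₗ X.proj k)
      (linearMap_ext fun g v hv => ?_) v
    simp only [LinearMap.comp_apply, hv.proj k, (h g v hv).proj k]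
    split_ifs <;> simp

instance : Category (PointedCat A) where
  Hom := Hom
  id X := ⟨LinearMap.id, fun _ _ => rfl⟩
  comp f g := ⟨g.lin ∘ₗ f.lin, fun x v => by simp [f.comm, g.comm]⟩

@[simp] theorem id_lin (X : PointedCat A) : Hom.lin (𝟙 X) = LinearMap.id := rfl
@[simp] theorem comp_lin {X Y Z : PointedCat A} (f : X ⟶ Y) (g : Y ⟶ Z) :
    Hom.lin (f ≫ g) = g.lin ∘ₗ f.lin := rfl

@[ext] theorem hom_ext {X Y : PointedCat A} {f g : X ⟶ Y} (h : f.lin = g.lin) : f = g :=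
  Hom.ext h

theorem hom_ext_homog {X Y : PointedCat A} {f f' : X ⟶ Y}
    (h : ∀ g v, X.IsHomog g v → f.lin v = f'.lin v) : f = f' :=
  hom_ext (linearMap_ext h)

theorem IsHomog.map {X Y : PointedCat A} (f : X ⟶ Y) {g : G} {v : X.V} (h : X.IsHomog g v) :
    Y.IsHomog g (f.lin v) := by
  rw [IsHomog, f.comm, h]

/-- A linear equivalence commuting with the projections is an isomorphism. -/
@[simps]
def mkIso {X Y : PointedCat A} (e : X.V ≃ₗ[ℂ] Y.V)
    (h : ∀ g v, Y.proj g (e v) = e (X.proj g v)) : X ≅ Y where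
  hom := ⟨e.toLinearMap, h⟩
  inv := ⟨e.symm.toLinearMap, fun g v => e.injective (by
    have := h g (e.symm v)
    rw [e.apply_symm_apply] at this
    simp [this])⟩
  hom_inv_id := hom_ext (by ext; simp)
  inv_hom_id := hom_ext (by ext; simp)

section Linear

variable (X Y : PointedCat A)

instance : Zero (X ⟶ Y) := ⟨⟨0, by simp⟩⟩
instance : Add (X ⟶ Y) := ⟨fun f g => ⟨f.lin + g.lin, fun x => by simp [f.comm, g.comm]⟩⟩
instance : Neg (X ⟶ Y) := ⟨fun f => ⟨-f.lin, fun x => by simp [f.comm]⟩⟩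
instance : Sub (X ⟶ Y) := ⟨fun f g => ⟨f.lin - g.lin, fun x => by simp [f.comm, g.comm]⟩⟩
instance : SMul ℕ (X ⟶ Y) := ⟨fun n f => ⟨n • f.lin, fun x => by simp [f.comm]⟩⟩
instance : SMul ℤ (X ⟶ Y) := ⟨fun n f => ⟨n • f.lin, fun x => by simp [f.comm]⟩⟩
instance : SMul ℂ (X ⟶ Y) := ⟨fun c f => ⟨c • f.lin, fun x => by simp [f.comm]⟩⟩

instance : AddCommGroup (X ⟶ Y) :=
  Function.Injective.addCommGroup (fun f : X ⟶ Y => f.lin) (fun _ _ h => hom_ext h)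
    rfl (fun _ _ => rfl) (fun _ => rfl) (fun _ _ => rfl) (fun _ _ => rfl) (fun _ _ => rfl)

instance : Module ℂ (X ⟶ Y) :=
  Function.Injective.module ℂ (⟨⟨fun f : X ⟶ Y => f.lin, rfl⟩, fun _ _ => rfl⟩ :
    (X ⟶ Y) →+ (X.V →ₗ[ℂ] Y.V)) (fun _ _ h => hom_ext h) (fun _ _ => rfl)

end Linear

instance : Preadditive (PointedCat A) where
  add_comp _ _ _ _ _ _ := hom_ext (LinearMap.comp_add _ _ _)
  comp_add _ _ _ _ _ _ := hom_ext (LinearMap.add_comp _ _ _)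

instance : Linear ℂ (PointedCat A) where
  smul_comp _ _ _ _ _ _ := hom_ext (LinearMap.comp_smul _ _ _)
  comp_smul _ _ _ _ _ _ := hom_ext (LinearMap.smul_comp _ _ _)

/-- The direct sum of graded vector spaces. -/
abbrev dsum (X Y : PointedCat A) : PointedCat A where
  V := X.V × Y.V
  proj g := (X.proj g).prodMap (Y.proj g)
  proj_proj g h v := by
    ext <;> simp [X.proj_proj, Y.proj_proj] <;> split_ifs <;> rfl
  sum_proj v := by
    ext
    · simp [Prod.fst_sum, X.sum_proj]
    · simp [Prod.snd_sum, Y.sum_proj]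

instance : HasBinaryBiproducts (PointedCat A) where
  has_binary_biproduct X Y :=
    hasBinaryBiproduct_of_total
      { pt := dsum X Y
        fst := ⟨LinearMap.fst ℂ X.V Y.V, fun _ _ => rfl⟩
        snd := ⟨LinearMap.snd ℂ X.V Y.V, fun _ _ => rfl⟩
        inl := ⟨LinearMap.inl ℂ X.V Y.V, fun g _ => Prod.ext rfl (map_zero (Y.proj g))⟩
        inr := ⟨LinearMap.inr ℂ X.V Y.V, fun g _ => Prod.ext (map_zero (X.proj g)) rfl⟩
        inl_fst := hom_ext (LinearMap.fst_comp_inl ℂ _ _)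
        inl_snd := hom_ext (LinearMap.snd_comp_inl ℂ _ _)
        inr_fst := hom_ext (LinearMap.fst_comp_inr ℂ _ _)
        inr_snd := hom_ext (LinearMap.snd_comp_inr ℂ _ _) }
      (hom_ext (LinearMap.coprod_inl_inr))

section Tensor

theorem tensor_ext {X Y : PointedCat A} {W : Type*} [AddCommGroup W] [Module ℂ W]
    {f f' : X.V ⊗[ℂ] Y.V →ₗ[ℂ] W}
    (h : ∀ a b u v, X.IsHomog a u → Y.IsHomog b v → f (u ⊗ₜ v) = f' (u ⊗ₜ v)) : f = f' := by
  refine TensorProduct.ext (linearMap_ext fun a u hu => linearMap_ext fun b v hv => ?_)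
  exact h a b u v hu hv

/-- The endomorphism of `X ⊗ Y` acting on `X_a ⊗ Y_b` as the scalar `f a b`. -/
def diag₂ (X Y : PointedCat A) (f : G → G → ℂ) : X.V ⊗[ℂ] Y.V →ₗ[ℂ] X.V ⊗[ℂ] Y.V :=
  ∑ a, ∑ b, f a b • TensorProduct.map (X.proj a) (Y.proj b)

theorem diag₂_tmul {X Y : PointedCat A} (f : G → G → ℂ) {a b : G} {u : X.V} {v : Y.V}
    (hu : X.IsHomog a u) (hv : Y.IsHomog b v) :
    diag₂ X Y f (u ⊗ₜ v) = f a b • (u ⊗ₜ[ℂ] v) := by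
  simp only [diag₂, LinearMap.sum_apply, LinearMap.smul_apply, TensorProduct.map_tmul, hu.proj,
    hv.proj]
  rw [Finset.sum_eq_single a (fun k _ hk => by simp [hk]) (by simp),
    Finset.sum_eq_single b (fun k _ hk => by simp [hk]) (by simp)]
  simp

/-- The tensor product of graded vector spaces: `(X ⊗ Y)_k` is the sum of the `X_a ⊗ Y_b` with
`a + b = k`. -/
abbrev tensor (X Y : PointedCat A) : PointedCat A where
  V := X.V ⊗[ℂ] Y.V
  proj k := diag₂ X Y fun a b => if a + b = k then 1 else 0
  proj_proj k l v := by
    refine LinearMap.congr_fun (f := diag₂ X Y (fun a b => if a + b = k then 1 else 0) ∘ₗ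
      diag₂ X Y (fun a b => if a + b = l then 1 else 0))
      (g := if k = l then diag₂ X Y (fun a b => if a + b = l then 1 else 0) else 0)
      (tensor_ext fun a b u v hu hv => ?_) v |>.trans ?_
    · rw [LinearMap.comp_apply, diag₂_tmul _ hu hv, map_smul, diag₂_tmul _ hu hv]
      split_ifs with h1 h2 h3 <;> simp_all [diag₂_tmul _ hu hv]
    · split_ifs <;> rfl
  sum_proj v := by
    rw [← LinearMap.sum_apply]
    refine LinearMap.congr_fun (g := LinearMap.id) (tensor_ext fun a b u v hu hv => ?_) v
    simp [LinearMap.sum_apply, diag₂_tmul _ hu hv]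

theorem IsHomog.tmul {X Y : PointedCat A} {a b : G} {u : X.V} {v : Y.V}
    (hu : X.IsHomog a u) (hv : Y.IsHomog b v) :
    (tensor X Y).IsHomog (a + b) (u ⊗ₜ[ℂ] v : X.V ⊗[ℂ] Y.V) := by
  simp [IsHomog, diag₂_tmul _ hu hv]

theorem tensor_ext₃ {X Y Z : PointedCat A} {W : Type*} [AddCommGroup W] [Module ℂ W]
    {f f' : (X.V ⊗[ℂ] Y.V) ⊗[ℂ] Z.V →ₗ[ℂ] W}
    (h : ∀ a b c u v w, X.IsHomog a u → Y.IsHomog b v → Z.IsHomog c w →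
      f ((u ⊗ₜ v) ⊗ₜ w) = f' ((u ⊗ₜ v) ⊗ₜ w)) : f = f' := by
  refine TensorProduct.ext (tensor_ext fun a b u v hu hv => linearMap_ext fun c w hw => ?_)
  exact h a b c u v w hu hv hw

theorem tensor_ext₃' {X Y Z : PointedCat A} {W : Type*} [AddCommGroup W] [Module ℂ W]
    {f f' : X.V ⊗[ℂ] (Y.V ⊗[ℂ] Z.V) →ₗ[ℂ] W}
    (h : ∀ a b c u v w, X.IsHomog a u → Y.IsHomog b v → Z.IsHomog c w →
      f (u ⊗ₜ (v ⊗ₜ w)) = f' (u ⊗ₜ (v ⊗ₜ w))) : f = f' := by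
  refine TensorProduct.ext (linearMap_ext fun a u hu => tensor_ext fun b c v w hv hw => ?_)
  exact h a b c u v w hu hv hw

theorem tensor_ext₄ {W X Y Z : PointedCat A} {U : Type*} [AddCommGroup U] [Module ℂ U]
    {f f' : ((W.V ⊗[ℂ] X.V) ⊗[ℂ] Y.V) ⊗[ℂ] Z.V →ₗ[ℂ] U}
    (h : ∀ a b c d s u v w, W.IsHomog a s → X.IsHomog b u → Y.IsHomog c v → Z.IsHomog d w →
      f (((s ⊗ₜ u) ⊗ₜ v) ⊗ₜ w) = f' (((s ⊗ₜ u) ⊗ₜ v) ⊗ₜ w)) : f = f' := by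
  refine TensorProduct.ext (tensor_ext₃ fun a b c s u v hs hu hv =>
    linearMap_ext fun d w hw => ?_)
  exact h a b c d s u v w hs hu hv hw

/-- A linear map on `X ⊗ Y` preserving degrees of pure tensors is a morphism. -/
def tensorHomMk {X Y Z : PointedCat A} (f : X.V ⊗[ℂ] Y.V →ₗ[ℂ] Z.V)
    (h : ∀ a b u v, X.IsHomog a u → Y.IsHomog b v → Z.IsHomog (a + b) (f (u ⊗ₜ v))) :
    tensor X Y ⟶ Z where
  lin := f
  comm k x := by
    refine LinearMap.congr_fun (f := Z.proj k ∘ₗ f) (g := f ∘ₗ (tensor X Y).proj k)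
      (tensor_ext fun a b u v hu hv => ?_) x
    rw [LinearMap.comp_apply, LinearMap.comp_apply, (hu.tmul hv).proj, (h a b u v hu hv).proj]
    split_ifs <;> simp

/-- The endomorphism of `(X ⊗ Y) ⊗ Z` acting on `(X_a ⊗ Y_b) ⊗ Z_c` as the scalar `f a b c`. -/
def diag₃ (X Y Z : PointedCat A) (f : G → G → G → ℂ) :
    (X.V ⊗[ℂ] Y.V) ⊗[ℂ] Z.V →ₗ[ℂ] (X.V ⊗[ℂ] Y.V) ⊗[ℂ] Z.V :=
  ∑ c, TensorProduct.map (diag₂ X Y fun a b => f a b c) (Z.proj c)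

theorem diag₃_tmul {X Y Z : PointedCat A} (f : G → G → G → ℂ) {a b c : G} {u : X.V} {v : Y.V}
    {w : Z.V} (hu : X.IsHomog a u) (hv : Y.IsHomog b v) (hw : Z.IsHomog c w) :
    diag₃ X Y Z f ((u ⊗ₜ v) ⊗ₜ w) = f a b c • ((u ⊗ₜ[ℂ] v) ⊗ₜ[ℂ] w) := by
  simp only [diag₃, LinearMap.sum_apply, TensorProduct.map_tmul, hw.proj, diag₂_tmul _ hu hv]
  rw [Finset.sum_eq_single c (fun k _ hk => by simp [hk]) (by simp)]
  simp [TensorProduct.smul_tmul']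

/-- The automorphism of `X ⊗ Y` acting on `X_a ⊗ Y_b` as the invertible scalar `f a b`. -/
def diagEquiv₂ (X Y : PointedCat A) (f : G → G → ℂˣ) : X.V ⊗[ℂ] Y.V ≃ₗ[ℂ] X.V ⊗[ℂ] Y.V :=
  LinearEquiv.ofLinearMap (diag₂ X Y fun a b => f a b) (diag₂ X Y fun a b => ((f a b)⁻¹ : ℂˣ))
    (tensor_ext fun a b u v hu hv => by simp [diag₂_tmul _ hu hv, smul_smul])
    (tensor_ext fun a b u v hu hv => by simp [diag₂_tmul _ hu hv, smul_smul])

theorem diagEquiv₂_tmul {X Y : PointedCat A} (f : G → G → ℂˣ) {a b : G} {u : X.V} {v : Y.V}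
    (hu : X.IsHomog a u) (hv : Y.IsHomog b v) :
    diagEquiv₂ X Y f (u ⊗ₜ v) = (f a b : ℂ) • (u ⊗ₜ[ℂ] v) := diag₂_tmul _ hu hv

/-- The automorphism of `(X ⊗ Y) ⊗ Z` acting on `(X_a ⊗ Y_b) ⊗ Z_c` as the invertible scalar
`f a b c`. -/
def diagEquiv₃ (X Y Z : PointedCat A) (f : G → G → G → ℂˣ) :
    (X.V ⊗[ℂ] Y.V) ⊗[ℂ] Z.V ≃ₗ[ℂ] (X.V ⊗[ℂ] Y.V) ⊗[ℂ] Z.V :=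
  LinearEquiv.ofLinearMap (diag₃ X Y Z fun a b c => f a b c)
    (diag₃ X Y Z fun a b c => ((f a b c)⁻¹ : ℂˣ))
    (tensor_ext₃ fun a b c u v w hu hv hw => by simp [diag₃_tmul _ hu hv hw, smul_smul])
    (tensor_ext₃ fun a b c u v w hu hv hw => by simp [diag₃_tmul _ hu hv hw, smul_smul])

theorem diagEquiv₃_tmul {X Y Z : PointedCat A} (f : G → G → G → ℂˣ) {a b c : G} {u : X.V}
    {v : Y.V} {w : Z.V} (hu : X.IsHomog a u) (hv : Y.IsHomog b v) (hw : Z.IsHomog c w) :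
    diagEquiv₃ X Y Z f ((u ⊗ₜ v) ⊗ₜ w) = (f a b c : ℂ) • ((u ⊗ₜ[ℂ] v) ⊗ₜ[ℂ] w) :=
  diag₃_tmul _ hu hv hw

/-- Isomorphisms out of a tensor product. -/
def tensorIsoMk {X Y Z : PointedCat A} (e : X.V ⊗[ℂ] Y.V ≃ₗ[ℂ] Z.V)
    (h : ∀ a b u v, X.IsHomog a u → Y.IsHomog b v → Z.IsHomog (a + b) (e (u ⊗ₜ v))) :
    tensor X Y ≅ Z :=
  mkIso (X := tensor X Y) e (tensorHomMk e.toLinearMap h).comm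

theorem IsHomog.smul {X : PointedCat A} {g : G} {v : X.V} (h : X.IsHomog g v) (c : ℂ) :
    X.IsHomog g (c • v) := by
  rw [IsHomog, map_smul, h]

/-- The vector space `ℂ` in degree `b`. -/
abbrev simple (A : AbelianCocycle G) (b : G) : PointedCat A where
  V := ℂ
  proj g := if g = b then LinearMap.id else 0
  proj_proj g h v := by split_ifs <;> simp_all
  sum_proj v := by
    rw [Finset.sum_eq_single b (fun k _ hk => by simp [hk]) (by simp)]
    simp

theorem isHomog_simple (b : G) (v : ℂ) : (simple A b).IsHomog b v := by
  simp [IsHomog]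

theorem simple_degree {b a : G} {v : ℂ} (h : (simple A b).IsHomog a v) (hv : v ≠ 0) : a = b := by
  by_contra hab
  simp [IsHomog, hab] at h
  exact hv h.symm

/-- The associator: `ω a b c` times the usual one on `(X_a ⊗ Y_b) ⊗ Z_c`. -/
def assoc (X Y Z : PointedCat A) : tensor (tensor X Y) Z ≅ tensor X (tensor Y Z) :=
  mkIso (X := tensor (tensor X Y) Z) (Y := tensor X (tensor Y Z))
    (diagEquiv₃ X Y Z A.ω ≪≫ₗ TensorProduct.assoc ℂ X.V Y.V Z.V) fun k x => by
    refine LinearMap.congr_fun (f := (tensor X (tensor Y Z)).proj k ∘ₗ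
      (diagEquiv₃ X Y Z A.ω ≪≫ₗ TensorProduct.assoc ℂ X.V Y.V Z.V).toLinearMap)
      (g := (diagEquiv₃ X Y Z A.ω ≪≫ₗ TensorProduct.assoc ℂ X.V Y.V Z.V).toLinearMap ∘ₗ
        (tensor (tensor X Y) Z).proj k)
      (tensor_ext₃ fun a b c u v w hu hv hw => ?_) x
    have h1 := ((hu.tmul hv).tmul hw).proj k
    have h2 := (hu.tmul (hv.tmul hw)).proj k
    simp only [LinearMap.comp_apply, LinearEquiv.coe_coe, LinearEquiv.trans_apply,
      diagEquiv₃_tmul _ hu hv hw, map_smul, TensorProduct.assoc_tmul, h1, h2, add_assoc]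
    split_ifs <;> simp [diagEquiv₃_tmul _ hu hv hw]

theorem assoc_hom_tmul {X Y Z : PointedCat A} {a b c : G} {u : X.V}
    {v : Y.V} {w : Z.V} (hu : X.IsHomog a u) (hv : Y.IsHomog b v) (hw : Z.IsHomog c w) :
    (assoc X Y Z).hom.lin ((u ⊗ₜ[ℂ] v) ⊗ₜ[ℂ] w : (X.V ⊗[ℂ] Y.V) ⊗[ℂ] Z.V) =
      (A.ω a b c : ℂ) • (u ⊗ₜ[ℂ] (v ⊗ₜ[ℂ] w) : X.V ⊗[ℂ] (Y.V ⊗[ℂ] Z.V)) := by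
  change TensorProduct.assoc ℂ X.V Y.V Z.V (diagEquiv₃ X Y Z A.ω ((u ⊗ₜ[ℂ] v) ⊗ₜ[ℂ] w)) = _
  rw [diagEquiv₃_tmul _ hu hv hw, map_smul, TensorProduct.assoc_tmul]

theorem assoc_inv_tmul {X Y Z : PointedCat A} {a b c : G} {u : X.V}
    {v : Y.V} {w : Z.V} (hu : X.IsHomog a u) (hv : Y.IsHomog b v) (hw : Z.IsHomog c w) :
    (assoc X Y Z).inv.lin (u ⊗ₜ[ℂ] (v ⊗ₜ[ℂ] w) : X.V ⊗[ℂ] (Y.V ⊗[ℂ] Z.V)) =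
      ((A.ω a b c)⁻¹ : ℂ) • ((u ⊗ₜ[ℂ] v) ⊗ₜ[ℂ] w : (X.V ⊗[ℂ] Y.V) ⊗[ℂ] Z.V) := by
  change diag₃ X Y Z (fun a b c => ((A.ω a b c)⁻¹ : ℂˣ)) ((TensorProduct.assoc ℂ X.V Y.V Z.V).symm
    (u ⊗ₜ[ℂ] (v ⊗ₜ[ℂ] w))) = _
  rw [TensorProduct.assoc_symm_tmul, diag₃_tmul _ hu hv hw]
  simp

/-- The braiding: `c a b` times the flip on `X_a ⊗ Y_b`. -/
def braid (X Y : PointedCat A) : tensor X Y ≅ tensor Y X :=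
  tensorIsoMk (diagEquiv₂ X Y A.c ≪≫ₗ TensorProduct.comm ℂ X.V Y.V) fun a b u v hu hv => by
    rw [LinearEquiv.trans_apply, diagEquiv₂_tmul _ hu hv, map_smul, TensorProduct.comm_tmul,
      add_comm]
    exact (hv.tmul hu).smul _

theorem braid_hom_tmul {X Y : PointedCat A} {a b : G} {u : X.V} {v : Y.V}
    (hu : X.IsHomog a u) (hv : Y.IsHomog b v) :
    (braid X Y).hom.lin (u ⊗ₜ[ℂ] v : X.V ⊗[ℂ] Y.V) =
      (A.c a b : ℂ) • (v ⊗ₜ[ℂ] u : Y.V ⊗[ℂ] X.V) := by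
  change TensorProduct.comm ℂ X.V Y.V (diagEquiv₂ X Y A.c (u ⊗ₜ[ℂ] v)) = _
  rw [diagEquiv₂_tmul _ hu hv, map_smul, TensorProduct.comm_tmul]

instance : MonoidalCategoryStruct (PointedCat A) where
  tensorObj := tensor
  tensorUnit := simple A 0
  tensorHom f f' := tensorHomMk (Z := tensor _ _) (TensorProduct.map f.lin f'.lin)
    fun a b u v hu hv => (hu.map f).tmul (hv.map f')
  whiskerLeft X _ _ f := tensorHomMk (Z := tensor _ _) (TensorProduct.map LinearMap.id f.lin)
    fun a b u v hu hv => hu.tmul (hv.map f)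
  whiskerRight f Y := tensorHomMk (Z := tensor _ _) (TensorProduct.map f.lin LinearMap.id)
    fun a b u v hu hv => (hu.map f).tmul hv
  associator := assoc
  leftUnitor X := tensorIsoMk (X := simple A 0) (TensorProduct.lid ℂ X.V) fun a b u v hu hv => by
    rw [TensorProduct.lid_tmul]
    by_cases h : u = 0
    · simp [h, IsHomog]
    · rw [simple_degree hu h, zero_add]
      exact hv.smul u
  rightUnitor X := tensorIsoMk (Y := simple A 0) (TensorProduct.rid ℂ X.V) fun a b u v hu hv => by
    rw [TensorProduct.rid_tmul]
    by_cases h : v = 0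
    · simp [h, IsHomog]
    · rw [simple_degree hv h, add_zero]
      exact hu.smul v

/-- The pure tensor `u ⊗ v` as an element of `X ⊗ Y`. -/
def tm {X Y : PointedCat A} (u : X.V) (v : Y.V) : (X ⊗ Y).V := (u ⊗ₜ[ℂ] v : X.V ⊗[ℂ] Y.V)

theorem smul_tm {X Y : PointedCat A} (r : ℂ) (u : X.V) (v : Y.V) :
    tm (r • u) v = r • tm u v := TensorProduct.smul_tmul' r u v

theorem tm_smul {X Y : PointedCat A} (r : ℂ) (u : X.V) (v : Y.V) :
    tm u (r • v) = r • tm u v := TensorProduct.tmul_smul r u v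

theorem IsHomog.tm {X Y : PointedCat A} {a b : G} {u : X.V} {v : Y.V}
    (hu : X.IsHomog a u) (hv : Y.IsHomog b v) : (X ⊗ Y).IsHomog (a + b) (tm u v) := hu.tmul hv

theorem hom_ext₂ {X Y Z : PointedCat A} {f f' : X ⊗ Y ⟶ Z}
    (h : ∀ a b u v, X.IsHomog a u → Y.IsHomog b v → f.lin (tm u v) = f'.lin (tm u v)) :
    f = f' := hom_ext (tensor_ext h)

theorem hom_ext₃ {X Y Z W : PointedCat A} {f f' : (X ⊗ Y) ⊗ Z ⟶ W}
    (h : ∀ a b c u v w, X.IsHomog a u → Y.IsHomog b v → Z.IsHomog c w →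
      f.lin (tm (tm u v) w) = f'.lin (tm (tm u v) w)) : f = f' := hom_ext (tensor_ext₃ h)

theorem hom_ext₃' {X Y Z W : PointedCat A} {f f' : X ⊗ (Y ⊗ Z) ⟶ W}
    (h : ∀ a b c u v w, X.IsHomog a u → Y.IsHomog b v → Z.IsHomog c w →
      f.lin (tm u (tm v w)) = f'.lin (tm u (tm v w))) : f = f' := hom_ext (tensor_ext₃' h)

theorem hom_ext₄ {W X Y Z U : PointedCat A} {f f' : ((W ⊗ X) ⊗ Y) ⊗ Z ⟶ U}
    (h : ∀ a b c d s u v w, W.IsHomog a s → X.IsHomog b u → Y.IsHomog c v → Z.IsHomog d w →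
      f.lin (tm (tm (tm s u) v) w) = f'.lin (tm (tm (tm s u) v) w)) : f = f' :=
  hom_ext (tensor_ext₄ h)

theorem hom_comp_apply {X Y Z : PointedCat A} (f : X ⟶ Y) (g : Y ⟶ Z) (v : X.V) :
    Hom.lin (f ≫ g) v = g.lin (f.lin v) := rfl

theorem tensorHom_tm {X X' Y Y' : PointedCat A} (f : X ⟶ X') (f' : Y ⟶ Y') (u : X.V)
    (v : Y.V) : Hom.lin (f ⊗ₘ f') (tm u v) = tm (f.lin u) (f'.lin v) := rfl

theorem whiskerLeft_tm (X : PointedCat A) {Y Y' : PointedCat A} (f : Y ⟶ Y') (u : X.V)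
    (v : Y.V) : Hom.lin (X ◁ f) (tm u v) = tm u (f.lin v) := rfl

theorem whiskerRight_tm {X X' : PointedCat A} (f : X ⟶ X') (Y : PointedCat A) (u : X.V)
    (v : Y.V) : Hom.lin (f ▷ Y) (tm u v) = tm (f.lin u) v := rfl

theorem associator_hom_tm {X Y Z : PointedCat A} {a b c : G} {u : X.V}
    {v : Y.V} {w : Z.V} (hu : X.IsHomog a u) (hv : Y.IsHomog b v) (hw : Z.IsHomog c w) :
    (α_ X Y Z).hom.lin (tm (tm u v) w) = (A.ω a b c : ℂ) • tm u (tm v w) :=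
  assoc_hom_tmul hu hv hw

theorem associator_inv_tm {X Y Z : PointedCat A} {a b c : G} {u : X.V}
    {v : Y.V} {w : Z.V} (hu : X.IsHomog a u) (hv : Y.IsHomog b v) (hw : Z.IsHomog c w) :
    (α_ X Y Z).inv.lin (tm u (tm v w)) = ((A.ω a b c)⁻¹ : ℂ) • tm (tm u v) w :=
  assoc_inv_tmul hu hv hw

theorem leftUnitor_tm (X : PointedCat A) (r : (𝟙_ (PointedCat A)).V) (v : X.V) :
    (λ_ X).hom.lin (tm r v) = (show ℂ from r) • v := TensorProduct.lid_tmul v (show ℂ from r)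

theorem rightUnitor_tm (X : PointedCat A) (r : (𝟙_ (PointedCat A)).V) (v : X.V) :
    (ρ_ X).hom.lin (tm v r) = (show ℂ from r) • v := TensorProduct.rid_tmul v (show ℂ from r)

theorem unit_degree {a : G} {r : (𝟙_ (PointedCat A)).V}
    (h : (𝟙_ (PointedCat A)).IsHomog a r) : a = 0 ∨ r = 0 := by
  by_cases hr : r = 0
  · exact Or.inr hr
  · exact Or.inl (simple_degree h hr)

instance : MonoidalCategory (PointedCat A) where
  tensorHom_def f g := hom_ext₂ fun _ _ u v _ _ => rfl
  id_tensorHom_id X Y := hom_ext₂ fun _ _ u v _ _ => rfl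
  tensorHom_comp_tensorHom f f' g g' := hom_ext₂ fun _ _ u v _ _ => rfl
  whiskerLeft_id X Y := hom_ext₂ fun _ _ u v _ _ => rfl
  id_whiskerRight X Y := hom_ext₂ fun _ _ u v _ _ => rfl
  associator_naturality f f' f'' := hom_ext₃ fun a b c u v w hu hv hw => by
    simp only [hom_comp_apply, associator_hom_tm hu hv hw, map_smul,
      tensorHom_tm, associator_hom_tm (hu.map f) (hv.map f') (hw.map f'')]
  leftUnitor_naturality {X Y} f := hom_ext₂ fun a b u v hu hv => by
    simp only [hom_comp_apply, whiskerLeft_tm, leftUnitor_tm, map_smul]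
  rightUnitor_naturality f := hom_ext₂ fun a b u v hu hv => by
    simp only [hom_comp_apply, whiskerRight_tm, rightUnitor_tm, map_smul]
  pentagon W X Y Z := hom_ext₄ fun a b c d s u v w hs hu hv hw => by
    have h := congrArg (fun x : ℂˣ => (x : ℂ)) (A.pentagon a b c d)
    simp only [Units.val_mul, mul_assoc] at h
    simp only [hom_comp_apply, whiskerRight_tm, whiskerLeft_tm,
      associator_hom_tm hs hu hv, associator_hom_tm hs (hu.tm hv) hw,
      associator_hom_tm hu hv hw, associator_hom_tm (hs.tm hu) hv hw,
      associator_hom_tm hs hu (hv.tm hw), map_smul, tm_smul, smul_tm, smul_smul]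
    rw [h]
  triangle X Y := hom_ext₃ fun a b c u v w hu hv hw => by
    simp only [hom_comp_apply, whiskerRight_tm, whiskerLeft_tm, associator_hom_tm hu hv hw,
      map_smul, leftUnitor_tm, rightUnitor_tm, tm_smul, smul_tm]
    rcases unit_degree hv with rfl | rfl
    · simp [A.normalized]
    · have : (show ℂ from (0 : (𝟙_ (PointedCat A)).V)) = 0 := rfl
      simp [this]

instance : BraidedCategory (PointedCat A) where
  braiding := braid
  braiding_naturality_right X {Y Z} f := hom_ext₂ fun a b u v hu hv => by
    have h1 : (braid X Y).hom.lin (tm u v) = (A.c a b : ℂ) • tm v u := braid_hom_tmul hu hv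
    have h2 : (braid X Z).hom.lin (tm u (f.lin v)) = (A.c a b : ℂ) • tm (f.lin v) u :=
      braid_hom_tmul hu (hv.map f)
    simp only [hom_comp_apply, whiskerLeft_tm, whiskerRight_tm, h1, h2, map_smul]
  braiding_naturality_left {X Y} f Z := hom_ext₂ fun a b u v hu hv => by
    have h1 : (braid X Z).hom.lin (tm u v) = (A.c a b : ℂ) • tm v u := braid_hom_tmul hu hv
    have h2 : (braid Y Z).hom.lin (tm (f.lin u) v) = (A.c a b : ℂ) • tm v (f.lin u) :=
      braid_hom_tmul (hu.map f) hv
    simp only [hom_comp_apply, whiskerLeft_tm, whiskerRight_tm, h1, h2, map_smul]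
  hexagon_forward X Y Z := hom_ext₃ fun a b c u v w hu hv hw => by
    have h := congrArg (fun x : ℂˣ => (x : ℂ)) (A.hexagon_forward a b c)
    simp only [Units.val_mul, mul_assoc] at h
    have h1 : (braid X (Y ⊗ Z)).hom.lin (tm u (tm v w)) = (A.c a (b + c) : ℂ) • tm (tm v w) u :=
      braid_hom_tmul hu (hv.tm hw)
    have h2 : (braid X Y).hom.lin (tm u v) = (A.c a b : ℂ) • tm v u := braid_hom_tmul hu hv
    have h3 : (braid X Z).hom.lin (tm u w) = (A.c a c : ℂ) • tm w u := braid_hom_tmul hu hw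
    simp only [hom_comp_apply, whiskerRight_tm, whiskerLeft_tm, associator_hom_tm hu hv hw, h1, h2, h3,
      associator_hom_tm hv hw hu, associator_hom_tm hv hu hw, map_smul, tm_smul, smul_tm,
      smul_smul]
    rw [h]
  hexagon_reverse X Y Z := hom_ext₃' fun a b c u v w hu hv hw => by
    have h := congrArg (fun x : ℂˣ => (x : ℂ)) (A.hexagon_reverse a b c)
    simp only [Units.val_mul, Units.val_inv_eq_inv_val, mul_assoc] at h
    have h1 : (braid (X ⊗ Y) Z).hom.lin (tm (tm u v) w) = (A.c (a + b) c : ℂ) • tm w (tm u v) :=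
      braid_hom_tmul (hu.tm hv) hw
    have h2 : (braid Y Z).hom.lin (tm v w) = (A.c b c : ℂ) • tm w v := braid_hom_tmul hv hw
    have h3 : (braid X Z).hom.lin (tm u w) = (A.c a c : ℂ) • tm w u := braid_hom_tmul hu hw
    simp only [hom_comp_apply, whiskerRight_tm, whiskerLeft_tm, associator_inv_tm hu hv hw, h1, h2, h3,
      associator_inv_tm hw hu hv, associator_inv_tm hu hw hv, map_smul, tm_smul, smul_tm,
      smul_smul]
    rw [h]

theorem braiding_hom_tm {X Y : PointedCat A} {a b : G} {u : X.V} {v : Y.V}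
    (hu : X.IsHomog a u) (hv : Y.IsHomog b v) :
    (β_ X Y).hom.lin (tm u v) = (A.c a b : ℂ) • tm v u := braid_hom_tmul hu hv

end Tensor

end PointedCat
end Pointed

section Action

variable {G : Type*} [AddCommGroup G] [Fintype G] [DecidableEq G]

/-- Scalars for an action of `Γ` on the pointed category of `(G, ω, c)` that lifts a given action of
`Γ` on `G`: the functor `T_γ` relabels the degree `g` as `γ • g`, its tensor structure
`T_γ X ⊗ T_γ Y ≅ T_γ (X ⊗ Y)` is `μ γ a b` on `X_a ⊗ Y_b`, and the isomorphism `T_γ T_δ ≅ T_{γδ}` is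
`ν γ δ a` on `X_a`. The fields say that this is an action by monoidal functors. -/
structure ActionData (Γ : Type*) [Group Γ] [DistribMulAction Γ G] (A : AbelianCocycle G) where
  μ : Γ → G → G → ℂˣ
  ν : Γ → Γ → G → ℂˣ
  μ_zero_left : ∀ γ a, μ γ 0 a = 1
  μ_zero_right : ∀ γ a, μ γ a 0 = 1
  μ_assoc : ∀ γ a b c, μ γ a b * μ γ (a + b) c * A.ω a b c =
    A.ω (γ • a) (γ • b) (γ • c) * μ γ b c * μ γ a (b + c)
  ν_monoidal : ∀ γ δ a b, μ γ (δ • a) (δ • b) * μ δ a b * ν γ δ (a + b) =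
    ν γ δ a * ν γ δ b * μ (γ * δ) a b
  ν_assoc : ∀ γ δ η a, ν γ δ (η • a) * ν (γ * δ) η a = ν δ η a * ν γ (δ * η) a

namespace ActionData

open PointedCat

variable {Γ : Type*} [Group Γ] [DistribMulAction Γ G] {A : AbelianCocycle G}

/-- The graded vector space `X` with every degree `g` replaced by `γ • g`. -/
abbrev shift (γ : Γ) (X : PointedCat A) : PointedCat A where
  V := X.V
  proj g := X.proj (γ⁻¹ • g)
  proj_proj g h v := by simp [X.proj_proj]
  sum_proj v := by
    rw [← X.sum_proj v]
    exact Fintype.sum_equiv (MulAction.toPerm γ⁻¹) _ _ fun g => by simp [X.sum_proj]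

theorem isHomog_shift {γ : Γ} {X : PointedCat A} {g : G} {v : X.V} :
    (shift γ X).IsHomog g v ↔ X.IsHomog (γ⁻¹ • g) v := Iff.rfl

/-- The relabelling of degrees as a functor. -/
def T (A : AbelianCocycle G) (γ : Γ) : PointedCat A ⥤ PointedCat A where
  obj X := shift γ X
  map {X Y} f := ⟨f.lin, fun g v => f.comm _ v⟩

/-- The identity map, viewed as a map from `X` to its relabelling. -/
def sh (γ : Γ) (X : PointedCat A) : X.V ≃ₗ[ℂ] ((T A γ).obj X).V := LinearEquiv.refl ℂ X.V

theorem isHomog_sh {γ : Γ} {X : PointedCat A} {g : G} {v : X.V} :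
    ((T A γ).obj X).IsHomog g (sh γ X v) ↔ X.IsHomog (γ⁻¹ • g) v := Iff.rfl

theorem proj_sh (γ : Γ) (X : PointedCat A) (g : G) (v : X.V) :
    ((T A γ).obj X).proj g (sh γ X v) = sh γ X (X.proj (γ⁻¹ • g) v) := rfl

theorem IsHomog.sh {γ : Γ} {X : PointedCat A} {g : G} {v : X.V} (h : X.IsHomog g v) :
    ((T A γ).obj X).IsHomog (γ • g) (sh γ X v) := by
  rw [isHomog_sh, inv_smul_smul]
  exact h

theorem map_sh (γ : Γ) {X Y : PointedCat A} (f : X ⟶ Y) (v : X.V) :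
    ((T A γ).map f).lin (sh γ X v) = sh γ Y (f.lin v) := rfl

instance (γ : Γ) : (T A γ).Additive where
instance (γ : Γ) : (T A γ).Linear ℂ where

instance (γ : Γ) : (T A γ).IsEquivalence where
  faithful := ⟨fun {_ _ _ _} h => PointedCat.hom_ext (congrArg Hom.lin h :)⟩
  full := ⟨fun {X Y} f => ⟨⟨f.lin, fun g v => by
    have := f.comm (γ • g) v
    simp only [T, inv_smul_smul] at this
    exact this⟩, rfl⟩⟩
  essSurj := ⟨fun Y => ⟨shift γ⁻¹ Y, ⟨mkIso (LinearEquiv.refl ℂ Y.V) fun g v => by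
    simp only [T, inv_inv, smul_inv_smul]
    rfl⟩⟩⟩

theorem T_ext {γ : Γ} {X Z : PointedCat A} {f f' : (T A γ).obj X ⟶ Z}
    (h : ∀ a u, X.IsHomog a u → f.lin (sh γ X u) = f'.lin (sh γ X u)) : f = f' :=
  hom_ext_homog fun _ u hu => h _ u hu

theorem T_ext₂ {γ : Γ} {X Y Z : PointedCat A} {f f' : (T A γ).obj X ⊗ (T A γ).obj Y ⟶ Z}
    (h : ∀ a b u v, X.IsHomog a u → Y.IsHomog b v →
      f.lin (tm (sh γ X u) (sh γ Y v)) = f'.lin (tm (sh γ X u) (sh γ Y v))) :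
    f = f' := hom_ext₂ fun _ _ u v hu hv => h _ _ u v hu hv

theorem T_ext₃ {γ : Γ} {X Y Z W : PointedCat A}
    {f f' : ((T A γ).obj X ⊗ (T A γ).obj Y) ⊗ (T A γ).obj Z ⟶ W}
    (h : ∀ a b c u v w, X.IsHomog a u → Y.IsHomog b v → Z.IsHomog c w →
      f.lin (tm (tm (sh γ X u) (sh γ Y v)) (sh γ Z w)) =
      f'.lin (tm (tm (sh γ X u) (sh γ Y v)) (sh γ Z w))) :
    f = f' := hom_ext₃ fun _ _ _ u v w hu hv hw => h _ _ _ u v w hu hv hw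

/-- The tensorator: `μ γ a b` on `X_a ⊗ Y_b`. -/
def μIso (D : ActionData Γ A) (γ : Γ) (X Y : PointedCat A) :
    (T A γ).obj X ⊗ (T A γ).obj Y ≅ (T A γ).obj (X ⊗ Y) :=
  tensorIsoMk (X := (T A γ).obj X) (Y := (T A γ).obj Y) (Z := (T A γ).obj (X ⊗ Y))
    (diagEquiv₂ X Y (D.μ γ)) fun a b u v hu hv => by
    obtain ⟨u, rfl⟩ := (sh γ _).surjective u
    obtain ⟨v, rfl⟩ := (sh γ _).surjective v
    rw [isHomog_sh] at hu hv
    have h1 : diagEquiv₂ X Y (D.μ γ) (u ⊗ₜ v) = _ := diagEquiv₂_tmul (D.μ γ) hu hv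
    have h2 := (hu.tm hv).smul (D.μ γ (γ⁻¹ • a) (γ⁻¹ • b))
    rw [← smul_add, ← isHomog_sh] at h2
    exact (congrArg (((T A γ).obj (X ⊗ Y)).IsHomog (a + b)) h1).mpr h2

theorem μIso_tm (D : ActionData Γ A) (γ : Γ) {X Y : PointedCat A} {a b : G} {u : X.V} {v : Y.V}
    (hu : X.IsHomog a u) (hv : Y.IsHomog b v) :
    (D.μIso γ X Y).hom.lin (tm (sh γ X u) (sh γ Y v)) =
      (D.μ γ a b : ℂ) • sh γ (X ⊗ Y) (tm u v) := diagEquiv₂_tmul _ hu hv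

/-- The unit isomorphism. -/
def εIso (A : AbelianCocycle G) (γ : Γ) : 𝟙_ (PointedCat A) ≅ (T A γ).obj (𝟙_ (PointedCat A)) :=
  mkIso (X := simple A 0) (Y := shift γ (simple A 0)) (LinearEquiv.refl ℂ ℂ) fun g v => by
    simp [inv_smul_eq_iff]

theorem εIso_apply (γ : Γ) (r : (𝟙_ (PointedCat A)).V) :
    (εIso A γ).hom.lin r = sh γ _ r := rfl

theorem tm_zero {X Y : PointedCat A} (u : X.V) : tm u (0 : Y.V) = 0 := TensorProduct.tmul_zero _ _
theorem zero_tm {X Y : PointedCat A} (v : Y.V) : tm (0 : X.V) v = 0 := TensorProduct.zero_tmul _ _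

/-- The relabelling is a monoidal functor. -/
def coreMonoidal (D : ActionData Γ A) (γ : Γ) : (T A γ).CoreMonoidal where
  εIso := εIso A γ
  μIso := D.μIso γ
  μIso_hom_natural_left := fun {X Y} f X' => T_ext₂ fun a b u v hu hv => by
    simp only [hom_comp_apply, whiskerRight_tm, map_sh, D.μIso_tm γ hu hv,
      D.μIso_tm γ (hu.map f) hv, map_smul]
  μIso_hom_natural_right := fun {X Y} X' f => T_ext₂ fun a b u v hu hv => by
    simp only [hom_comp_apply, whiskerLeft_tm, map_sh, D.μIso_tm γ hu hv,
      D.μIso_tm γ hu (hv.map f), map_smul]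
  associativity := fun X Y Z => T_ext₃ fun a b c u v w hu hv hw => by
    have h := congrArg (fun x : ℂˣ => (x : ℂ)) (D.μ_assoc γ a b c)
    simp only [Units.val_mul, mul_assoc] at h
    simp only [hom_comp_apply, whiskerLeft_tm, whiskerRight_tm, map_sh, D.μIso_tm γ hu hv,
      D.μIso_tm γ (hu.tm hv) hw, D.μIso_tm γ hv hw, D.μIso_tm γ hu (hv.tm hw),
      associator_hom_tm (IsHomog.sh hu) (IsHomog.sh (γ := γ) hv) (IsHomog.sh (γ := γ) hw),
      associator_hom_tm hu hv hw, map_smul, tm_smul, smul_tm, smul_smul]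
    rw [h]
  left_unitality := fun X => hom_ext₂ fun a b r v hr hv => by
    obtain ⟨v, rfl⟩ := (sh γ X).surjective v
    rw [isHomog_sh] at hv
    rcases unit_degree hr with rfl | rfl
    · simp only [hom_comp_apply, whiskerRight_tm, εIso_apply, D.μIso_tm γ hr hv, leftUnitor_tm,
        map_smul, map_sh, D.μ_zero_left, Units.val_one, one_smul]
    · simp only [zero_tm, map_zero]
  right_unitality := fun X => hom_ext₂ fun a b v r hv hr => by
    obtain ⟨v, rfl⟩ := (sh γ X).surjective v
    rw [isHomog_sh] at hv
    rcases unit_degree hr with rfl | rfl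
    · simp only [hom_comp_apply, whiskerLeft_tm, εIso_apply, D.μIso_tm γ hv hr, rightUnitor_tm,
        map_smul, map_sh, D.μ_zero_right, Units.val_one, one_smul]
    · simp only [tm_zero, map_zero]

/-- The endomorphism of `X` acting on `X_a` as the scalar `f a`. -/
def diag₁ (X : PointedCat A) (f : G → ℂ) : X.V →ₗ[ℂ] X.V := ∑ a, f a • X.proj a

theorem diag₁_apply {X : PointedCat A} (f : G → ℂ) {a : G} {u : X.V} (hu : X.IsHomog a u) :
    diag₁ X f u = f a • u := by
  simp only [diag₁, LinearMap.sum_apply, LinearMap.smul_apply, hu.proj]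
  rw [Finset.sum_eq_single a (fun k _ hk => by simp [hk]) (by simp)]
  simp

/-- The automorphism of `X` acting on `X_a` as the invertible scalar `f a`. -/
def diagIso (X : PointedCat A) (f : G → ℂˣ) : X ≅ X where
  hom := Hom.mk' (diag₁ X fun a => f a) fun g v hv => by
    rw [diag₁_apply _ hv]; exact hv.smul _
  inv := Hom.mk' (diag₁ X fun a => ((f a)⁻¹ : ℂˣ)) fun g v hv => by
    rw [diag₁_apply _ hv]; exact hv.smul _
  hom_inv_id := hom_ext_homog fun _ v hv => by
    simp [Hom.mk', diag₁_apply _ hv, smul_smul]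
  inv_hom_id := hom_ext_homog fun _ v hv => by
    simp [Hom.mk', diag₁_apply _ hv, smul_smul]

theorem diagIso_apply {X : PointedCat A} (f : G → ℂˣ) {a : G} {u : X.V} (hu : X.IsHomog a u) :
    (diagIso X f).hom.lin u = (f a : ℂ) • u := diag₁_apply _ hu

/-- `T_γ T_δ X` and `T_{γδ} X` are the same graded vector space. -/
def TTIso (γ δ : Γ) (X : PointedCat A) : (T A γ).obj ((T A δ).obj X) ≅ (T A (γ * δ)).obj X :=
  mkIso (LinearEquiv.refl ℂ X.V) fun g v => by
    simp only [T, mul_smul, mul_inv_rev]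
    rfl

theorem TTIso_apply (γ δ : Γ) (X : PointedCat A) (v : X.V) :
    (TTIso γ δ X).hom.lin (sh γ _ (sh δ X v)) = sh (γ * δ) X v := rfl

/-- The isomorphism `T_γ T_δ ≅ T_{γδ}`: `ν γ δ a` on `X_a`. -/
def νIso (D : ActionData Γ A) (γ δ : Γ) : T A δ ⋙ T A γ ≅ T A (γ * δ) :=
  NatIso.ofComponents
    (fun X => (T A γ).mapIso ((T A δ).mapIso (diagIso X (D.ν γ δ))) ≪≫ TTIso γ δ X)
    fun {X Y} f => by
      refine T_ext (X := (T A δ).obj X) fun a v hv => ?_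
      obtain ⟨v, rfl⟩ := (sh δ X).surjective v
      rw [isHomog_sh] at hv
      simp [map_sh, diagIso_apply _ hv, diagIso_apply _ (hv.map f), TTIso_apply]

theorem νIso_apply (D : ActionData Γ A) (γ δ : Γ) {X : PointedCat A} {a : G} {v : X.V}
    (hv : X.IsHomog a v) : ((D.νIso γ δ).hom.app X).lin (sh γ _ (sh δ X v)) =
      (D.ν γ δ a : ℂ) • sh (γ * δ) X v := by
  simp [νIso, diagIso_apply _ hv, map_sh, TTIso_apply]

theorem eqToHom_sh {γ δ : Γ} (h : γ = δ) (X : PointedCat A) (v : X.V) :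
    (eqToHom (congrArg (fun x => (T A x).obj X) h)).lin (sh γ X v) = sh δ X v := by
  subst h
  rfl

theorem ν_unit (D : ActionData Γ A) (γ δ : Γ) :
    ((εIso A γ).hom ≫ (T A γ).map (εIso A δ).hom) ≫
      (show (T A γ).obj ((T A δ).obj (𝟙_ _)) ⟶ _ from (D.νIso γ δ).hom.app (𝟙_ (PointedCat A))) =
      (εIso A (γ * δ)).hom := by
  refine hom_ext_homog fun a r hr => ?_
  rcases unit_degree hr with rfl | rfl
  · have h := D.ν_monoidal γ δ 0 0
    simp only [smul_zero, add_zero, D.μ_zero_left, one_mul, mul_one] at h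
    simp only [hom_comp_apply, εIso_apply, map_sh]
    refine (D.νIso_apply γ δ hr).trans ?_
    simp [left_eq_mul.1 h]
  · simp only [map_zero]

theorem ν_tensor (D : ActionData Γ A) (γ δ : Γ) (X Y : PointedCat A) :
    ((D.μIso γ ((T A δ).obj X) ((T A δ).obj Y)).hom ≫ (T A γ).map (D.μIso δ X Y).hom) ≫
      (show (T A γ).obj ((T A δ).obj (X ⊗ Y)) ⟶ _ from (D.νIso γ δ).hom.app (X ⊗ Y)) =
    ((show (T A γ).obj ((T A δ).obj X) ⟶ _ from (D.νIso γ δ).hom.app X) ⊗ₘ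
      (show (T A γ).obj ((T A δ).obj Y) ⟶ _ from (D.νIso γ δ).hom.app Y)) ≫
      (D.μIso (γ * δ) X Y).hom := by
  refine T_ext₂ (X := (T A δ).obj X) (Y := (T A δ).obj Y) fun a b u v hu hv => ?_
  obtain ⟨u, rfl⟩ := (sh δ X).surjective u
  obtain ⟨v, rfl⟩ := (sh δ Y).surjective v
  have hu' := hu
  have hv' := hv
  rw [isHomog_sh] at hu' hv'
  have h1 := D.νIso_apply γ δ hu'
  have h2 := D.νIso_apply γ δ hv'
  have h3 := D.νIso_apply γ δ (hu'.tm hv')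
  have h := congrArg (fun x : ℂˣ => (x : ℂ)) (D.ν_monoidal γ δ (δ⁻¹ • a) (δ⁻¹ • b))
  simp only [Units.val_mul, mul_assoc, smul_inv_smul] at h
  simp only [hom_comp_apply, tensorHom_tm, D.μIso_tm γ hu hv, map_smul, map_sh,
    D.μIso_tm δ hu' hv']
  rw [h1, h2]
  erw [h3]
  simp only [smul_tm, tm_smul, map_smul, D.μIso_tm (γ * δ) hu' hv', smul_smul]
  rw [h, ← mul_assoc, mul_comm (D.ν γ δ (δ⁻¹ • a) : ℂ)]

theorem ν_assoc' (D : ActionData Γ A) (γ δ η : Γ) (X : PointedCat A) :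
    (show (T A γ).obj ((T A δ).obj ((T A η).obj X)) ⟶ _ from
      (D.νIso γ δ).hom.app ((T A η).obj X)) ≫
      (show (T A (γ * δ)).obj ((T A η).obj X) ⟶ _ from (D.νIso (γ * δ) η).hom.app X) ≫
        eqToHom (congrArg (fun x => (T A x).obj X) (mul_assoc γ δ η)) =
      (T A γ).map (show (T A δ).obj ((T A η).obj X) ⟶ _ from (D.νIso δ η).hom.app X) ≫
        (show (T A γ).obj ((T A (δ * η)).obj X) ⟶ _ from (D.νIso γ (δ * η)).hom.app X) := by
  refine T_ext fun a v hv => ?_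
  obtain ⟨v, rfl⟩ := (sh δ _).surjective v
  obtain ⟨v, rfl⟩ := (sh η _).surjective v
  rw [isHomog_sh] at hv
  have hv' := hv
  rw [isHomog_sh] at hv'
  have h1 := D.νIso_apply γ δ hv
  have h2 := D.νIso_apply (γ * δ) η hv'
  have h3 := D.νIso_apply δ η hv'
  have h4 := D.νIso_apply γ (δ * η) hv'
  have h := congrArg (fun x : ℂˣ => (x : ℂ)) (D.ν_assoc γ δ η (η⁻¹ • δ⁻¹ • a))
  simp only [Units.val_mul, smul_inv_smul] at h
  simp only [smul_smul] at h
  simp only [hom_comp_apply, map_sh]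
  rw [h1, h3]
  simp only [map_smul]
  erw [h2, h4]
  simp only [map_smul, eqToHom_sh (mul_assoc γ δ η), smul_smul]
  rw [h]

/-- The action on the pointed category given by the scalars `μ` and `ν`. -/
def toMonoidalAction (D : ActionData Γ A) : MonoidalAction Γ (PointedCat A) where
  T := T A
  isEquivalence _ := inferInstance
  additive _ := inferInstance
  linear _ := inferInstance
  monoidal γ := (D.coreMonoidal γ).toMonoidal
  ν := D.νIso
  ν_monoidal γ δ :=
    letI := fun γ' => (D.coreMonoidal γ').toMonoidal
    { unit := D.ν_unit γ δ
      tensor := fun X Y => D.ν_tensor γ δ X Y }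
  ν_assoc γ δ η X := D.ν_assoc' γ δ η X


section Induced

variable {Γ : Type} [Group Γ] [DistribMulAction Γ G] [Fintype Γ] [DecidableEq Γ]

/-- The object `⊕_γ ℂ_{γ • a}`: a vector is a function on `Γ`, and the basis vector `e_γ` has
degree `γ • a`. -/
abbrev orbitSum (Γ : Type) [Group Γ] [DistribMulAction Γ G] [Fintype Γ] [DecidableEq Γ]
    (A : AbelianCocycle G) (a : G) : PointedCat A where
  V := Γ → ℂ
  proj g := LinearMap.pi fun γ => if γ • a = g then LinearMap.proj γ else 0
  proj_proj g h v := by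
    ext γ
    by_cases hg : γ • a = g <;> by_cases hh : γ • a = h <;> by_cases hgh : g = h <;>
      simp_all
  sum_proj v := by
    ext γ
    rw [Finset.sum_apply, Finset.sum_eq_single (γ • a) (fun g _ hg => by simp [hg.symm])
      (by simp)]
    simp

theorem orbitSum_proj_apply (A : AbelianCocycle G) (a g : G) (v : Γ → ℂ) (γ : Γ) :
    (show Γ → ℂ from (orbitSum Γ A a).proj g v) γ = if γ • a = g then v γ else 0 := by
  change (if γ • a = g then LinearMap.proj γ else 0 : (Γ → ℂ) →ₗ[ℂ] ℂ) v = _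
  split_ifs <;> rfl

/-- The linear map with `e_γ ↦ ν δ γ a • e_{δγ}`. -/
def orbitEquiv (D : ActionData Γ A) (a : G) (δ : Γ) : (Γ → ℂ) ≃ₗ[ℂ] (Γ → ℂ) where
  toFun f γ := (D.ν δ (δ⁻¹ * γ) a : ℂ) * f (δ⁻¹ * γ)
  map_add' f f' := by
    ext γ
    exact mul_add _ (f (δ⁻¹ * γ)) (f' (δ⁻¹ * γ))
  map_smul' r f := by
    ext γ
    exact mul_left_comm _ r (f (δ⁻¹ * γ))
  invFun f γ := ((D.ν δ γ a)⁻¹ : ℂˣ) * f (δ * γ)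
  left_inv f := by
    ext γ
    simp
  right_inv f := by
    ext γ
    simp

/-- The isomorphism `T_δ (⊕_γ ℂ_{γ • a}) ≅ ⊕_γ ℂ_{γ • a}` with `e_γ ↦ ν δ γ a • e_{δγ}`. -/
def orbitU (D : ActionData Γ A) (a : G) (δ : Γ) :
    (T A δ).obj (orbitSum Γ A a) ≅ orbitSum Γ A a :=
  mkIso (X := (T A δ).obj (orbitSum Γ A a)) (D.orbitEquiv a δ) fun g v => by
    obtain ⟨v, rfl⟩ := (sh δ _).surjective v
    rw [proj_sh]
    funext γ
    refine (orbitSum_proj_apply A a g _ γ).trans ?_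
    refine Eq.trans ?_ (congrArg ((D.ν δ (δ⁻¹ * γ) a : ℂ) * ·)
      (orbitSum_proj_apply A a (δ⁻¹ • g) v (δ⁻¹ * γ))).symm
    simp only [mul_smul, smul_left_cancel_iff, mul_ite, mul_zero]
    rfl

theorem orbitU_apply (D : ActionData Γ A) (a : G) (δ : Γ) (v : Γ → ℂ) (γ : Γ) :
    (show Γ → ℂ from (D.orbitU a δ).hom.lin (sh δ _ v)) γ =
      (D.ν δ (δ⁻¹ * γ) a : ℂ) * v (δ⁻¹ * γ) := rfl

theorem orbitSum_degree {a g : G} {v : Γ → ℂ} (h : (orbitSum Γ A a).IsHomog g v) {γ : Γ}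
    (hγ : γ • a ≠ g) : v γ = 0 := by
  have := congrFun h γ
  rw [← this]
  exact (orbitSum_proj_apply A a g v γ).trans (if_neg hγ)

/-- The equivariant object `⊕_γ ℂ_{γ • a}` with `u_δ (e_γ) = ν δ γ a • e_{δγ}`. -/
def induced (D : ActionData Γ A) (a : G) : EquivObj D.toMonoidalAction where
  obj := orbitSum Γ A a
  u := D.orbitU a
  compat δ η := by
    refine T_ext (X := (T A η).obj (orbitSum Γ A a)) fun g v hv => ?_
    obtain ⟨v, rfl⟩ := (sh η _).surjective v
    rw [isHomog_sh] at hv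
    have h1 := D.νIso_apply δ η hv
    change (D.orbitU a (δ * η)).hom.lin (((D.νIso δ η).hom.app _).lin (sh δ _ (sh η _ v))) =
      (D.orbitU a δ).hom.lin (sh δ _ ((D.orbitU a η).hom.lin (sh η _ v)))
    rw [h1, map_smul]
    funext γ
    have h2 : ((D.ν δ η (η⁻¹ • g) : ℂ) * ((D.ν (δ * η) ((δ * η)⁻¹ * γ) a : ℂ) *
        (show Γ → ℂ from v) ((δ * η)⁻¹ * γ))) =
      (D.ν δ (δ⁻¹ * γ) a : ℂ) * ((D.ν η (η⁻¹ * (δ⁻¹ * γ)) a : ℂ) *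
        (show Γ → ℂ from v) (η⁻¹ * (δ⁻¹ * γ))) := by
      rw [mul_inv_rev, mul_assoc η⁻¹]
      by_cases hg : (η⁻¹ * (δ⁻¹ * γ)) • a = η⁻¹ • g
      · have h := congrArg (fun x : ℂˣ => (x : ℂ)) (D.ν_assoc δ η (η⁻¹ * (δ⁻¹ * γ)) a)
        simp only [hg, Units.val_mul, mul_inv_cancel_left] at h
        rw [← mul_assoc, h, mul_comm (D.ν η _ a : ℂ), mul_assoc]
      · rw [orbitSum_degree hv hg]
        simp
    exact h2

end Induced

end ActionData

end Action

section ParticleHole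

variable {G : Type*} [AddCommGroup G]

/-- A quadratic form on an abelian group, with values in the multiplicative group `ℂˣ`:
`q (-g) = q g`, and `(g, h) ↦ q (g + h) / (q g * q h)` is bimultiplicative (it is symmetric, so one
variable is enough). -/
structure IsQuadraticForm (q : G → ℂˣ) : Prop where
  map_neg : ∀ g, q (-g) = q g
  bimultiplicative : ∀ g h k,
    q (g + h + k) / (q (g + h) * q k) = q (g + k) / (q g * q k) * (q (h + k) / (q h * q k))

/-- The subgroup of all `b` with `b = -b`. -/
def twoTorsion (G : Type*) [AddCommGroup G] : AddSubgroup G where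
  carrier := {b | b = -b}
  add_mem' {a b} ha hb := by
    simp only [Set.mem_ofPred_eq] at *
    rw [neg_add, ← ha, ← hb]
  zero_mem' := by simp
  neg_mem' {a} ha := by
    simp only [Set.mem_ofPred_eq] at *
    rw [← ha]
    exact ha

theorem ParticleHole.smul_eq (γ : ℤˣ) {b : G} (hb : b ∈ twoTorsion G) : γ • b = b := by
  rcases Int.units_eq_one_or γ with rfl | rfl
  · simp
  · rw [Units.neg_smul, one_smul]
    exact (show b = -b from hb).symm

variable [Fintype G] [DecidableEq G]

/-- A particle-hole action on the pointed category of `(G, ω, c)`: an action of the group `ℤˣ` with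
two elements by monoidal functors that lifts the inversion `g ↦ -g` of `G`, normalized so that it is
the trivial action on the objects supported on the degrees `b = -b`. -/
structure ParticleHole (A : AbelianCocycle G) extends ActionData ℤˣ A where
  μ_two : ∀ γ, ∀ b ∈ twoTorsion G, ∀ b' ∈ twoTorsion G, μ γ b b' = 1
  ν_two : ∀ γ δ, ∀ b ∈ twoTorsion G, ν γ δ b = 1

namespace ParticleHole

variable {A : AbelianCocycle G}

/-- The equivariantization of the pointed category by a particle-hole action. -/
abbrev Equivariant (P : ParticleHole A) : Type _ := EquivObj P.toActionData.toMonoidalAction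

/-- The character of `ℤˣ` with value `ε` at `-1`. -/
def sign (ε γ : ℤˣ) : ℂˣ := if γ = 1 then 1 else Units.map (Int.castRingHom ℂ).toMonoidHom ε

theorem sign_mul (ε γ δ : ℤˣ) : sign ε (γ * δ) = sign ε γ * sign ε δ := by
  have h : (-1 : ℤˣ) ≠ 1 := by decide
  rcases Int.units_eq_one_or γ with rfl | rfl <;> rcases Int.units_eq_one_or δ with rfl | rfl <;>
    simp [sign, h, ← map_mul]

/-- The isomorphism `T_γ ℂ_b ≅ ℂ_b` given by the scalar `sign ε γ`. -/
def signIso (A : AbelianCocycle G) (b : twoTorsion G) (ε γ : ℤˣ) :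
    (ActionData.T A γ).obj (PointedCat.simple A b) ≅ PointedCat.simple A b :=
  PointedCat.mkIso (X := ActionData.shift γ (PointedCat.simple A b))
    (LinearEquiv.smulOfUnit (sign ε γ)) fun g v => by
    change (if g = (b : G) then LinearMap.id else 0 : ℂ →ₗ[ℂ] ℂ) ((sign ε γ : ℂ) * v) =
      (sign ε γ : ℂ) * (if γ⁻¹ • g = (b : G) then LinearMap.id else 0 : ℂ →ₗ[ℂ] ℂ) v
    simp only [inv_smul_eq_iff, smul_eq γ b.2]
    split_ifs <;> simp

theorem signIso_apply (b : twoTorsion G) (ε γ : ℤˣ) (v : ℂ) :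
    (signIso A b ε γ).hom.lin (ActionData.sh γ _ v) = (sign ε γ : ℂ) * v := rfl

/-- The equivariant object `X_b^ε = (ℂ_b, u)` for `b = -b`, with `u_1 = id` and `u_{-1} = ε`. -/
def X (P : ParticleHole A) (b : twoTorsion G) (ε : ℤˣ) : P.Equivariant where
  obj := PointedCat.simple A b
  u γ := signIso A b ε γ
  compat γ δ := by
    refine ActionData.T_ext (X := (ActionData.T A δ).obj (PointedCat.simple A b))
      fun g v hv => ?_
    obtain ⟨v, rfl⟩ := (ActionData.sh δ _).surjective v
    rw [ActionData.isHomog_sh] at hv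
    have h1 := P.νIso_apply γ δ hv
    change (signIso A b ε (γ * δ)).hom.lin (((P.νIso γ δ).hom.app _).lin
      (ActionData.sh γ _ (ActionData.sh δ _ v))) =
      (signIso A b ε γ).hom.lin (ActionData.sh γ _ ((signIso A b ε δ).hom.lin
        (ActionData.sh δ _ v)))
    rw [h1, map_smul]
    have h2 : (P.ν γ δ (δ⁻¹ • g) : ℂ) * ((sign ε (γ * δ) : ℂ) * (show ℂ from v)) =
        (sign ε γ : ℂ) * ((sign ε δ : ℂ) * (show ℂ from v)) := by
      by_cases hv0 : (show ℂ from v) = 0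
      · rw [hv0]
        simp
      · rw [PointedCat.simple_degree hv hv0, P.ν_two γ δ b b.2, sign_mul]
        simp [mul_assoc]
    exact h2

/-- The equivariant object `Y_a = (ℂ_a ⊕ ℂ_{-a}, u)`, where the involution interchanges the two
summands. -/
def Y (P : ParticleHole A) (a : G) : P.Equivariant := P.toActionData.induced a

end ParticleHole
end ParticleHole

section Fusion

variable (D : Type*) [Category D] [Preadditive D] [Linear ℂ D] [MonoidalCategory D]

/-- The set of isomorphism classes of simple objects. -/
def Irr : Type _ := {c : Quotient (isIsomorphicSetoid D) // Simple c.out}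

variable {D}

/-- The fusion coefficient `dim Hom(X ⊗ Y, Z)`. -/
noncomputable def fusionCoeff (X Y Z : D) : ℕ := Module.finrank ℂ (X ⊗ Y ⟶ Z)

/-- `d` is the Frobenius-Perron dimension of `X`: the greatest real eigenvalue of the matrix of
multiplication by `X`, whose entry at `(k, j)` is the multiplicity of the simple object `k` in
`X ⊗ j`. -/
def IsFPdim (X : D) (d : ℝ) : Prop :=
  IsGreatest {x : ℝ | ∃ v : Irr D → ℝ, v ≠ 0 ∧
    ∀ k, ∑ᶠ j : Irr D, (fusionCoeff X j.1.out k.1.out : ℝ) * v j = x * v k} d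

end Fusion

end Equivariantization

/-! On vectors, an equivariant object is a graded space `Z` with operators `Z.act γ` that carry
degree `a` to degree `γ • a` and compose up to the scalars `ν`. The simple objects come from one
construction: a vector `v` of degree `a` determines a morphism `fromInduced` from `Y_a` to `Z` with
`e_γ ↦ u_γ v`. If `a ≠ -a`, the homogeneous components of `Y_a` are lines, so a nonzero morphism to
`Y_a` reaches a basis vector and is onto, and `fromInduced` is injective for `v ≠ 0`. If `b = -b`,
the normalization of `ν` makes `u_{-1}` an involution in degree `b`, and an eigenvector yields an
embedding `fromX` of some `X_b^ε`. This gives `simple_classification`; degrees, the sign of `u_{-1}`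
and the dimension tell the listed objects apart.

The fusion rules need almost nothing about the cocycle. The operators `u_γ` send products of basis
vectors to unit multiples of such products, so the morphisms given by `e_1 ⊗ e_1` and `e_1 ⊗ e_{-1}`
together cover `Y_a ⊗ Y_{a'}`, and dimensions make this an isomorphism from `Y_{a+a'} ⊕ Y_{a-a'}`
(`Y_tensor_Y`). The exceptional rule is the splitting of `Y_0`. Only `X ⊗ X` uses the normalization
of `μ`.

For the Frobenius–Perron dimension, the dimensions of the underlying spaces form a strictly positive
left eigenvector of the multiplication matrix: by Schur's lemma and the fusion rules the dimension
of each relevant product is the sum over its simple constituents (`DimSum`). A nonnegative matrix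
with such an eigenvector has no larger real eigenvalue (`isFPdim_of_left_eigenvector`).

For existence, write `G` as a product of cyclic groups of prime power orders `n_i`, a quotient of
the lattice `ι → ℤ`. There `q` is `x ↦ B(x, x)` for an upper triangular `B`. With a section `s`, put
`c(a, b) = B(s a, s b)` and `ω(a, b, c) = B(s a, s b + s c - s (b + c))`; the axioms hold since `B`
vanishes on pairs from the kernel and is antisymmetric when one argument lies there. Inversion lifts
to the isometry `signAction` of `B`, and its defect against `s` gives `μ`, with `ν = 1`. Leaving the
coordinates with `n_i = 2` fixed is what makes `μ` trivial on the two-torsion. -/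

namespace Equivariantization

/-! ### Homogeneous vectors -/

namespace PointedCat

variable {G : Type*} [AddCommGroup G] [Fintype G] [DecidableEq G] {A : AbelianCocycle G}

theorem IsHomog.add {X : PointedCat A} {g : G} {v w : X.V} (hv : X.IsHomog g v)
    (hw : X.IsHomog g w) : X.IsHomog g (v + w) := by
  rw [IsHomog, map_add, hv, hw]

theorem exists_homog_ne_zero {X : PointedCat A} {v : X.V} (hv : v ≠ 0) :
    ∃ g, X.proj g v ≠ 0 := by
  by_contra! h
  exact hv (by rw [← X.sum_proj v]; simp [h])

end PointedCat

/-! ### Equivariant objects as graded spaces with twisted operators -/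

namespace EquivObj

open PointedCat ActionData

variable {G : Type*} [AddCommGroup G] [Fintype G] [DecidableEq G] {A : AbelianCocycle G}
  {Γ : Type*} [Group Γ] [DistribMulAction Γ G] {D : ActionData Γ A}

/-- The map `u_γ` of an equivariant object, as a linear endomorphism of the underlying vector
space. -/
def act (Z : EquivObj D.toMonoidalAction) (γ : Γ) : Z.obj.V →ₗ[ℂ] Z.obj.V :=
  (show (T A γ).obj Z.obj ⟶ Z.obj from (Z.u γ).hom).lin ∘ₗ (sh γ Z.obj).toLinearMap

theorem act_homog {Z : EquivObj D.toMonoidalAction} {γ : Γ} {a : G} {v : Z.obj.V}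
    (hv : Z.obj.IsHomog a v) : Z.obj.IsHomog (γ • a) (Z.act γ v) :=
  IsHomog.map (show (T A γ).obj Z.obj ⟶ Z.obj from (Z.u γ).hom) (IsHomog.sh hv)

/-- This is `compat` evaluated at a homogeneous vector: the operators form a representation of `Γ`
twisted by `ν`. -/
theorem act_act (Z : EquivObj D.toMonoidalAction) (γ δ : Γ) {a : G} {v : Z.obj.V}
    (hv : Z.obj.IsHomog a v) :
    Z.act γ (Z.act δ v) = (D.ν γ δ a : ℂ) • Z.act (γ * δ) v := by
  have h := congrArg (fun f : (T A γ).obj ((T A δ).obj Z.obj) ⟶ Z.obj =>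
    f.lin (sh γ _ (sh δ _ v))) (Z.compat γ δ)
  have h1 := D.νIso_apply γ δ hv
  have h2 : (show (T A (γ * δ)).obj Z.obj ⟶ Z.obj from (Z.u (γ * δ)).hom).lin
      (((D.νIso γ δ).hom.app Z.obj).lin (sh γ _ (sh δ Z.obj v))) = Z.act γ (Z.act δ v) := h
  rw [h1, map_smul] at h2
  exact h2.symm

theorem hom_act {Z W : EquivObj D.toMonoidalAction} (f : Z ⟶ W) (γ : Γ) (v : Z.obj.V) :
    f.hom.lin (Z.act γ v) = W.act γ (f.hom.lin v) :=
  congrArg (fun g : (T A γ).obj Z.obj ⟶ W.obj => g.lin (sh γ _ v)) (f.comm γ)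

/-- A linear map that preserves the grading and commutes with the `u_γ` is a morphism. -/
def homOfLin {Z W : EquivObj D.toMonoidalAction} (f : Z.obj.V →ₗ[ℂ] W.obj.V)
    (hf : ∀ g v, Z.obj.IsHomog g v → W.obj.IsHomog g (f v))
    (hact : ∀ γ g v, Z.obj.IsHomog g v → f (Z.act γ v) = W.act γ (f v)) : Z ⟶ W where
  hom := PointedCat.Hom.mk' f hf
  comm γ := T_ext (X := Z.obj) fun g v hv => hact γ g v hv

theorem lin_ext {Z W : EquivObj D.toMonoidalAction} {f g : Z ⟶ W}
    (h : ∀ v, f.hom.lin v = g.hom.lin v) : f = g :=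
  EquivObj.hom_ext (PointedCat.hom_ext (LinearMap.ext h))

theorem comp_apply {Z W U : EquivObj D.toMonoidalAction} (f : Z ⟶ W) (g : W ⟶ U) (v : Z.obj.V) :
    (f ≫ g).hom.lin v = g.hom.lin (f.hom.lin v) := rfl

theorem id_apply (Z : EquivObj D.toMonoidalAction) (v : Z.obj.V) :
    (EquivObj.Hom.hom (𝟙 Z)).lin v = v := rfl

theorem zero_apply {Z W : EquivObj D.toMonoidalAction} (v : Z.obj.V) :
    (0 : Z ⟶ W).hom.lin v = 0 := rfl

theorem add_apply {Z W : EquivObj D.toMonoidalAction} (f g : Z ⟶ W) (v : Z.obj.V) :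
    (f + g).hom.lin v = f.hom.lin v + g.hom.lin v := rfl

theorem smul_apply {Z W : EquivObj D.toMonoidalAction} (c : ℂ) (f : Z ⟶ W) (v : Z.obj.V) :
    (c • f).hom.lin v = c • f.hom.lin v := rfl

/-- The isomorphism given by a bijective morphism. -/
noncomputable def isoOfBijective {Z W : EquivObj D.toMonoidalAction} (f : Z ⟶ W)
    (hf : Function.Bijective f.hom.lin) : Z ≅ W :=
  mkIso (PointedCat.mkIso (LinearEquiv.ofBijective f.hom.lin hf) f.hom.comm) fun γ => f.comm γ

theorem isIso_of_bijective {Z W : EquivObj D.toMonoidalAction} (f : Z ⟶ W)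
    (hf : Function.Bijective f.hom.lin) : IsIso f :=
  (isoOfBijective f hf).isIso_hom

theorem mono_of_injective {Z W : EquivObj D.toMonoidalAction} (f : Z ⟶ W)
    (hf : Function.Injective f.hom.lin) : Mono f where
  right_cancellation g h hgh := lin_ext fun v => hf (by
    rw [← comp_apply, ← comp_apply, hgh])

theorem ne_zero_of_apply {Z W : EquivObj D.toMonoidalAction} {f : Z ⟶ W} {v : Z.obj.V}
    (h : f.hom.lin v ≠ 0) : f ≠ 0 := by
  rintro rfl
  exact h (zero_apply v)

/-- The dimension of the underlying vector space. -/
noncomputable def vdim (Z : EquivObj D.toMonoidalAction) : ℕ := Module.finrank ℂ Z.obj.V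

/-- The linear equivalence underlying an isomorphism. -/
def linEquiv {Z W : EquivObj D.toMonoidalAction} (e : Z ≅ W) : Z.obj.V ≃ₗ[ℂ] W.obj.V where
  toLinearMap := e.hom.hom.lin
  invFun := e.inv.hom.lin
  left_inv v := by
    change (e.hom ≫ e.inv).hom.lin v = v
    rw [e.hom_inv_id]
    rfl
  right_inv v := by
    change (e.inv ≫ e.hom).hom.lin v = v
    rw [e.inv_hom_id]
    rfl

theorem vdim_congr {Z W : EquivObj D.toMonoidalAction} (e : Z ≅ W) : Z.vdim = W.vdim :=
  (linEquiv e).finrank_eq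

section Biprod

variable (Z W : EquivObj D.toMonoidalAction)

/-- The vector space underlying a direct sum. -/
noncomputable def biprodEquiv : (Z ⊞ W).obj.V ≃ₗ[ℂ] Z.obj.V × W.obj.V where
  toLinearMap := (biprod.fst : Z ⊞ W ⟶ Z).hom.lin.prod (biprod.snd : Z ⊞ W ⟶ W).hom.lin
  invFun p := (biprod.inl : Z ⟶ Z ⊞ W).hom.lin p.1 + (biprod.inr : W ⟶ Z ⊞ W).hom.lin p.2
  left_inv v := by
    change (biprod.fst ≫ biprod.inl + biprod.snd ≫ biprod.inr : Z ⊞ W ⟶ Z ⊞ W).hom.lin v = v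
    rw [biprod.total]
    rfl
  right_inv p := by
    have h1 : ((biprod.inl : Z ⟶ Z ⊞ W) ≫ biprod.fst).hom.lin p.1 = p.1 := by
      rw [biprod.inl_fst, id_apply]
    have h2 : (biprod.inl ≫ biprod.snd : Z ⟶ W).hom.lin p.1 = 0 := by
      rw [biprod.inl_snd, zero_apply]
    have h3 : (biprod.inr ≫ biprod.fst : W ⟶ Z).hom.lin p.2 = 0 := by
      rw [biprod.inr_fst, zero_apply]
    have h4 : ((biprod.inr : W ⟶ Z ⊞ W) ≫ biprod.snd).hom.lin p.2 = p.2 := by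
      rw [biprod.inr_snd, id_apply]
    rw [comp_apply] at h1 h2 h3 h4
    ext <;> simp [h1, h2, h3, h4]

theorem vdim_biprod : (Z ⊞ W).vdim = Z.vdim + W.vdim := by
  rw [vdim, (biprodEquiv Z W).finrank_eq, Module.finrank_prod]
  rfl

variable {Z W}

theorem desc_apply {U : EquivObj D.toMonoidalAction} (f : Z ⟶ U) (g : W ⟶ U) (v : (Z ⊞ W).obj.V) :
    (biprod.desc f g).hom.lin v =
      f.hom.lin (biprodEquiv Z W v).1 + g.hom.lin (biprodEquiv Z W v).2 := by
  rw [biprod.desc_eq]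
  rfl

/-- Surjectivity is enough because the dimensions agree; the fusion rules only have to exhibit
spanning vectors. -/
theorem desc_bijective {U : EquivObj D.toMonoidalAction} (f : Z ⟶ U) (g : W ⟶ U)
    (h : Function.Surjective (f.hom.lin.coprod g.hom.lin)) (hd : Z.vdim + W.vdim = U.vdim) :
    Function.Bijective (biprod.desc f g).hom.lin := by
  have hs : Function.Surjective (biprod.desc f g).hom.lin := fun u => by
    obtain ⟨p, hp⟩ := h u
    refine ⟨(biprodEquiv Z W).symm p, ?_⟩
    rw [desc_apply, LinearEquiv.apply_symm_apply]
    exact hp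
  exact ⟨(LinearMap.injective_iff_surjective_of_finrank_eq_finrank
    ((vdim_biprod Z W).trans hd)).2 hs, hs⟩

end Biprod

section Tensor

/-- The operator on a product is `(u ⊗ w) ∘ μ⁻¹`; with `μ` moved to the other side no inverse scalar
appears. -/
theorem act_tensor (Z W : EquivObj D.toMonoidalAction) (γ : Γ) {a b : G} {v : Z.obj.V}
    {w : W.obj.V} (hv : Z.obj.IsHomog a v) (hw : W.obj.IsHomog b w) :
    (D.μ γ a b : ℂ) • (Z ⊗ W).act γ (tm v w : (Z.obj ⊗ W.obj).V) =
      (tm (Z.act γ v) (W.act γ w) : (Z.obj ⊗ W.obj).V) := by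
  have h := congrArg (fun f : (T A γ).obj Z.obj ⊗ (T A γ).obj W.obj ⟶ Z.obj ⊗ W.obj =>
    f.lin (tm (sh γ _ v) (sh γ _ w))) (μ_tensorU D.toMonoidalAction γ (Z.u γ) (W.u γ))
  have h1 := D.μIso_tm γ hv hw
  have h2 : (show (T A γ).obj (Z.obj ⊗ W.obj) ⟶ Z.obj ⊗ W.obj from ((Z ⊗ W).u γ).hom).lin
      ((D.μIso γ Z.obj W.obj).hom.lin (tm (sh γ _ v) (sh γ _ w))) =
      (tm (Z.act γ v) (W.act γ w) : (Z.obj ⊗ W.obj).V) := h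
  rw [h1, map_smul] at h2
  exact h2

theorem vdim_tensor (Z W : EquivObj D.toMonoidalAction) : (Z ⊗ W).vdim = Z.vdim * W.vdim :=
  Module.finrank_tensorProduct (R := ℂ) (S := ℂ) (M := Z.obj.V) (M' := W.obj.V)

end Tensor

theorem act_injective (Z : EquivObj D.toMonoidalAction) (γ : Γ) :
    Function.Injective (Z.act γ) := fun v w h => by
  have h1 := congrArg (show Z.obj ⟶ (T A γ).obj Z.obj from (Z.u γ).inv).lin h
  have h2 (v) : (show Z.obj ⟶ (T A γ).obj Z.obj from (Z.u γ).inv).lin (Z.act γ v) = sh γ _ v :=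
    congrArg (fun f : (T A γ).obj Z.obj ⟶ (T A γ).obj Z.obj => f.lin (sh γ _ v))
      (Z.u γ).hom_inv_id
  rw [h2, h2] at h1
  exact h1

/-- The axioms do not force `u_1` to be the identity. Cancelling one injective `u_1` in `u_1 u_1 = ν
u_1` determines it. -/
theorem act_one {Z : EquivObj D.toMonoidalAction} {a : G} {v : Z.obj.V}
    (hv : Z.obj.IsHomog a v) : Z.act 1 v = (D.ν 1 1 a : ℂ) • v := by
  have h := Z.act_act 1 1 hv
  rw [mul_one, ← map_smul] at h
  exact Z.act_injective 1 h

theorem act_mem_range {Z W : EquivObj D.toMonoidalAction} (f : W ⟶ Z) (γ : Γ) {z : Z.obj.V}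
    (hz : z ∈ LinearMap.range f.hom.lin) : Z.act γ z ∈ LinearMap.range f.hom.lin := by
  obtain ⟨w, rfl⟩ := hz
  exact ⟨W.act γ w, hom_act f γ w⟩

theorem exists_homog_of_ne_zero {Z W : EquivObj D.toMonoidalAction} {f : W ⟶ Z} (hf : f ≠ 0) :
    ∃ g w, W.obj.IsHomog g w ∧ f.hom.lin w ≠ 0 := by
  by_contra! h
  exact hf (EquivObj.hom_ext (hom_ext_homog h))

theorem act_ne_zero {Z : EquivObj D.toMonoidalAction} (γ : Γ) {v : Z.obj.V} (hv : v ≠ 0) :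
    Z.act γ v ≠ 0 := fun h => hv (Z.act_injective γ (h.trans (map_zero _).symm))

/-- Membership in a subspace is insensitive to the units `r` and `s`. Hence a subspace that contains
the `u_γ`-translate of one basis tensor contains the translated basis tensor, whatever `μ` and `ν`
are. -/
theorem tm_act_mem {Z W : EquivObj D.toMonoidalAction} {S : Submodule ℂ (Z ⊗ W).obj.V} {γ : Γ}
    {a b : G} {v v' : Z.obj.V} {w w' : W.obj.V} {r s : ℂˣ} (hv : Z.obj.IsHomog a v)
    (hw : W.obj.IsHomog b w) (hv' : Z.act γ v = (r : ℂ) • v') (hw' : W.act γ w = (s : ℂ) • w')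
    (h : (Z ⊗ W).act γ (tm v w : (Z.obj ⊗ W.obj).V) ∈ S) :
    (tm v' w' : (Z.obj ⊗ W.obj).V) ∈ S := by
  have h1 := act_tensor Z W γ hv hw
  rw [hv', hw', smul_tm, tm_smul] at h1
  have h2 : (r : ℂ) • (s : ℂ) • (tm v' w' : (Z ⊗ W).obj.V) ∈ S := by
    erw [← h1]
    exact S.smul_mem _ h
  have h3 (x : (Z ⊗ W).obj.V) (hx : (r : ℂ) • (s : ℂ) • x ∈ S) : x ∈ S :=
    (S.smul_mem_iff (Units.ne_zero s)).1 ((S.smul_mem_iff (Units.ne_zero r)).1 hx)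
  exact h3 _ h2

theorem tm_span {Z W : EquivObj D.toMonoidalAction} {ι κ : Type*} {e : ι → Z.obj.V}
    {f : κ → W.obj.V} (he : ⊤ ≤ Submodule.span ℂ (Set.range e))
    (hf : ⊤ ≤ Submodule.span ℂ (Set.range f)) {S : Submodule ℂ (Z ⊗ W).obj.V}
    (hS : ∀ i j, (tm (e i) (f j) : (Z.obj ⊗ W.obj).V) ∈ S) : S = ⊤ := by
  have h1 (j : κ) : ⊤ ≤ S.comap ((TensorProduct.mk ℂ Z.obj.V W.obj.V).flip (f j)) :=
    he.trans (Submodule.span_le.2 fun _ ⟨i, hi⟩ => hi ▸ hS i j)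
  have h2 (x : Z.obj.V) : ⊤ ≤ S.comap (TensorProduct.mk ℂ Z.obj.V W.obj.V x) :=
    hf.trans (Submodule.span_le.2 fun _ ⟨j, hj⟩ => hj ▸ h1 j (Submodule.mem_top (x := x)))
  refine (Submodule.eq_top_iff').2 fun x => ?_
  induction x using TensorProduct.induction_on with
  | zero => exact S.zero_mem
  | add x y hx hy => exact S.add_mem hx hy
  | tmul x y => exact h2 x (Submodule.mem_top (x := y))

/-! ### Morphisms out of induced objects -/

section Induced

variable {Γ : Type} [Group Γ] [DistribMulAction Γ G] [Fintype Γ] [DecidableEq Γ]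
  {D : ActionData Γ A}

variable (D) in
/-- The basis vector of degree `γ • a` of the induced object. -/
def inducedBasis (a : G) (γ : Γ) : (D.induced a).obj.V := (Pi.single γ 1 : Γ → ℂ)

theorem induced_sum (a : G) (f : (D.induced a).obj.V) :
    f = ∑ γ, (show Γ → ℂ from f) γ • inducedBasis D a γ := by
  have h (f : Γ → ℂ) : f = ∑ γ, f γ • (Pi.single γ 1 : Γ → ℂ) := by
    ext γ
    simp [Finset.sum_apply, Pi.single_apply]
  exact h f

theorem inducedBasis_homog (a : G) (γ : Γ) :
    (D.induced a).obj.IsHomog (γ • a) (inducedBasis D a γ) := by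
  funext δ
  refine (orbitSum_proj_apply A a (γ • a) (Pi.single γ 1) δ).trans ?_
  by_cases h : δ = γ
  · simp [h, inducedBasis]
  · simp [h, inducedBasis]

theorem act_inducedBasis (a : G) (γ δ : Γ) :
    (D.induced a).act δ (inducedBasis D a γ) = (D.ν δ γ a : ℂ) • inducedBasis D a (δ * γ) := by
  have h : (fun η => (D.ν δ (δ⁻¹ * η) a : ℂ) * (Pi.single γ 1 : Γ → ℂ) (δ⁻¹ * η)) =
      (D.ν δ γ a : ℂ) • (Pi.single (δ * γ) 1 : Γ → ℂ) := by
    ext η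
    by_cases h : η = δ * γ
    · simp [h]
    · have : δ⁻¹ * η ≠ γ := fun h' => h (by rw [← h', mul_inv_cancel_left])
      simp [h, this]
  exact h

/-- The linear map from the induced object that sends the basis vector at `γ` to `u_γ v`. -/
def inducedLin {Z : EquivObj D.toMonoidalAction} (a : G) (v : Z.obj.V) :
    (D.induced a).obj.V →ₗ[ℂ] Z.obj.V :=
  Fintype.linearCombination ℂ fun γ => Z.act γ v

theorem inducedLin_basis {Z : EquivObj D.toMonoidalAction} (a : G) (v : Z.obj.V) (γ : Γ) :
    inducedLin a v (inducedBasis D a γ) = Z.act γ v := by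
  refine (Fintype.linearCombination_apply_single ℂ (fun γ => Z.act γ v) γ (1 : ℂ)).trans ?_
  rw [one_smul]

/-- The morphism from the induced object given by a homogeneous vector `v`: it sends the basis
vector at `γ` to `u_γ v`. -/
def fromInduced {Z : EquivObj D.toMonoidalAction} {a : G} {v : Z.obj.V}
    (hv : Z.obj.IsHomog a v) : D.induced a ⟶ Z :=
  homOfLin (inducedLin a v)
    (fun g f hf => by
      change Z.obj.proj g (∑ γ, (show Γ → ℂ from f) γ • Z.act γ v) =
        ∑ γ, (show Γ → ℂ from f) γ • Z.act γ v
      rw [map_sum]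
      refine Finset.sum_congr rfl fun γ _ => ?_
      by_cases h : γ • a = g
      · subst h
        exact (act_homog hv).smul _
      · rw [show (show Γ → ℂ from f) γ = 0 from orbitSum_degree hf h, zero_smul, map_zero])
    -- On the basis vector at `γ` both sides are `ν δ γ a` times `u_{δγ} v`; the scalar in the
    -- definition of the induced object is chosen to match `act_act`.
    (fun δ g f _ => by
      rw [induced_sum a f]
      simp only [map_sum, map_smul, act_inducedBasis, inducedLin_basis, Z.act_act δ _ hv])

theorem fromInduced_basis {Z : EquivObj D.toMonoidalAction} {a : G} {v : Z.obj.V}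
    (hv : Z.obj.IsHomog a v) (γ : Γ) :
    (fromInduced hv).hom.lin (inducedBasis D a γ) = Z.act γ v := inducedLin_basis a v γ

theorem vdim_induced (a : G) : (D.induced a).vdim = Fintype.card Γ :=
  Module.finrank_fintype_fun_eq_card ℂ

/-- Monomorphisms of equivariant objects are injective. -/
theorem injective_of_mono {Z W : EquivObj D.toMonoidalAction} (f : Z ⟶ W) [Mono f] :
    Function.Injective f.hom.lin := by
  refine (injective_iff_map_eq_zero _).2 fun v hv => ?_
  by_contra hv0
  obtain ⟨g, hg⟩ := exists_homog_ne_zero hv0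
  have hw : f.hom.lin (Z.obj.proj g v) = 0 := by rw [← f.hom.comm, hv, map_zero]
  -- A homogeneous kernel vector remains in the kernel under every `u_γ`, so `f` kills the whole
  -- morphism that it induces. Being mono, `f` forces that morphism, and hence the vector, to
  -- vanish.
  have hz : fromInduced (Z.obj.isHomog_proj g v) ≫ f = 0 := lin_ext fun x => by
    rw [comp_apply, induced_sum g x, zero_apply]
    simp only [map_sum, map_smul, fromInduced_basis, hom_act, hw, map_zero, smul_zero,
      Finset.sum_const_zero]
  have h0 := congrArg (fun h : D.induced g ⟶ Z => h.hom.lin (inducedBasis D g 1))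
    (zero_of_comp_mono f hz)
  simp only [fromInduced_basis, zero_apply] at h0
  exact hg (Z.act_injective 1 (h0.trans (map_zero _).symm))

/-- An equivariant object is simple if it is nonzero and every nonzero morphism to it is
surjective. -/
theorem simple_of_surjective {Z : EquivObj D.toMonoidalAction} (hZ : Nontrivial Z.obj.V)
    (h : ∀ (W : EquivObj D.toMonoidalAction) (f : W ⟶ Z), f ≠ 0 →
      Function.Surjective f.hom.lin) : Simple Z where
  mono_isIso_iff_nonzero {W} f _ := by
    refine ⟨fun _ hf => ?_, fun hf => isIso_of_bijective f ⟨injective_of_mono f, h W f hf⟩⟩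
    subst hf
    obtain ⟨z, hz⟩ := exists_ne (0 : Z.obj.V)
    refine hz ?_
    obtain ⟨w, rfl⟩ := (linEquiv (asIso (0 : W ⟶ Z))).surjective z
    exact zero_apply w

end Induced

end EquivObj

/-! ### Simplicity and isomorphisms of induced objects -/

namespace EquivObj

open PointedCat ActionData

variable {G : Type*} [AddCommGroup G] [Fintype G] [DecidableEq G] {A : AbelianCocycle G}
  {Γ : Type} [Group Γ] [DistribMulAction Γ G] [Fintype Γ] [DecidableEq Γ] {D : ActionData Γ A}

theorem inducedBasis_ne_zero (a : G) (γ : Γ) : inducedBasis D a γ ≠ 0 := fun h => by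
  have : (Pi.single γ 1 : Γ → ℂ) γ = 0 := congrFun h γ
  simp at this

theorem inducedBasis_span (a : G) {S : Submodule ℂ (D.induced a).obj.V}
    (hS : ∀ γ, inducedBasis D a γ ∈ S) : S = ⊤ := by
  refine (Submodule.eq_top_iff').2 fun x => ?_
  rw [induced_sum a x]
  exact S.sum_mem fun γ _ => S.smul_mem _ (hS γ)

/-- The degrees of the induced object lie in the orbit. -/
theorem exists_smul_of_homog {a g : G} {v : (D.induced a).obj.V}
    (hv : (D.induced a).obj.IsHomog g v) (h0 : v ≠ 0) : ∃ γ : Γ, γ • a = g := by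
  by_contra! h
  exact h0 (funext fun γ => orbitSum_degree hv (h γ))

/-- On a free orbit distinct basis vectors have distinct degrees, so each homogeneous component is a
line. -/
theorem homog_induced_of_free {a : G} (ha : Function.Injective fun γ : Γ => γ • a) {γ : Γ}
    {v : (D.induced a).obj.V} (hv : (D.induced a).obj.IsHomog (γ • a) v) :
    ∃ c : ℂ, v = c • inducedBasis D a γ := by
  refine ⟨(show Γ → ℂ from v) γ, ?_⟩
  conv_lhs => rw [induced_sum a v]
  refine Finset.sum_eq_single γ (fun δ _ hδ => ?_) (by simp)
  rw [show (show Γ → ℂ from v) δ = 0 from orbitSum_degree hv fun h => hδ (ha h), zero_smul]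

/-- The range is stable under all `u_δ`, and these carry one basis vector to unit multiples of all
the others. -/
theorem range_induced_eq_top {W : EquivObj D.toMonoidalAction} {a : G} (f : W ⟶ D.induced a)
    {γ : Γ} (h : inducedBasis D a γ ∈ LinearMap.range f.hom.lin) :
    LinearMap.range f.hom.lin = ⊤ := by
  refine inducedBasis_span a fun δ => ?_
  have h1 := act_mem_range f (δ * γ⁻¹) h
  rw [act_inducedBasis, inv_mul_cancel_right] at h1
  exact (Submodule.smul_mem_iff _ (Units.ne_zero _)).1 h1

theorem surjective_to_induced {a : G} (ha : Function.Injective fun γ : Γ => γ • a)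
    (W : EquivObj D.toMonoidalAction) (f : W ⟶ D.induced a) (hf : f ≠ 0) :
    Function.Surjective f.hom.lin := by
  obtain ⟨g, w, hw, h0⟩ := exists_homog_of_ne_zero hf
  obtain ⟨γ, rfl⟩ := exists_smul_of_homog (hw.map f.hom) h0
  obtain ⟨c, hc⟩ := homog_induced_of_free ha (hw.map f.hom)
  have hc0 : c ≠ 0 := by
    rintro rfl
    rw [zero_smul] at hc
    exact h0 hc
  refine LinearMap.range_eq_top.1 (range_induced_eq_top f (γ := γ) ?_)
  refine (Submodule.smul_mem_iff _ hc0).1 ?_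
  rw [← hc]
  exact LinearMap.mem_range_self _ _

theorem simple_induced {a : G} (ha : Function.Injective fun γ : Γ => γ • a) :
    Simple (D.induced a) :=
  simple_of_surjective ⟨⟨_, 0, inducedBasis_ne_zero a 1⟩⟩ (surjective_to_induced ha)

theorem fromInduced_ne_zero {Z : EquivObj D.toMonoidalAction} {a : G} {v : Z.obj.V}
    (hv : Z.obj.IsHomog a v) (h0 : v ≠ 0) : fromInduced hv ≠ 0 :=
  ne_zero_of_apply (v := inducedBasis D a 1) (by
    rw [fromInduced_basis]
    exact act_ne_zero 1 h0)

/-- The vectors `u_γ v` lie in pairwise different degrees and are nonzero, so projecting to degree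
`γ • a` isolates the coordinate at `γ`. -/
theorem fromInduced_injective {Z : EquivObj D.toMonoidalAction} {a : G} {v : Z.obj.V}
    (ha : Function.Injective fun γ : Γ => γ • a) (hv : Z.obj.IsHomog a v) (h0 : v ≠ 0) :
    Function.Injective (fromInduced hv).hom.lin := by
  refine (injective_iff_map_eq_zero _).2 fun f hf => funext fun γ => ?_
  have h1 := congrArg (Z.obj.proj (γ • a)) hf
  rw [(fromInduced hv).hom.comm] at h1
  obtain ⟨c, hc⟩ := homog_induced_of_free ha ((D.induced a).obj.isHomog_proj (γ • a) f)
  rw [hc, map_smul, fromInduced_basis, map_zero, smul_eq_zero,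
    or_iff_left (act_ne_zero γ h0)] at h1
  rw [h1, zero_smul] at hc
  have h2 := orbitSum_proj_apply A a (γ • a) f γ
  rw [if_pos rfl] at h2
  exact h2.symm.trans (congrFun hc γ)

/-- An isomorphism preserves degrees, and the degrees that occur form the orbit. Conversely, the
basis vector at `γ` has degree `γ • a'` and generates the whole object, so it induces an
isomorphism. -/
theorem induced_iso_iff (a a' : G) :
    Nonempty (D.induced a ≅ D.induced a') ↔ ∃ γ : Γ, γ • a' = a := by
  constructor
  · rintro ⟨e⟩
    have h := (inducedBasis_homog (D := D) a (1 : Γ)).map e.hom.hom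
    rw [one_smul] at h
    refine exists_smul_of_homog h fun h0 => inducedBasis_ne_zero (D := D) a 1 ?_
    exact (linEquiv e).injective (h0.trans (map_zero (linEquiv e)).symm)
  · rintro ⟨γ, rfl⟩
    have hs : Function.Surjective (fromInduced (inducedBasis_homog (D := D) a' γ)).hom.lin := by
      refine LinearMap.range_eq_top.1 (range_induced_eq_top _ (γ := γ) ?_)
      -- The basis vector at `1` goes to `u_1 e_γ`, which is `e_γ` only up to the unit `ν 1 γ a'`.
      refine (Submodule.smul_mem_iff _ (Units.ne_zero (D.ν 1 γ a'))).1 ?_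
      refine ⟨inducedBasis D _ 1, ?_⟩
      rw [fromInduced_basis, act_inducedBasis, one_mul]
    exact ⟨isoOfBijective _ ⟨(LinearMap.injective_iff_surjective_of_finrank_eq_finrank
      ((vdim_induced _).trans (vdim_induced _).symm)).2 hs, hs⟩⟩

end EquivObj

/-! ### Simple objects and fusion rules of the particle-hole equivariantization -/

namespace ParticleHole

theorem smul_injective {G : Type*} [AddCommGroup G] {a : G} (ha : a ≠ -a) : Function.Injective fun γ : ℤˣ => γ • a := by
  intro γ δ h
  rcases Int.units_eq_one_or γ with rfl | rfl <;> rcases Int.units_eq_one_or δ with rfl | rfl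
  · rfl
  · simp only [one_smul, Units.neg_smul] at h
    exact absurd h ha
  · simp only [one_smul, Units.neg_smul] at h
    exact absurd h.symm ha
  · rfl

open PointedCat ActionData EquivObj

variable {G : Type*} [AddCommGroup G] [Fintype G] [DecidableEq G] {A : AbelianCocycle G}
  (P : ParticleHole A)

/-- The basis vector of `X_b^ε`. -/
def xBasis (b : twoTorsion G) (ε : ℤˣ) : (P.X b ε).obj.V := (1 : ℂ)

theorem xBasis_homog (b : twoTorsion G) (ε : ℤˣ) :
    (P.X b ε).obj.IsHomog b (P.xBasis b ε) := isHomog_simple _ _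

theorem xBasis_ne_zero (b : twoTorsion G) (ε : ℤˣ) : P.xBasis b ε ≠ 0 := one_ne_zero (α := ℂ)

theorem eq_smul_xBasis (b : twoTorsion G) (ε : ℤˣ) (v : (P.X b ε).obj.V) :
    v = (show ℂ from v) • P.xBasis b ε := (mul_one (show ℂ from v)).symm

theorem vdim_X (b : twoTorsion G) (ε : ℤˣ) : (P.X b ε).vdim = 1 := Module.finrank_self ℂ

theorem vdim_Y (a : G) : (P.Y a).vdim = 2 := vdim_induced a

theorem act_X (b : twoTorsion G) (ε γ : ℤˣ) (v : (P.X b ε).obj.V) :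
    (P.X b ε).act γ v = (sign ε γ : ℂ) • v := signIso_apply b ε γ v

theorem sign_one (ε : ℤˣ) : sign ε 1 = 1 := if_pos rfl

theorem sign_neg_one (ε : ℤˣ) : (sign ε (-1) : ℂ) = ((ε : ℤ) : ℂ) := by
  have h : (-1 : ℤˣ) ≠ 1 := by decide
  simp [sign, h]

theorem act_one_two {Z : P.Equivariant} {b : twoTorsion G} {v : Z.obj.V}
    (hv : Z.obj.IsHomog b v) : Z.act 1 v = v := by
  rw [act_one hv, P.ν_two 1 1 b b.2, Units.val_one, one_smul]

/-- The normalization of `ν` enters here: in a degree `b = -b` the operator `u_{-1}` squares to the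
identity, so its eigenvalues are signs. -/
theorem act_act_two {Z : P.Equivariant} {b : twoTorsion G} {v : Z.obj.V}
    (hv : Z.obj.IsHomog b v) : Z.act (-1) (Z.act (-1) v) = v := by
  rw [Z.act_act _ _ hv, P.ν_two _ _ b b.2, Units.val_one, one_smul, neg_mul_neg, one_mul,
    P.act_one_two hv]

theorem act_homog_two {Z : P.Equivariant} {b : twoTorsion G} {v : Z.obj.V} (γ : ℤˣ)
    (hv : Z.obj.IsHomog b v) : Z.obj.IsHomog b (Z.act γ v) := by
  have := act_homog (γ := γ) hv
  rwa [ParticleHole.smul_eq γ b.2] at this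

variable {P}

/-- The morphism from `X_b^ε` given by a vector of degree `b` on which `u_{-1}` acts as `ε`. -/
def fromX {Z : P.Equivariant} {b : twoTorsion G} {ε : ℤˣ} {v : Z.obj.V}
    (hv : Z.obj.IsHomog b v) (hε : Z.act (-1) v = ((ε : ℤ) : ℂ) • v) : P.X b ε ⟶ Z :=
  homOfLin (Z := P.X b ε) (LinearMap.toSpanSingleton ℂ Z.obj.V v)
    (fun g x hx => by
      change Z.obj.IsHomog g ((show ℂ from x) • v)
      by_cases h0 : (show ℂ from x) = 0
      · rw [h0, zero_smul]
        exact map_zero _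
      · rw [simple_degree hx h0]
        exact hv.smul _)
    (fun γ g x hx => by
      rw [act_X]
      erw [map_smul]
      change (sign ε γ : ℂ) • (show ℂ from x) • v = Z.act γ ((show ℂ from x) • v)
      rw [map_smul, smul_comm]
      congr 1
      rcases Int.units_eq_one_or γ with rfl | rfl
      · rw [sign_one, Units.val_one, one_smul, P.act_one_two hv]
      · rw [sign_neg_one, hε])

theorem fromX_basis {Z : P.Equivariant} {b : twoTorsion G} {ε : ℤˣ} {v : Z.obj.V}
    (hv : Z.obj.IsHomog b v) (hε : Z.act (-1) v = ((ε : ℤ) : ℂ) • v) :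
    (fromX hv hε).hom.lin (P.xBasis b ε) = v := one_smul ℂ v

theorem fromX_injective {Z : P.Equivariant} {b : twoTorsion G} {ε : ℤˣ} {v : Z.obj.V}
    (hv : Z.obj.IsHomog b v) (hε : Z.act (-1) v = ((ε : ℤ) : ℂ) • v) (h0 : v ≠ 0) :
    Function.Injective (fromX hv hε).hom.lin := by
  refine (injective_iff_map_eq_zero _).2 fun x hx => ?_
  rw [P.eq_smul_xBasis b ε x, map_smul, fromX_basis, smul_eq_zero, or_iff_left h0] at hx
  exact hx

variable (P)

theorem surjective_to_X (b : twoTorsion G) (ε : ℤˣ) (W : P.Equivariant) (f : W ⟶ P.X b ε)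
    (hf : f ≠ 0) : Function.Surjective f.hom.lin := by
  obtain ⟨g, w, hw, h0⟩ := exists_homog_of_ne_zero hf
  intro x
  refine ⟨((show ℂ from x) / (show ℂ from f.hom.lin w)) • w, ?_⟩
  rw [map_smul]
  exact div_mul_cancel₀ (show ℂ from x) h0

theorem simple_X (b : twoTorsion G) (ε : ℤˣ) : Simple (P.X b ε) :=
  simple_of_surjective ⟨⟨_, 0, P.xBasis_ne_zero b ε⟩⟩ (P.surjective_to_X b ε)

theorem simple_Y {a : G} (ha : a ≠ -a) : Simple (P.Y a) := simple_induced (smul_injective ha)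

/-- Any nonzero homogeneous vector yields a nonzero injective morphism to `Z` from one of the listed
objects, and simplicity of `Z` makes it an isomorphism. -/
theorem simple_classification (Z : P.Equivariant) [Simple Z] :
    (∃ b ε, Nonempty (Z ≅ P.X b ε)) ∨ ∃ a : G, a ≠ -a ∧ Nonempty (Z ≅ P.Y a) := by
  obtain ⟨g, v, hv, h0⟩ := exists_homog_of_ne_zero (id_nonzero Z)
  rw [EquivObj.id_apply] at h0
  have key {W : P.Equivariant} (f : W ⟶ Z) (hf : f ≠ 0) (hi : Function.Injective f.hom.lin) :
      Nonempty (Z ≅ W) := by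
    have := mono_of_injective f hi
    have := isIso_of_mono_of_nonzero hf
    exact ⟨(asIso f).symm⟩
  by_cases hg : g = -g
  · left
    let b : twoTorsion G := ⟨g, hg⟩
    replace hv : Z.obj.IsHomog b v := hv
    have hX {ε : ℤˣ} {w : Z.obj.V} (hw : Z.obj.IsHomog b w)
        (hε : Z.act (-1) w = ((ε : ℤ) : ℂ) • w) (hw0 : w ≠ 0) :
        ∃ b ε, Nonempty (Z ≅ P.X b ε) :=
      ⟨b, ε, key (fromX hw hε) (ne_zero_of_apply (v := P.xBasis b ε) (by rwa [fromX_basis]))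
        (fromX_injective hw hε hw0)⟩
    -- The sum `v + u_{-1} v` is fixed by the involution. If it is zero, then `v` itself is an
    -- eigenvector for the sign `-1`.
    by_cases hw : v + Z.act (-1) v = 0
    · refine hX (ε := -1) hv ?_ h0
      rw [eq_neg_of_add_eq_zero_right hw]
      simp
    · refine hX (ε := 1) (hv.add (P.act_homog_two _ hv)) ?_ hw
      rw [map_add, P.act_act_two hv, add_comm]
      simp
  · right
    exact ⟨g, hg, key (fromInduced hv) (fromInduced_ne_zero hv h0)
      (fromInduced_injective (smul_injective hg) hv h0)⟩

theorem X_iso_X (b : twoTorsion G) (ε : ℤˣ) (b' : twoTorsion G) (ε' : ℤˣ) :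
    Nonempty (P.X b ε ≅ P.X b' ε') ↔ b = b' ∧ ε = ε' := by
  refine ⟨?_, fun h => by rw [h.1, h.2]; exact ⟨Iso.refl _⟩⟩
  rintro ⟨e⟩
  have h0 : e.hom.hom.lin (P.xBasis b ε) ≠ 0 := fun h => P.xBasis_ne_zero b ε
    ((linEquiv e).injective (h.trans (map_zero (linEquiv e)).symm))
  refine ⟨Subtype.ext (simple_degree ((P.xBasis_homog b ε).map e.hom.hom) h0), ?_⟩
  have h := hom_act e.hom (-1) (P.xBasis b ε)
  rw [act_X, act_X, map_smul, sign_neg_one, sign_neg_one] at h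
  have h1 := smul_left_injective ℂ h0 h
  exact Units.ext (by exact_mod_cast h1)

theorem Y_iso_Y (a a' : G) : Nonempty (P.Y a ≅ P.Y a') ↔ a = a' ∨ a = -a' := by
  refine (induced_iso_iff a a').trans ⟨?_, ?_⟩
  · rintro ⟨γ, h⟩
    rcases Int.units_eq_one_or γ with rfl | rfl
    · exact Or.inl (by rw [← h, one_smul])
    · exact Or.inr (by rw [← h, Units.neg_smul, one_smul])
  · rintro (rfl | rfl)
    · exact ⟨1, one_smul _ _⟩
    · exact ⟨-1, by rw [Units.neg_smul, one_smul]⟩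

theorem X_not_iso_Y (b : twoTorsion G) (ε : ℤˣ) (a : G) : IsEmpty (P.X b ε ≅ P.Y a) :=
  ⟨fun e => by
    have := vdim_congr e
    rw [vdim_X, vdim_Y] at this
    omega⟩

theorem unit_iso : Nonempty (𝟙_ P.Equivariant ≅ P.X 0 1) := by
  let v : (𝟙_ P.Equivariant).obj.V := (1 : ℂ)
  have hv : (𝟙_ P.Equivariant).obj.IsHomog (0 : twoTorsion G) v := isHomog_simple _ _
  have hε : (𝟙_ P.Equivariant).act (-1) v = (((1 : ℤˣ) : ℤ) : ℂ) • v := by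
    simp only [Units.val_one, Int.cast_one, one_smul]
    rfl
  refine ⟨(isoOfBijective (fromX hv hε) ?_).symm⟩
  have hi := fromX_injective hv hε (one_ne_zero (α := ℂ))
  exact ⟨hi, (LinearMap.injective_iff_surjective_of_finrank_eq_finrank
    ((P.vdim_X 0 1).trans (Module.finrank_self ℂ).symm)).1 hi⟩

/-- The basis vectors of `Y_a`. -/
def yBasis (a : G) (γ : ℤˣ) : (P.Y a).obj.V := inducedBasis P.toActionData a γ

theorem yBasis_homog (a : G) (γ : ℤˣ) : (P.Y a).obj.IsHomog (γ • a) (P.yBasis a γ) :=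
  inducedBasis_homog a γ

theorem act_Y (a : G) (γ δ : ℤˣ) :
    (P.Y a).act δ (P.yBasis a γ) = (P.ν δ γ a : ℂ) • P.yBasis a (δ * γ) := act_inducedBasis a γ δ

theorem act_Y_one (a : G) (δ : ℤˣ) :
    (P.Y a).act δ (P.yBasis a 1) = (P.ν δ 1 a : ℂ) • P.yBasis a δ := by
  rw [act_Y, mul_one]

theorem yBasis_span (a : G) {S : Submodule ℂ (P.Y a).obj.V} (hS : ∀ γ, P.yBasis a γ ∈ S) :
    S = ⊤ := inducedBasis_span a hS

/-- In a degree `b = -b` the involution swaps the two basis vectors, so `e_1 + e_{-1}` and `e_1 -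
e_{-1}` are eigenvectors for the two signs. -/
theorem Y_two (b : twoTorsion G) : Nonempty (P.Y b ≅ P.X b 1 ⊞ P.X b (-1)) := by
  have hh (γ : ℤˣ) : (P.Y b).obj.IsHomog b (P.yBasis b γ) := by
    have := P.yBasis_homog b γ
    rwa [ParticleHole.smul_eq γ b.2] at this
  have ha (γ : ℤˣ) : (P.Y b).act (-1) (P.yBasis b γ) = P.yBasis b (-γ) := by
    rw [act_Y, P.ν_two _ _ b b.2, Units.val_one, one_smul, neg_one_mul]
  let f : P.X b 1 ⟶ P.Y b := fromX ((hh 1).add (hh (-1))) (by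
    rw [map_add, ha, ha, neg_neg, add_comm]
    simp)
  let g : P.X b (-1) ⟶ P.Y b := fromX ((hh 1).add ((hh (-1)).smul (-1))) (by
    rw [map_add, map_smul, ha, ha, neg_neg, add_comm]
    simp)
  have hf : f.hom.lin (P.xBasis b 1) = P.yBasis b 1 + P.yBasis b (-1) := fromX_basis _ _
  have hg : g.hom.lin (P.xBasis b (-1)) = P.yBasis b 1 + (-1 : ℂ) • P.yBasis b (-1) :=
    fromX_basis _ _
  refine ⟨(isoOfBijective (biprod.desc f g) (desc_bijective f g ?_ ?_)).symm⟩
  · refine LinearMap.range_eq_top.1 (P.yBasis_span b fun γ => ?_)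
    have h1 : P.yBasis b 1 + P.yBasis b (-1) ∈
        LinearMap.range (f.hom.lin.coprod g.hom.lin) := ⟨(P.xBasis b 1, 0), by simp [hf]⟩
    have h2 : P.yBasis b 1 + (-1 : ℂ) • P.yBasis b (-1) ∈
        LinearMap.range (f.hom.lin.coprod g.hom.lin) := ⟨(0, P.xBasis b (-1)), by simp [hg]⟩
    rcases Int.units_eq_one_or γ with rfl | rfl
    · have := Submodule.smul_mem _ (1 / 2 : ℂ) (Submodule.add_mem _ h1 h2)
      convert this using 1
      module
    · have := Submodule.smul_mem _ (1 / 2 : ℂ) (Submodule.sub_mem _ h1 h2)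
      convert this using 1
      module
  · rw [vdim_X, vdim_X, vdim_Y]

/-- Since `μ` is `1` on the two-torsion, the sign of `u_{-1}` on the product is exactly the product
of the signs. -/
theorem X_tensor_X (b : twoTorsion G) (ε : ℤˣ) (b' : twoTorsion G) (ε' : ℤˣ) :
    Nonempty (P.X b ε ⊗ P.X b' ε' ≅ P.X (b + b') (ε * ε')) := by
  let v : (P.X b ε ⊗ P.X b' ε').obj.V :=
    (tm (P.xBasis b ε) (P.xBasis b' ε') : ((P.X b ε).obj ⊗ (P.X b' ε').obj).V)
  have hv : (P.X b ε ⊗ P.X b' ε').obj.IsHomog (b + b' : twoTorsion G) v :=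
    (P.xBasis_homog b ε).tm (P.xBasis_homog b' ε')
  have hε : (P.X b ε ⊗ P.X b' ε').act (-1) v = (((ε * ε' : ℤˣ) : ℤ) : ℂ) • v := by
    have h := act_tensor (P.X b ε) (P.X b' ε') (-1) (P.xBasis_homog b ε) (P.xBasis_homog b' ε')
    rw [P.μ_two _ b b.2 b' b'.2, Units.val_one, one_smul, act_X, act_X, smul_tm, tm_smul,
      smul_smul, sign_neg_one, sign_neg_one] at h
    refine h.trans ?_
    push_cast
    rfl
  have hv0 : v ≠ 0 := by
    have h : (TensorProduct.lid ℂ ℂ) (1 ⊗ₜ[ℂ] 1) = 1 := by simp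
    intro h0
    have h2 : (1 : ℂ) ⊗ₜ[ℂ] (1 : ℂ) = 0 := h0
    rw [h2, map_zero] at h
    exact zero_ne_one h
  have hi := fromX_injective hv hε hv0
  refine ⟨(isoOfBijective (fromX hv hε) ⟨hi,
    (LinearMap.injective_iff_surjective_of_finrank_eq_finrank ?_).1 hi⟩).symm⟩
  refine (P.vdim_X _ _).trans (Eq.symm ((vdim_tensor _ _).trans ?_))
  rw [vdim_X, vdim_X]

theorem xBasis_span (b : twoTorsion G) (ε : ℤˣ) :
    ⊤ ≤ Submodule.span ℂ (Set.range fun _ : Unit => P.xBasis b ε) := fun v _ => by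
  rw [P.eq_smul_xBasis b ε v]
  exact Submodule.smul_mem _ _ (Submodule.subset_span ⟨(), rfl⟩)

theorem yBasis_span' (a : G) : ⊤ ≤ Submodule.span ℂ (Set.range (P.yBasis a)) :=
  (P.yBasis_span a fun γ => Submodule.subset_span (Set.mem_range_self γ)).ge

theorem act_mem_range_fromInduced {Z : P.Equivariant} {a : G} {v : Z.obj.V}
    (hv : Z.obj.IsHomog a v) (γ : ℤˣ) :
    Z.act γ v ∈ LinearMap.range (show P.Y a ⟶ Z from fromInduced hv).hom.lin :=
  ⟨P.yBasis a γ, fromInduced_basis hv γ⟩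

/-- The sign `ε` is lost because it only rescales the translates of the generating vector `1 ⊗ e_1`,
of degree `a + b`. -/
theorem X_tensor_Y (b : twoTorsion G) (ε : ℤˣ) (a : G) :
    Nonempty (P.X b ε ⊗ P.Y a ≅ P.Y (a + b)) := by
  have hy : (P.Y a).obj.IsHomog a (P.yBasis a 1) := by
    simpa using P.yBasis_homog a 1
  have hv : (P.X b ε ⊗ P.Y a).obj.IsHomog (a + b)
      (tm (P.xBasis b ε) (P.yBasis a 1) : ((P.X b ε).obj ⊗ (P.Y a).obj).V) := by
    rw [add_comm]
    exact (P.xBasis_homog b ε).tm hy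
  have hs := tm_span (P.xBasis_span b ε) (P.yBasis_span' a)
    (S := LinearMap.range (show P.Y (a + b) ⟶ P.X b ε ⊗ P.Y a from fromInduced hv).hom.lin)
    fun _ γ => by
      exact tm_act_mem (P.xBasis_homog b ε) hy (P.act_X b ε γ _) (P.act_Y_one a γ)
        (P.act_mem_range_fromInduced hv γ)
  have hs' := LinearMap.range_eq_top.1 hs
  refine ⟨(isoOfBijective _ ⟨(LinearMap.injective_iff_surjective_of_finrank_eq_finrank ?_).2 hs',
    hs'⟩).symm⟩
  refine (P.vdim_Y _).trans (Eq.symm ((vdim_tensor _ _).trans ?_))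
  rw [vdim_X, vdim_Y]

/-- The opposite order is needed for the matrix of multiplication by `Y_a`, as no braiding on the
equivariantization is used. -/
theorem Y_tensor_X (a : G) (b : twoTorsion G) (ε : ℤˣ) :
    Nonempty (P.Y a ⊗ P.X b ε ≅ P.Y (a + b)) := by
  have hy : (P.Y a).obj.IsHomog a (P.yBasis a 1) := by
    simpa using P.yBasis_homog a 1
  have hv : (P.Y a ⊗ P.X b ε).obj.IsHomog (a + b)
      (tm (P.yBasis a 1) (P.xBasis b ε) : ((P.Y a).obj ⊗ (P.X b ε).obj).V) :=
    hy.tm (P.xBasis_homog b ε)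
  have hs := tm_span (P.yBasis_span' a) (P.xBasis_span b ε)
    (S := LinearMap.range (show P.Y (a + b) ⟶ P.Y a ⊗ P.X b ε from fromInduced hv).hom.lin)
    fun γ _ => by
      exact tm_act_mem hy (P.xBasis_homog b ε) (P.act_Y_one a γ) (P.act_X b ε γ _)
        (P.act_mem_range_fromInduced hv γ)
  have hs' := LinearMap.range_eq_top.1 hs
  refine ⟨(isoOfBijective _ ⟨(LinearMap.injective_iff_surjective_of_finrank_eq_finrank ?_).2 hs',
    hs'⟩).symm⟩
  refine (P.vdim_Y _).trans (Eq.symm ((vdim_tensor _ _).trans ?_))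
  rw [vdim_X, vdim_Y]

theorem Y_tensor_Y (a a' : G) :
    Nonempty (P.Y a ⊗ P.Y a' ≅ P.Y (a + a') ⊞ P.Y (a - a')) := by
  have hy : (P.Y a).obj.IsHomog a (P.yBasis a 1) := by
    simpa using P.yBasis_homog a 1
  have hy' : (P.Y a').obj.IsHomog a' (P.yBasis a' 1) := by
    simpa using P.yBasis_homog a' 1
  have hv : (P.Y a ⊗ P.Y a').obj.IsHomog (a + a')
      (tm (P.yBasis a 1) (P.yBasis a' 1) : ((P.Y a).obj ⊗ (P.Y a').obj).V) := hy.tm hy'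
  have hy'' : (P.Y a').obj.IsHomog (-a') (P.yBasis a' (-1)) := by
    simpa [Units.neg_smul] using P.yBasis_homog a' (-1)
  have hw : (P.Y a ⊗ P.Y a').obj.IsHomog (a - a')
      (tm (P.yBasis a 1) (P.yBasis a' (-1)) : ((P.Y a).obj ⊗ (P.Y a').obj).V) := by
    rw [sub_eq_add_neg]
    exact hy.tm hy''
  let f : P.Y (a + a') ⟶ P.Y a ⊗ P.Y a' := fromInduced hv
  let g : P.Y (a - a') ⟶ P.Y a ⊗ P.Y a' := fromInduced hw
  have hs := tm_span (P.yBasis_span' a) (P.yBasis_span' a')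
    (S := LinearMap.range (f.hom.lin.coprod g.hom.lin)) fun γ δ => by
      rw [LinearMap.range_coprod]
      -- The tensors `e_γ ⊗ e_δ` form two orbits: those with `δ = γ` are translates of `e_1 ⊗ e_1`,
      -- those with `δ = -γ` of `e_1 ⊗ e_{-1}`.
      have hδ : δ = γ ∨ γ * -1 = δ := by
        revert γ δ
        decide
      rcases hδ with rfl | rfl
      · exact SetLike.le_def.1 (le_sup_left (a := LinearMap.range f.hom.lin)) (tm_act_mem hy hy' (P.act_Y_one a δ) (P.act_Y_one a' δ)
          (P.act_mem_range_fromInduced hv δ))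
      · exact SetLike.le_def.1 (le_sup_right (b := LinearMap.range g.hom.lin)) (tm_act_mem hy hy'' (P.act_Y_one a γ) (P.act_Y a' (-1) γ)
          (P.act_mem_range_fromInduced hw γ))
  refine ⟨(isoOfBijective _ (desc_bijective f g (LinearMap.range_eq_top.1 hs) ?_)).symm⟩
  rw [vdim_tensor, vdim_Y, vdim_Y, vdim_Y, vdim_Y]

/-- If `a = ±a'`, one of the degrees `a - a'` and `a + a'` is `0` and the other is `2a`; the summand
`Y_0` then splits by `Y_two`. -/
theorem Y_tensor_Y_of_eq (a a' : G) (h : a = a' ∨ a = -a') :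
    Nonempty (P.Y a ⊗ P.Y a' ≅ P.X 0 1 ⊞ (P.X 0 (-1) ⊞ P.Y (a + a))) := by
  obtain ⟨e₀⟩ := P.Y_two 0
  obtain ⟨e⟩ := P.Y_tensor_Y a a'
  have e₁ : P.X 0 1 ⊞ (P.X 0 (-1) ⊞ P.Y (a + a)) ≅ P.Y (0 : twoTorsion G) ⊞ P.Y (a + a) :=
    (biprod.associator _ _ _).symm ≪≫ biprod.mapIso e₀.symm (Iso.refl _)
  rcases h with rfl | rfl
  · rw [sub_self] at e
    exact ⟨e ≪≫ biprod.braiding _ _ ≪≫ e₁.symm⟩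
  · rw [neg_add_cancel, sub_eq_add_neg] at e
    exact ⟨e ≪≫ e₁.symm⟩

end ParticleHole

/-! ### Frobenius–Perron dimension from a positive left eigenvector -/

section FrobeniusPerron

variable {D : Type*} [Category D] [Preadditive D] [Linear ℂ D] [MonoidalCategory D]

/-- If a strictly positive function on the simple objects is a left eigenvector of the matrix of
multiplication by `X`, then its eigenvalue is the Frobenius-Perron dimension of `X`. -/
theorem isFPdim_of_left_eigenvector [Fintype (Irr D)] [Nonempty (Irr D)] {X : D} {x : ℝ}
    (d : Irr D → ℝ) (hd : ∀ j, 0 < d j)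
    (h : ∀ j : Irr D, ∑ k : Irr D, (fusionCoeff X j.1.out k.1.out : ℝ) * d k = x * d j) :
    IsFPdim X x := by
  classical
  let N : Matrix (Irr D) (Irr D) ℝ := .of fun k j => (fusionCoeff X j.1.out k.1.out : ℝ)
  constructor
  -- A left eigenvector makes `N - x` singular, and a singular matrix also has a right null vector;
  -- this shows that `x` is attained.
  · have h1 : ∃ v ≠ 0, Matrix.vecMul v (N - x • (1 : Matrix (Irr D) (Irr D) ℝ)) = 0 := by
      refine ⟨d, fun h0 => ?_, ?_⟩
      · obtain ⟨j⟩ := ‹Nonempty (Irr D)›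
        exact (hd j).ne' (congrFun h0 j)
      · ext j
        simp only [Matrix.vecMul_sub, Matrix.vecMul_smul, Matrix.vecMul_one, Pi.sub_apply,
          Pi.smul_apply, smul_eq_mul, Pi.zero_apply, sub_eq_zero, ← h j]
        exact Finset.sum_congr rfl fun k _ => mul_comm _ _
    obtain ⟨v, hv, hNv⟩ := Matrix.exists_mulVec_eq_zero_iff.2
      (Matrix.exists_vecMul_eq_zero_iff.1 h1)
    refine ⟨v, hv, fun k => ?_⟩
    have h2 := congrFun hNv k
    simp only [Matrix.sub_mulVec, Matrix.smul_mulVec, Matrix.one_mulVec, Pi.sub_apply,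
      Pi.smul_apply, smul_eq_mul, Pi.zero_apply, sub_eq_zero] at h2
    rw [finsum_eq_sum_of_fintype, ← h2]
    rfl
  · rintro y ⟨v, hv, hy⟩
    -- For any real eigenvalue `y` with eigenvector `v`, nonnegativity of the matrix gives `y |v| ≤
    -- N |v|`. Pairing with `d` turns the right side into `x` times the same positive number.
    have hpos : 0 < ∑ k, d k * |v k| := by
      obtain ⟨k, hk⟩ := Function.ne_iff.1 hv
      exact Finset.sum_pos' (fun k _ => mul_nonneg (hd k).le (abs_nonneg _))
        ⟨k, Finset.mem_univ _, mul_pos (hd k) (abs_pos.2 hk)⟩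
    refine le_of_mul_le_mul_right ?_ hpos
    calc y * ∑ k, d k * |v k| = ∑ k, d k * (y * |v k|) := by
          rw [Finset.mul_sum]
          exact Finset.sum_congr rfl fun k _ => by ring
      _ ≤ ∑ k, d k * ∑ j : Irr D, (fusionCoeff X j.1.out k.1.out : ℝ) * |v j| := by
          refine Finset.sum_le_sum fun k _ => mul_le_mul_of_nonneg_left ?_ (hd k).le
          calc y * |v k| ≤ |y * v k| := by
                rw [abs_mul]
                exact mul_le_mul_of_nonneg_right (le_abs_self y) (abs_nonneg _)
            _ ≤ _ := by
                rw [← hy k, finsum_eq_sum_of_fintype]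
                refine (Finset.abs_sum_le_sum_abs _ _).trans_eq ?_
                exact Finset.sum_congr rfl fun j _ => by rw [abs_mul, Nat.abs_cast]
      _ = ∑ j : Irr D, (∑ k : Irr D, (fusionCoeff X j.1.out k.1.out : ℝ) * d k) * |v j| := by
          simp only [Finset.mul_sum, Finset.sum_mul]
          rw [Finset.sum_comm]
          exact Finset.sum_congr rfl fun j _ => Finset.sum_congr rfl fun k _ => by ring
      _ = x * ∑ k, d k * |v k| := by
          rw [Finset.mul_sum]
          exact Finset.sum_congr rfl fun j _ => by rw [h j, mul_assoc]

end FrobeniusPerron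

/-! ### Dimensions of morphism spaces -/

namespace EquivObj

open PointedCat ActionData

variable {G : Type*} [AddCommGroup G] [Fintype G] [DecidableEq G] {A : AbelianCocycle G}
  {Γ : Type*} [Group Γ] [DistribMulAction Γ G] {D : ActionData Γ A}

/-- The linear map underlying a morphism, as a linear function of the morphism. -/
def linHom (Z W : EquivObj D.toMonoidalAction) : (Z ⟶ W) →ₗ[ℂ] Z.obj.V →ₗ[ℂ] W.obj.V where
  toFun f := f.hom.lin
  map_add' _ _ := rfl
  map_smul' _ _ := rfl

instance (Z W : EquivObj D.toMonoidalAction) : FiniteDimensional ℂ (Z ⟶ W) :=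
  Module.Finite.of_injective (linHom Z W) fun _ _ h =>
    EquivObj.hom_ext (PointedCat.hom_ext h)

/-- Morphisms out of a direct sum. -/
noncomputable def biprodHomEquiv (Z W U : EquivObj D.toMonoidalAction) :
    (Z ⊞ W ⟶ U) ≃ₗ[ℂ] (Z ⟶ U) × (W ⟶ U) where
  toFun f := (biprod.inl ≫ f, biprod.inr ≫ f)
  map_add' f g := by simp
  map_smul' c f := by simp
  invFun p := biprod.desc p.1 p.2
  left_inv f := by
    refine biprod.hom_ext' _ _ ?_ ?_ <;> simp
  right_inv p := by simp

theorem finrank_biprod_hom (Z W U : EquivObj D.toMonoidalAction) :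
    Module.finrank ℂ (Z ⊞ W ⟶ U) = Module.finrank ℂ (Z ⟶ U) + Module.finrank ℂ (W ⟶ U) := by
  rw [(biprodHomEquiv Z W U).finrank_eq, Module.finrank_prod]

theorem finrank_hom_congr {Z W : EquivObj D.toMonoidalAction} (e : Z ≅ W)
    (U : EquivObj D.toMonoidalAction) :
    Module.finrank ℂ (Z ⟶ U) = Module.finrank ℂ (W ⟶ U) :=
  (Linear.homCongr ℂ e (Iso.refl U)).finrank_eq

end EquivObj

/-! ### Schur's lemma and the dimension vector -/

namespace ParticleHole

open PointedCat ActionData EquivObj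

variable {G : Type*} [AddCommGroup G] [Fintype G] [DecidableEq G] {A : AbelianCocycle G}
  (P : ParticleHole A)

/-- Surjectivity is already known for morphisms to the `X_b^ε` and to the `Y_a` with `a ≠ -a`; the
classification transports it to every simple object. -/
theorem surjective_of_simple {Z : P.Equivariant} [Simple Z] {W : P.Equivariant} (f : W ⟶ Z)
    (hf : f ≠ 0) : Function.Surjective f.hom.lin := by
  have key {S : P.Equivariant} (e : Z ≅ S)
      (hS : ∀ g : W ⟶ S, g ≠ 0 → Function.Surjective g.hom.lin) :
      Function.Surjective f.hom.lin := fun z => by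
    obtain ⟨w, hw⟩ := hS (f ≫ e.hom) (fun h => hf (by
      rw [← cancel_mono e.hom, h, zero_comp])) (linEquiv e z)
    exact ⟨w, (linEquiv e).injective hw⟩
  rcases P.simple_classification Z with ⟨b, ε, ⟨e⟩⟩ | ⟨a, ha, ⟨e⟩⟩
  · exact key e (P.surjective_to_X b ε W)
  · exact key e (surjective_to_induced (smul_injective ha) W)

/-- A homogeneous kernel vector induces a morphism from `Y_g` that is onto the simple object `Z`. As
the kernel is stable under the `u_γ`, the composite with `f` is zero, and so is `f`. -/
theorem injective_of_simple {Z W : P.Equivariant} [Simple Z] (f : Z ⟶ W) (hf : f ≠ 0) :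
    Function.Injective f.hom.lin := by
  refine (injective_iff_map_eq_zero _).2 fun v hv => ?_
  by_contra hv0
  obtain ⟨g, hg⟩ := exists_homog_ne_zero hv0
  have hw : f.hom.lin (Z.obj.proj g v) = 0 := by rw [← f.hom.comm, hv, map_zero]
  let φ : P.Y g ⟶ Z := fromInduced (Z.obj.isHomog_proj g v)
  have hs : Function.Surjective φ.hom.lin :=
    P.surjective_of_simple φ (fromInduced_ne_zero _ hg)
  have hz : LinearMap.ker (f.hom.lin ∘ₗ φ.hom.lin) = ⊤ := P.yBasis_span g fun γ => by
    have h1 : φ.hom.lin (P.yBasis g γ) = Z.act γ (Z.obj.proj g v) := fromInduced_basis _ γ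
    rw [LinearMap.mem_ker, LinearMap.comp_apply, h1, hom_act, hw, map_zero]
  refine hf (lin_ext fun z => ?_)
  obtain ⟨y, rfl⟩ := hs z
  exact LinearMap.mem_ker.1 (show y ∈ LinearMap.ker (f.hom.lin ∘ₗ φ.hom.lin) from
    hz ▸ Submodule.mem_top)

/-- Schur's lemma for nonisomorphic simple objects. -/
theorem finrank_hom_eq_zero {Z W : P.Equivariant} [Simple Z] [Simple W]
    (h : IsEmpty (Z ≅ W)) : Module.finrank ℂ (Z ⟶ W) = 0 := by
  have : Subsingleton (Z ⟶ W) := subsingleton_of_forall_eq 0 fun f => by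
    by_contra hf
    exact h.elim (isoOfBijective f ⟨P.injective_of_simple f hf, P.surjective_of_simple f hf⟩)
  exact Module.finrank_zero_of_subsingleton

/-- Schur's lemma for isomorphic simple objects. -/
theorem finrank_hom_eq_one {Z W : P.Equivariant} [Simple Z] (e : Z ≅ W) :
    Module.finrank ℂ (Z ⟶ W) = 1 := by
  have h1 : Module.finrank ℂ (Z ⟶ W) = Module.finrank ℂ (Z ⟶ Z) :=
    (Linear.homCongr ℂ (Iso.refl Z) e.symm).finrank_eq
  rw [h1]
  refine finrank_eq_one (𝟙 Z) (id_nonzero Z) fun f => ?_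
  have : Nontrivial Z.obj.V := by
    obtain ⟨g, w, _, hw⟩ := exists_homog_of_ne_zero (id_nonzero Z)
    exact ⟨⟨_, 0, hw⟩⟩
  -- For an eigenvalue `c`, the endomorphism `c • 𝟙 - f` has an eigenvector in its kernel; not being
  -- injective, it must be zero.
  obtain ⟨c, hc⟩ := Module.End.exists_eigenvalue (show Module.End ℂ Z.obj.V from f.hom.lin)
  obtain ⟨v, hv⟩ := hc.exists_hasEigenvector
  refine ⟨c, ?_⟩
  by_contra hne
  have hne' : c • 𝟙 Z - f ≠ 0 := fun h => hne (sub_eq_zero.1 h)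
  refine hv.2 (P.injective_of_simple _ hne' ?_)
  rw [map_zero]
  have : (c • 𝟙 Z - f).hom.lin v = c • v - f.hom.lin v := rfl
  rw [this, sub_eq_zero]
  exact hv.apply_eq_smul.symm

/-- The isomorphism class of a simple object. -/
def irrMk (Z : P.Equivariant) (hZ : Simple Z) : Irr P.Equivariant :=
  ⟨Quotient.mk _ Z, Simple.of_iso (Quotient.mk_out (s := isIsomorphicSetoid _) Z).some⟩

theorem irr_iso (Z : P.Equivariant) (hZ : Simple Z) :
    Nonempty ((P.irrMk Z hZ).1.out ≅ Z) := Quotient.mk_out (s := isIsomorphicSetoid _) Z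

theorem irr_ext {j k : Irr P.Equivariant} (e : j.1.out ≅ k.1.out) : j = k :=
  Subtype.ext (Quotient.out_equiv_out.1 ⟨e⟩)

instance : Finite (Irr P.Equivariant) := by
  let f : (twoTorsion G × ℤˣ) ⊕ {a : G // a ≠ -a} → Irr P.Equivariant := Sum.elim
    (fun p => P.irrMk (P.X p.1 p.2) (P.simple_X p.1 p.2))
    (fun a => P.irrMk (P.Y a) (P.simple_Y a.2))
  refine Finite.of_surjective f fun k => ?_
  have := k.2
  rcases P.simple_classification k.1.out with ⟨b, ε, ⟨e⟩⟩ | ⟨a, ha, ⟨e⟩⟩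
  · exact ⟨Sum.inl (b, ε), P.irr_ext ((P.irr_iso _ (P.simple_X b ε)).some ≪≫ e.symm)⟩
  · exact ⟨Sum.inr ⟨a, ha⟩, P.irr_ext ((P.irr_iso _ (P.simple_Y ha)).some ≪≫ e.symm)⟩

noncomputable instance : Fintype (Irr P.Equivariant) := Fintype.ofFinite _

/-- The object `Z` has the same dimension as the sum of its simple constituents. -/
def DimSum (Z : P.Equivariant) : Prop :=
  ∑ k : Irr P.Equivariant, Module.finrank ℂ (Z ⟶ k.1.out) * vdim k.1.out = Z.vdim

variable {P}

theorem DimSum.congr {Z W : P.Equivariant} (e : Z ≅ W) (hW : P.DimSum W) : P.DimSum Z := by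
  rw [DimSum, vdim_congr e, ← hW]
  exact Finset.sum_congr rfl fun k _ => by rw [finrank_hom_congr e]

theorem DimSum.biprod {Z W : P.Equivariant} (hZ : P.DimSum Z) (hW : P.DimSum W) :
    P.DimSum (Z ⊞ W) := by
  rw [DimSum, vdim_biprod, ← hZ, ← hW, ← Finset.sum_add_distrib]
  exact Finset.sum_congr rfl fun k _ => by rw [finrank_biprod_hom, add_mul]

variable (P)

/-- By Schur's lemma only the class of `Z` itself contributes, with multiplicity one. -/
theorem dimSum_simple (Z : P.Equivariant) [hZ : Simple Z] : P.DimSum Z := by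
  have e := (P.irr_iso Z hZ).some
  rw [DimSum, Finset.sum_eq_single (P.irrMk Z hZ) (fun k _ hk => ?_) (by simp),
    P.finrank_hom_eq_one e.symm, one_mul, vdim_congr e]
  have := k.2
  rw [P.finrank_hom_eq_zero ⟨fun e' => hk (P.irr_ext (e'.symm ≪≫ e.symm))⟩, zero_mul]

theorem dimSum_X (b : twoTorsion G) (ε : ℤˣ) : P.DimSum (P.X b ε) :=
  have := P.simple_X b ε
  P.dimSum_simple _

theorem dimSum_Y (a : G) : P.DimSum (P.Y a) := by
  by_cases ha : a = -a
  · exact ((P.dimSum_X ⟨a, ha⟩ 1).biprod (P.dimSum_X ⟨a, ha⟩ (-1))).congr (P.Y_two ⟨a, ha⟩).some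
  · have := P.simple_Y ha
    exact P.dimSum_simple _

theorem vdim_pos (Z : P.Equivariant) [Simple Z] : 0 < Z.vdim := by
  rcases P.simple_classification Z with ⟨b, ε, ⟨e⟩⟩ | ⟨a, ha, ⟨e⟩⟩
  · rw [vdim_congr e, vdim_X]
    exact one_pos
  · rw [vdim_congr e, vdim_Y]
    exact two_pos

/-- Since `dim (Z ⊗ W) = dim Z * dim W`, the hypothesis says that the dimensions of the simple
objects form a left eigenvector with eigenvalue `dim Z`. -/
theorem isFPdim_of_dimSum (Z : P.Equivariant)
    (h : ∀ W : P.Equivariant, Simple W → P.DimSum (Z ⊗ W)) : IsFPdim Z Z.vdim := by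
  have : Nonempty (Irr P.Equivariant) := ⟨P.irrMk _ (P.simple_X 0 1)⟩
  refine isFPdim_of_left_eigenvector (fun k => (vdim k.1.out : ℝ)) (fun k => ?_) fun j => ?_
  · have := k.2
    exact_mod_cast P.vdim_pos k.1.out
  · have h1 := h j.1.out j.2
    rw [DimSum, vdim_tensor] at h1
    exact_mod_cast h1

theorem isFPdim_X (b : twoTorsion G) (ε : ℤˣ) : IsFPdim (P.X b ε) 1 := by
  have h := P.isFPdim_of_dimSum (P.X b ε) fun W hW => by
    rcases P.simple_classification W with ⟨b', ε', ⟨e⟩⟩ | ⟨a, ha, ⟨e⟩⟩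
    · exact (P.dimSum_X _ _).congr (whiskerLeftIso _ e ≪≫ (P.X_tensor_X b ε b' ε').some)
    · exact (P.dimSum_Y _).congr (whiskerLeftIso _ e ≪≫ (P.X_tensor_Y b ε a).some)
  rwa [vdim_X, Nat.cast_one] at h

theorem isFPdim_Y (a : G) : IsFPdim (P.Y a) 2 := by
  have h := P.isFPdim_of_dimSum (P.Y a) fun W hW => by
    rcases P.simple_classification W with ⟨b', ε', ⟨e⟩⟩ | ⟨a', ha, ⟨e⟩⟩
    · exact (P.dimSum_Y _).congr (whiskerLeftIso _ e ≪≫ (P.Y_tensor_X a b' ε').some)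
    · exact ((P.dimSum_Y _).biprod (P.dimSum_Y _)).congr
        (whiskerLeftIso _ e ≪≫ (P.Y_tensor_Y a a').some)
  rwa [vdim_Y, Nat.cast_ofNat] at h

end ParticleHole

/-! ### Abelian cocycles and actions descended from a bilinear map -/

section Descent

/-- A bilinear map on a group `L` mapping onto `G` with a chosen section, which descends to an
abelian 3-cocycle on `G`. -/
structure DescentDatum (G L : Type*) [AddCommGroup G] [AddCommGroup L] where
  π : L →+ G
  s : G → L
  B : LinearMap.BilinMap ℤ L (Additive ℂˣ)
  π_s : ∀ a, π (s a) = a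
  s_zero : s 0 = 0
  ker_ker : ∀ k l, π k = 0 → π l = 0 → B k l = 0
  ker_anti : ∀ k x, π k = 0 → B k x = -B x k

namespace DescentDatum

variable {G L : Type*} [AddCommGroup G] [AddCommGroup L] (E : DescentDatum G L)

theorem π_defect (a b : G) : E.π (E.s a + E.s b - E.s (a + b)) = 0 := by
  simp [E.π_s]

/-- The abelian 3-cocycle on the quotient. -/
def cocycle : AbelianCocycle G where
  ω a b c := (E.B (E.s a) (E.s b + E.s c - E.s (b + c))).toMul
  c a b := (E.B (E.s a) (E.s b)).toMul
  normalized a b := by simp [E.s_zero]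
  pentagon a b c d := by
    refine Additive.ofMul.injective ?_
    -- After expansion the two sides of the pentagon differ by the pairing of the defects of `(a,
    -- b)` and `(c, d)`, both in the kernel.
    have h := E.ker_ker _ _ (E.π_defect a b) (E.π_defect c d)
    simp only [map_add, map_sub, LinearMap.add_apply, LinearMap.sub_apply] at h
    simp only [ofMul_mul, ofMul_toMul, map_add, map_sub, ← add_assoc b c d]
    linear_combination (norm := module) (1 : ℤ) • h
  hexagon_forward x y z := by
    refine Additive.ofMul.injective ?_
    -- This hexagon is pure bilinearity; the other one needs antisymmetry of the defect of `(x, y)`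
    -- against `s z`.
    simp only [ofMul_mul, ofMul_toMul, map_add, map_sub, add_comm z x]
    module
  hexagon_reverse x y z := by
    refine Additive.ofMul.injective ?_
    have h := E.ker_anti _ (E.s z) (E.π_defect x y)
    simp only [map_add, map_sub, LinearMap.add_apply, LinearMap.sub_apply] at h
    simp only [ofMul_mul, ofMul_inv, ofMul_toMul, map_add, map_sub, add_comm z y]
    linear_combination (norm := module) (-1 : ℤ) • h

variable {Γ : Type*} [Group Γ] [DistribMulAction Γ G] (σ : Γ →* AddMonoid.End L)

/-- The failure of the section to be equivariant. -/
def twist (γ : Γ) (a : G) : L := E.s (γ • a) - σ γ (E.s a)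

/-- A lift of the action on `G` to an action on `L` that preserves the bilinear map. -/
structure Lift : Prop where
  equivariant : ∀ γ x, E.π (σ γ x) = γ • E.π x
  isometry : ∀ γ x y, E.B (σ γ x) (σ γ y) = E.B x y
  ker_right : ∀ γ x k, E.π k = 0 → E.B (σ γ x) k = E.B x k

variable {E σ}

namespace Lift

theorem π_twist (h : E.Lift σ) (γ : Γ) (a : G) : E.π (E.twist σ γ a) = 0 := by
  simp [twist, E.π_s, h.equivariant]

/-- The vectors `s (γ • a)` and `σ γ (s a)` differ by a kernel element, which pairs trivially with
the kernel. -/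
theorem B_s_smul (h : E.Lift σ) (γ : Γ) (a : G) {k : L} (hk : E.π k = 0) :
    E.B (E.s (γ • a)) k = E.B (E.s a) k := by
  have h1 := E.ker_ker _ _ (h.π_twist γ a) hk
  rw [twist, map_sub, LinearMap.sub_apply, h.ker_right γ _ _ hk, sub_eq_zero] at h1
  exact h1

theorem B_σ_right (h : E.Lift σ) (γ : Γ) (x : L) {k : L} (hk : E.π k = 0) :
    E.B x (σ γ k) = E.B x k := by
  have hk' : E.π (σ γ k) = 0 := by rw [h.equivariant, hk, smul_zero]
  rw [← h.ker_right γ x _ hk', h.isometry]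

/-- The action on the pointed category induced by a lift. -/
def actionData (h : E.Lift σ) : ActionData Γ E.cocycle where
  μ γ a b := (E.B (E.s a) (E.twist σ γ b)).toMul
  ν _ _ _ := 1
  μ_zero_left γ a := by simp [E.s_zero]
  μ_zero_right γ a := by simp [twist, E.s_zero]
  μ_assoc γ a b c := by
    refine Additive.ofMul.injective ?_
    simp only [cocycle, ofMul_mul, ofMul_toMul]
    have h1 := E.π_defect (γ • b) (γ • c)
    rw [h.B_s_smul γ a h1]
    -- The defect of the translated pair is the translate of the defect plus the coboundary of the
    -- twist; the remaining term pairs two kernel elements.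
    have h2 : E.s (γ • b) + E.s (γ • c) - E.s (γ • b + γ • c) =
        E.twist σ γ b + E.twist σ γ c - E.twist σ γ (b + c) +
          σ γ (E.s b + E.s c - E.s (b + c)) := by
      simp only [twist, smul_add, map_add, map_sub]
      abel
    have h3 := E.ker_ker _ _ (E.π_defect a b) (h.π_twist γ c)
    rw [h2, map_add, h.B_σ_right γ _ (E.π_defect b c)]
    simp only [map_add, map_sub, LinearMap.add_apply, LinearMap.sub_apply] at h3 ⊢
    linear_combination (norm := module) (-1 : ℤ) • h3
  ν_monoidal γ δ a b := by
    refine Additive.ofMul.injective ?_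
    simp only [mul_one, one_mul, ofMul_mul, ofMul_toMul]
    -- With `ν = 1` the claim is multiplicativity of `μ`, which follows from `twist (γδ) b = twist γ
    -- (δ • b) + σ γ (twist δ b)`.
    rw [h.B_s_smul δ a (h.π_twist γ _), ← h.B_σ_right γ _ (h.π_twist δ b), ← map_add]
    simp [twist, mul_smul]
  ν_assoc _ _ _ _ := rfl

/-- Expand `B` at `s (γ • a) = σ γ (s a) + twist` and likewise for `b`. The main term is preserved
by the isometry, the two cross terms are `μ γ a b` and, by antisymmetry, the inverse of `μ γ b a`,
and the last term vanishes. -/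
theorem μ_braiding (h : E.Lift σ) (γ : Γ) (a b : G) :
    h.actionData.μ γ a b * E.cocycle.c a b =
      E.cocycle.c (γ • a) (γ • b) * h.actionData.μ γ b a := by
  refine Additive.ofMul.injective ?_
  simp only [cocycle, actionData, ofMul_mul, ofMul_toMul]
  have ha : E.s (γ • a) = σ γ (E.s a) + E.twist σ γ a := by simp [twist]
  have hb : E.s (γ • b) = σ γ (E.s b) + E.twist σ γ b := by simp [twist]
  rw [ha, hb]
  simp only [map_add, LinearMap.add_apply]
  rw [h.isometry, h.ker_right γ _ _ (h.π_twist γ b), E.ker_anti _ _ (h.π_twist γ a),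
    h.ker_right γ _ _ (h.π_twist γ a), E.ker_ker _ _ (h.π_twist γ a) (h.π_twist γ b)]
  module

end Lift

end DescentDatum

end Descent

namespace ActionData

open PointedCat

theorem preservesBraiding {G : Type*} [AddCommGroup G] [Fintype G] [DecidableEq G]
    {A : AbelianCocycle G} {Γ : Type*} [Group Γ] [DistribMulAction Γ G] (D : ActionData Γ A)
    (h : ∀ γ a b, D.μ γ a b * A.c a b = A.c (γ • a) (γ • b) * D.μ γ b a) :
    D.toMonoidalAction.PreservesBraiding := fun γ X Y => by
  change (D.μIso γ X Y).hom ≫ (T A γ).map (β_ X Y).hom =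
    (β_ ((T A γ).obj X) ((T A γ).obj Y)).hom ≫ (D.μIso γ Y X).hom
  refine T_ext₂ fun a b u v hu hv => ?_
  have h' := congrArg (fun x : ℂˣ => (x : ℂ)) (h γ a b)
  simp only [Units.val_mul] at h'
  rw [hom_comp_apply, hom_comp_apply, D.μIso_tm γ hu hv, map_smul, map_sh,
    braiding_hom_tm hu hv, braiding_hom_tm (IsHomog.sh hu) (IsHomog.sh hv), map_smul, map_smul,
    D.μIso_tm γ hv hu, smul_smul, smul_smul, h']

end ActionData

/-! ### Quadratic forms as quadratic maps over the integers -/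

section QuadraticForm

open QuadraticMap

variable {G : Type*} [AddCommGroup G]

/-- A quadratic form with values in `ℂˣ` as a quadratic map of `ℤ`-modules. -/
def IsQuadraticForm.toQuadraticMap {q : G → ℂˣ} (hq : IsQuadraticForm q) :
    QuadraticMap ℤ G (Additive ℂˣ) := by
  have hadd (x x' y : G) : polar (fun g => Additive.ofMul (q g)) (x + x') y =
      polar (fun g => Additive.ofMul (q g)) x y + polar (fun g => Additive.ofMul (q g)) x' y := by
    have h := congrArg Additive.ofMul (hq.bimultiplicative x x' y)
    simp only [ofMul_mul, ofMul_div] at h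
    simp only [polar]
    linear_combination (norm := module) (1 : ℤ) • h
  have hsmul (n : ℤ) (x y : G) : polar (fun g => Additive.ofMul (q g)) (n • x) y =
      n • polar (fun g => Additive.ofMul (q g)) x y :=
    map_zsmul (AddMonoidHom.mk' (fun x => polar (fun g => Additive.ofMul (q g)) x y)
      fun x x' => hadd x x' y) n x
  have h0 : Additive.ofMul (q 0) = 0 := by
    have h : q 0 = 1 := by simpa using hq.bimultiplicative 0 0 0
    rw [h, ofMul_one]
  -- The symmetry `q (-x) = q x` enters here. It excludes a linear part and makes the polar form at
  -- `(x, x)` twice the value at `x`, from which `q (n x) = n² q x` follows by induction in both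
  -- directions.
  have hpol (x : G) : polar (fun g => Additive.ofMul (q g)) x x =
      (2 : ℤ) • Additive.ofMul (q x) := by
    have h := hsmul (-1) x x
    simp only [polar, neg_smul, one_smul, neg_add_cancel, h0, hq.map_neg] at h ⊢
    linear_combination (norm := module) (1 : ℤ) • h
  refine QuadraticMap.ofPolar (fun g => Additive.ofMul (q g)) (fun n x => ?_) hadd hsmul
  induction n with
  | zero => simp [h0]
  | succ n ih =>
    have h := hsmul n x x
    rw [hpol] at h
    simp only [polar] at h
    rw [add_smul, one_smul]
    linear_combination (norm := module) (1 : ℤ) • h + (1 : ℤ) • ih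
  | pred n ih =>
    have h := hsmul (-n - 1) x x
    rw [hpol] at h
    simp only [polar] at h
    rw [show (-(n : ℤ) - 1) • x + x = -(n : ℤ) • x by module] at h
    linear_combination (norm := module) (-1 : ℤ) • h + (1 : ℤ) • ih

end QuadraticForm


/-! ### A lift of inversion to the lattice -/

section SignAction

variable {ι : Type*} {G : Type*} [AddCommGroup G]

/-- The action of the signs on `ι → ℤ` by negation, except that it is trivial on the coordinates
`i` with `n i = 2`. -/
def signAction (n : ι → ℕ) : ℤˣ →* AddMonoid.End (ι → ℤ) where
  toFun γ :=
    { toFun := fun x i => if n i = 2 then x i else γ * x i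
      map_zero' := by ext; simp
      map_add' := fun x y => by
        ext i
        by_cases h : n i = 2 <;> simp [h, mul_add] }
  map_one' := by
    refine AddMonoidHom.ext fun x => funext fun i => ?_
    change (if n i = 2 then x i else ((1 : ℤˣ) : ℤ) * x i) = x i
    simp
  map_mul' γ δ := by
    refine AddMonoidHom.ext fun x => funext fun i => ?_
    change (if n i = 2 then x i else ((γ * δ : ℤˣ) : ℤ) * x i) =
      if n i = 2 then (if n i = 2 then x i else δ * x i) else
        γ * (if n i = 2 then x i else δ * x i)
    by_cases h : n i = 2 <;> simp [h, mul_assoc]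

theorem signAction_apply (n : ι → ℕ) (γ : ℤˣ) (x : ι → ℤ) (i : ι) :
    signAction n γ x i = if n i = 2 then x i else γ * x i := rfl

theorem two_dvd_units_sub_one (γ : ℤˣ) : (2 : ℤ) ∣ γ - 1 := by
  rcases Int.units_eq_one_or γ with rfl | rfl <;> decide

/-- On a coordinate with `n i = 2` a sign is invisible modulo `n i`, so leaving it unchanged still
lifts inversion. -/
theorem map_signAction {n : ι → ℕ} {π : (ι → ℤ) →+ G} (hπ : ∀ x, π x = 0 ↔ ∀ i, (n i : ℤ) ∣ x i) (γ : ℤˣ) (x : ι → ℤ) :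
    π (signAction n γ x) = γ • π x := by
  have h1 : γ • π x = π ((γ : ℤ) • x) := by
    rw [map_zsmul]
    rfl
  rw [h1, ← sub_eq_zero, ← map_sub, hπ]
  intro i
  simp only [Pi.sub_apply, Pi.smul_apply, signAction_apply, smul_eq_mul]
  split_ifs with h
  · rw [h, ← one_sub_mul, ← neg_sub, neg_mul, dvd_neg]
    exact (two_dvd_units_sub_one γ).mul_right _
  · simp

end SignAction

/-! ### The triangular form, its kernel and the sign action -/

section Lattice

open QuadraticMap

variable {ι : Type*} [Fintype ι] [LinearOrder ι] {G N : Type*} [AddCommGroup G] [AddCommGroup N]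

/-- The upper triangular bilinear form on `ι → ℤ` with the same quadratic form as the pullback of
`Q` along `π`. -/
noncomputable def triangular (Q : QuadraticMap ℤ G N) (π : (ι → ℤ) →+ G) :
    LinearMap.BilinMap ℤ (ι → ℤ) N :=
  (Q.comp π.toIntLinearMap).toBilin (Pi.basisFun ℤ ι)

theorem triangular_self (Q : QuadraticMap ℤ G N) (π : (ι → ℤ) →+ G) (x : ι → ℤ) :
    triangular Q π x x = Q (π x) :=
  DFunLike.congr_fun ((Q.comp π.toIntLinearMap).toQuadraticMap_toBilin (Pi.basisFun ℤ ι)) x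

theorem triangular_add_swap (Q : QuadraticMap ℤ G N) (π : (ι → ℤ) →+ G) (x y : ι → ℤ) :
    triangular Q π x y + triangular Q π y x = polar Q (π x) (π y) := by
  rw [polar, ← map_add, ← triangular_self, ← triangular_self, ← triangular_self]
  simp only [map_add, LinearMap.add_apply]
  abel

theorem bilin_eq_sum (B : LinearMap.BilinMap ℤ (ι → ℤ) N) (x y : ι → ℤ) :
    B x y = ∑ i, ∑ j, (x i * y j) • B (Pi.single i 1) (Pi.single j 1) := by
  have h (x : ι → ℤ) : x = ∑ i, x i • (Pi.single i 1 : ι → ℤ) := by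
    ext i
    simp [Finset.sum_apply, Pi.single_apply]
  conv_lhs => rw [h x, h y]
  simp only [map_sum, LinearMap.sum_apply, map_smul, LinearMap.smul_apply, Finset.smul_sum]
  rw [Finset.sum_comm]
  exact Finset.sum_congr rfl fun i _ => Finset.sum_congr rfl fun j _ => by
    rw [smul_smul, mul_comm]

theorem triangular_single (Q : QuadraticMap ℤ G N) (π : (ι → ℤ) →+ G) (i j : ι) :
    triangular Q π (Pi.single i 1) (Pi.single j 1) =
      if i = j then Q (π (Pi.single i 1)) else
        if i < j then polar Q (π (Pi.single i 1)) (π (Pi.single j 1)) else 0 := by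
  have h := (Q.comp π.toIntLinearMap).toBilin_apply (Pi.basisFun ℤ ι) i j
  simp only [Pi.basisFun_apply] at h
  refine h.trans ?_
  split_ifs <;> simp [polar]

variable {n : ι → ℕ} {Q : QuadraticMap ℤ G N} {π : (ι → ℤ) →+ G}

/-- An off-diagonal entry is `0` or a value of the polar form, which is bilinear on `G`; hence the
order of either generator kills it. -/
theorem smul_triangular_right (hπ : ∀ x, π x = 0 ↔ ∀ i, (n i : ℤ) ∣ x i) {i j : ι} (hij : i ≠ j)
    {m : ℤ} (hm : (n j : ℤ) ∣ m) :
    m • triangular Q π (Pi.single i 1) (Pi.single j 1) = 0 := by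
  have h0 : π (m • Pi.single j 1) = 0 := (hπ _).2 fun k => by
    by_cases hk : k = j
    · subst hk
      simpa using hm
    · simp [hk]
  rw [triangular_single, if_neg hij]
  split_ifs
  · rw [← polar_smul_right, ← map_zsmul, h0]
    simp [polar]
  · exact smul_zero _

theorem smul_triangular_left (hπ : ∀ x, π x = 0 ↔ ∀ i, (n i : ℤ) ∣ x i) {i j : ι} (hij : i ≠ j)
    {m : ℤ} (hm : (n i : ℤ) ∣ m) :
    m • triangular Q π (Pi.single i 1) (Pi.single j 1) = 0 := by
  have h0 : π (m • Pi.single i 1) = 0 := (hπ _).2 fun k => by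
    by_cases hk : k = i
    · subst hk
      simpa using hm
    · simp [hk]
  rw [triangular_single, if_neg hij]
  split_ifs
  · rw [← polar_smul_left, ← map_zsmul, h0]
    simp [polar]
  · exact smul_zero _

/-- The polar form of `n_i e_i` and `e_i` is `2 n_i` times the diagonal entry, and it vanishes
because `n_i e_i` maps to `0`. In general `n_i` alone does not suffice. -/
theorem smul_triangular_diag (hπ : ∀ x, π x = 0 ↔ ∀ i, (n i : ℤ) ∣ x i) {i : ι}
    {m : ℤ} (hm : 2 * (n i : ℤ) ∣ m) :
    m • triangular Q π (Pi.single i 1) (Pi.single i 1) = 0 := by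
  obtain ⟨r, rfl⟩ := hm
  have h0 : π ((n i : ℤ) • Pi.single i 1) = 0 := (hπ _).2 fun k => by
    by_cases hk : k = i
    · subst hk
      simp
    · simp [hk]
  have h1 := triangular_add_swap Q π ((n i : ℤ) • Pi.single i 1) (Pi.single i 1)
  rw [h0, map_smul, map_smul, LinearMap.smul_apply, ← add_smul] at h1
  simp only [polar, zero_add, map_zero, sub_zero, sub_self] at h1
  rw [two_mul, mul_comm, mul_smul, h1, smul_zero]

/-- Here the vanishing of `Q` at the image of `n_i e_i` is used: it is `n_i²` times the diagonal
entry. -/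
theorem smul_triangular_sq (hπ : ∀ x, π x = 0 ↔ ∀ i, (n i : ℤ) ∣ x i) {i : ι}
    {m m' : ℤ} (hm : (n i : ℤ) ∣ m) (hm' : (n i : ℤ) ∣ m') :
    (m * m') • triangular Q π (Pi.single i 1) (Pi.single i 1) = 0 := by
  obtain ⟨r, rfl⟩ := hm
  obtain ⟨r', rfl⟩ := hm'
  have h0 : π ((n i : ℤ) • Pi.single i 1) = 0 := (hπ _).2 fun k => by
    by_cases hk : k = i
    · subst hk
      simp
    · simp [hk]
  have h1 := triangular_self Q π ((n i : ℤ) • Pi.single i 1)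
  rw [h0, map_smul, map_smul, LinearMap.smul_apply, smul_smul, map_zero] at h1
  rw [show (n i : ℤ) * r * (n i * r') = (r * r') * (n i * n i) by ring, mul_smul, h1, smul_zero]

theorem triangular_ker_ker (hπ : ∀ x, π x = 0 ↔ ∀ i, (n i : ℤ) ∣ x i) (k l : ι → ℤ)
    (hk : π k = 0) (hl : π l = 0) : triangular Q π k l = 0 := by
  rw [hπ] at hk hl
  rw [bilin_eq_sum]
  refine Finset.sum_eq_zero fun i _ => Finset.sum_eq_zero fun j _ => ?_
  by_cases hij : i = j
  · subst hij
    exact smul_triangular_sq hπ (hk i) (hl i)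
  · exact smul_triangular_left hπ hij ((hk i).mul_right _)

/-- Two vectors pair trivially if the second one lies in the kernel and the products of their
coordinates are divisible by `2 n`. -/
theorem triangular_ker_right (hπ : ∀ x, π x = 0 ↔ ∀ i, (n i : ℤ) ∣ x i) (x k : ι → ℤ)
    (hk : π k = 0) (h : ∀ i, 2 * (n i : ℤ) ∣ x i * k i) : triangular Q π x k = 0 := by
  rw [hπ] at hk
  rw [bilin_eq_sum]
  refine Finset.sum_eq_zero fun i _ => Finset.sum_eq_zero fun j _ => ?_
  by_cases hij : i = j
  · subst hij
    exact smul_triangular_diag hπ (h i)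
  · exact smul_triangular_right hπ hij ((hk j).mul_left _)

/-- Signs cancel on the diagonal. Off the diagonal they may survive only if exactly one of `n i`, `n
j` is `2`; then `2` kills the entry and the change of the coefficient is even. -/
theorem triangular_signAction (hπ : ∀ x, π x = 0 ↔ ∀ i, (n i : ℤ) ∣ x i) (γ : ℤˣ)
    (x y : ι → ℤ) :
    triangular Q π (signAction n γ x) (signAction n γ y) = triangular Q π x y := by
  rw [bilin_eq_sum, bilin_eq_sum _ x y]
  refine Finset.sum_congr rfl fun i _ => Finset.sum_congr rfl fun j _ => ?_
  have hγ : (γ : ℤ) * γ = 1 := by rw [← Units.val_mul, Int.units_mul_self, Units.val_one]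
  by_cases hij : i = j
  · subst hij
    rw [signAction_apply, signAction_apply]
    split_ifs
    · rfl
    · rw [mul_mul_mul_comm, hγ, one_mul]
  · have h2 : (2 : ℤ) ∣ signAction n γ x i * signAction n γ y j - x i * y j := by
      have hx : signAction n γ x i ≡ x i [ZMOD 2] := by
        rw [signAction_apply]
        split_ifs
        · rfl
        · refine (Int.modEq_iff_dvd.2 ?_).symm
          rw [← sub_one_mul]
          exact (two_dvd_units_sub_one γ).mul_right _
      have hy : signAction n γ y j ≡ y j [ZMOD 2] := by
        rw [signAction_apply]
        split_ifs
        · rfl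
        · refine (Int.modEq_iff_dvd.2 ?_).symm
          rw [← sub_one_mul]
          exact (two_dvd_units_sub_one γ).mul_right _
      exact Int.modEq_iff_dvd.1 (hx.mul hy).symm
    rw [← sub_eq_zero, ← sub_smul]
    by_cases hi : n i = 2
    · exact smul_triangular_left hπ hij (by rwa [hi])
    · by_cases hj : n j = 2
      · exact smul_triangular_right hπ hij (by rwa [hj])
      · rw [signAction_apply, signAction_apply, if_neg hi, if_neg hj, mul_mul_mul_comm, hγ, one_mul,
          sub_self, zero_smul]

/-- The sign action changes coordinates by even numbers and those of `k` are divisible by `n i`,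
which supplies the factor `2 * n i` that kills the diagonal entries. -/
theorem triangular_signAction_ker (hπ : ∀ x, π x = 0 ↔ ∀ i, (n i : ℤ) ∣ x i) (γ : ℤˣ)
    (x k : ι → ℤ) (hk : π k = 0) :
    triangular Q π (signAction n γ x) k = triangular Q π x k := by
  rw [← sub_eq_zero, ← LinearMap.sub_apply, ← map_sub]
  refine triangular_ker_right hπ _ _ hk fun i => mul_dvd_mul ?_ ((hπ k).1 hk i)
  rw [Pi.sub_apply, signAction_apply]
  split_ifs
  · simp
  · rw [← sub_one_mul]
    exact (two_dvd_units_sub_one γ).mul_right _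

/-- The lattice `ι → ℤ` over a finite abelian group with its upper triangular form. -/
noncomputable def latticeDatum (Q : QuadraticMap ℤ G (Additive ℂˣ))
    (hπ : ∀ x, π x = 0 ↔ ∀ i, (n i : ℤ) ∣ x i) (s : G → ι → ℤ) (hs : ∀ a, π (s a) = a)
    (s_zero : s 0 = 0) : DescentDatum G (ι → ℤ) where
  π := π
  s := s
  B := triangular Q π
  π_s := hs
  s_zero := s_zero
  ker_ker := triangular_ker_ker hπ
  ker_anti k x hk := by
    -- The symmetrization of `B` is the polar form on `G`, which vanishes when one argument is `0`.
    have h := triangular_add_swap Q π k x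
    rw [hk] at h
    simp only [polar, zero_add, map_zero, sub_zero, sub_self] at h
    exact eq_neg_of_add_eq_zero_left h

theorem lift_signAction (Q : QuadraticMap ℤ G (Additive ℂˣ))
    (hπ : ∀ x, π x = 0 ↔ ∀ i, (n i : ℤ) ∣ x i) (s : G → ι → ℤ) (hs : ∀ a, π (s a) = a)
    (s_zero : s 0 = 0) : (latticeDatum Q hπ s hs s_zero).Lift (signAction n) where
  equivariant := map_signAction hπ
  isometry := triangular_signAction hπ
  ker_right := triangular_signAction_ker hπ

/-- The hypothesis `hn` serves only the normalization of `μ`. On the two-torsion the twist is zero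
in the coordinates with `n i = 2` and otherwise `0` or `2 s(b')_i`, so the diagonal entries die once
`n i` divides `s(b)_i s(b')_i`. -/
theorem exists_particleHole_of_lattice [Fintype G] [DecidableEq G] {q : G → ℂˣ}
    (hq : IsQuadraticForm q) (hπ : ∀ x, π x = 0 ↔ ∀ i, (n i : ℤ) ∣ x i) (s : G → ι → ℤ)
    (hs : ∀ a, π (s a) = a) (s_zero : s 0 = 0)
    (hn : ∀ i (u v : ℤ), (n i : ℤ) ∣ 2 * u → (n i : ℤ) ∣ 2 * v → n i = 2 ∨ (n i : ℤ) ∣ u * v) :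
    ∃ (A : AbelianCocycle G) (P : ParticleHole A),
      (∀ g, A.c g g = q g) ∧ P.toActionData.toMonoidalAction.PreservesBraiding := by
  have h := lift_signAction hq.toQuadraticMap hπ s hs s_zero
  have htwo {b : G} (hb : b ∈ twoTorsion G) (i : ι) : (n i : ℤ) ∣ 2 * s b i := by
    have h0 : π ((2 : ℤ) • s b) = 0 := by
      rw [map_zsmul, hs, two_zsmul]
      nth_rw 2 [show b = -b from hb]
      exact add_neg_cancel b
    simpa using (hπ _).1 h0 i
  refine ⟨_, { h.actionData with
    μ_two := fun γ b hb b' hb' => ?_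
    ν_two := fun _ _ _ _ => rfl }, fun g => ?_, ActionData.preservesBraiding _ h.μ_braiding⟩
  · refine Additive.ofMul.injective
      (triangular_ker_right hπ (s b) _ (h.π_twist γ b') fun i => ?_)
    have ht : (latticeDatum hq.toQuadraticMap hπ s hs s_zero).twist (signAction n) γ b' i =
        s b' i - if n i = 2 then s b' i else γ * s b' i := by
      change s (γ • b') i - signAction n γ (s b') i = _
      rw [ParticleHole.smul_eq γ hb', signAction_apply]
    rw [ht]
    split_ifs with h2
    · simp
    · have h3 := (hn i _ _ (htwo hb i) (htwo hb' i)).resolve_left h2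
      obtain ⟨r, hr⟩ := two_dvd_units_sub_one γ
      -- The factor `2` comes from `γ - 1 = 2 r` and the factor `n i` from `h3`.
      rw [show s b i * (s b' i - γ * s b' i) = 2 * (s b i * s b' i) * (-r) by
        linear_combination (-s b i * s b' i) * hr]
      exact (mul_dvd_mul_left 2 h3).mul_right _
  · exact congrArg Additive.toMul ((triangular_self _ π (s g)).trans (by rw [hs]; rfl))

end Lattice

/-- For odd `p` the factor `2` cancels. For `2 ^ e` with `e ≥ 2` both numbers are divisible by `2 ^
(e - 1)`, and `2 (e - 1) ≥ e`. The order `2` fails at `u = v = 1`, hence the exception. -/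
theorem prime_pow_dvd_mul_of_dvd_two_mul {p : ℕ} (hp : p.Prime) (e : ℕ) {u v : ℤ}
    (hu : ((p ^ e : ℕ) : ℤ) ∣ 2 * u) (hv : ((p ^ e : ℕ) : ℤ) ∣ 2 * v) :
    p ^ e = 2 ∨ ((p ^ e : ℕ) : ℤ) ∣ u * v := by
  by_cases hp2 : p = 2
  · subst hp2
    match e with
    | 0 => exact Or.inr (by simp)
    | 1 => exact Or.inl (by simp)
    | e + 2 =>
      right
      have key {w : ℤ} (hw : ((2 ^ (e + 2) : ℕ) : ℤ) ∣ 2 * w) : (2 : ℤ) ^ (e + 1) ∣ w := by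
        push_cast at hw
        rw [pow_succ' (2 : ℤ) (e + 1)] at hw
        exact Int.dvd_of_mul_dvd_mul_left two_ne_zero hw
      push_cast
      refine (pow_dvd_pow 2 (by omega : e + 2 ≤ (e + 1) + (e + 1))).trans ?_
      rw [pow_add]
      exact mul_dvd_mul (key hu) (key hv)
  · right
    have hc : IsCoprime ((p ^ e : ℕ) : ℤ) 2 := by
      have h1 : Nat.Coprime (p ^ e) 2 :=
        Nat.Coprime.pow_left e ((Nat.coprime_primes hp Nat.prime_two).2 hp2)
      exact_mod_cast Nat.isCoprime_iff_coprime.2 h1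
    exact (hc.dvd_of_dvd_mul_left hu).mul_right v

theorem exists_particleHole {G : Type*} [AddCommGroup G] [Fintype G] [DecidableEq G] {q : G → ℂˣ}
    (hq : IsQuadraticForm q) :
    ∃ (A : AbelianCocycle G) (P : ParticleHole A),
      (∀ g, A.c g g = q g) ∧ P.toActionData.toMonoidalAction.PreservesBraiding := by
  obtain ⟨ι, _, p, hp, e, ⟨f⟩⟩ := AddCommGroup.equiv_directSum_zmod_of_finite G
  -- Any order will do; it only decides which half of the matrix carries the polar form.
  let : LinearOrder ι := LinearOrder.lift' (Fintype.equivFin ι) (Fintype.equivFin ι).injective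
  let g : G ≃+ (∀ i, ZMod (p i ^ e i)) := f.trans (DirectSum.addEquivProd _)
  let π : (ι → ℤ) →+ G := g.symm.toAddMonoidHom.comp
    (AddMonoidHom.mk' (fun x i => (x i : ZMod (p i ^ e i))) fun x y => by
      ext i
      simp)
  refine exists_particleHole_of_lattice (n := fun i => p i ^ e i) (π := π) hq (fun x => ?_)
    -- The section takes integer representatives of the residues coordinatewise, so that `0` lifts
    -- to `0`.
    (fun a i => (g a i).cast) (fun a => ?_) ?_ fun i u v =>
      prime_pow_dvd_mul_of_dvd_two_mul (hp i) (e i)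
  · change g.symm (fun i => (x i : ZMod (p i ^ e i))) = 0 ↔ _
    rw [AddEquiv.map_eq_zero_iff, funext_iff]
    exact forall_congr' fun i => ZMod.intCast_zmod_eq_zero_iff_dvd _ _
  · change g.symm (fun i => (((g a i).cast : ℤ) : ZMod (p i ^ e i))) = a
    simp
  · ext i
    simp

end Equivariantization

theorem proposition3p1 {G : Type*} [AddCommGroup G] [Fintype G] [DecidableEq G] (q : G → ℂˣ)
    (hq : Equivariantization.IsQuadraticForm q) :
    (∃ (A : Equivariantization.AbelianCocycle G) (P : Equivariantization.ParticleHole A),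
      (∀ g, A.c g g = q g) ∧ P.toActionData.toMonoidalAction.PreservesBraiding) ∧
    ∀ (A : Equivariantization.AbelianCocycle G) (P : Equivariantization.ParticleHole A),
      (∀ g, A.c g g = q g) →
      -- the objects `X_b^ε` and `Y_a` with `a ≠ -a` are simple
      (∀ b ε, Simple (P.X b ε)) ∧
      (∀ a : G, a ≠ -a → Simple (P.Y a)) ∧
      -- every simple object is isomorphic to one of them
      (∀ Z : P.Equivariant, Simple Z →
        (∃ b ε, Nonempty (Z ≅ P.X b ε)) ∨ ∃ a : G, a ≠ -a ∧ Nonempty (Z ≅ P.Y a)) ∧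
      -- the only isomorphisms between them are `Y_a ≅ Y_{-a}`
      (∀ b ε b' ε', Nonempty (P.X b ε ≅ P.X b' ε') ↔ b = b' ∧ ε = ε') ∧
      (∀ a a' : G, a ≠ -a → a' ≠ -a' → (Nonempty (P.Y a ≅ P.Y a') ↔ a = a' ∨ a = -a')) ∧
      (∀ b ε, ∀ a : G, a ≠ -a → IsEmpty (P.X b ε ≅ P.Y a)) ∧
      -- dimensions
      (∀ b ε, Equivariantization.IsFPdim (P.X b ε) 1) ∧
      (∀ a : G, a ≠ -a → Equivariantization.IsFPdim (P.Y a) 2) ∧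
      -- the unit object, and the meaning of `Y_b` for `b = -b`
      Nonempty (𝟙_ P.Equivariant ≅ P.X 0 1) ∧
      (∀ b : Equivariantization.twoTorsion G, Nonempty (P.Y b ≅ P.X b 1 ⊞ P.X b (-1))) ∧
      -- fusion rules
      (∀ b ε b' ε', Nonempty (P.X b ε ⊗ P.X b' ε' ≅ P.X (b + b') (ε * ε'))) ∧
      (∀ b ε, ∀ a : G, a ≠ -a → Nonempty (P.X b ε ⊗ P.Y a ≅ P.Y (a + b))) ∧
      (∀ a a' : G, a ≠ -a → a' ≠ -a' → (a = a' ∨ a = -a') →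
        Nonempty (P.Y a ⊗ P.Y a' ≅ P.X 0 1 ⊞ (P.X 0 (-1) ⊞ P.Y (a + a)))) ∧
      (∀ a a' : G, a ≠ -a → a' ≠ -a' → a ≠ a' → a ≠ -a' →
        Nonempty (P.Y a ⊗ P.Y a' ≅ P.Y (a + a') ⊞ P.Y (a - a'))) :=
  ⟨Equivariantization.exists_particleHole hq, fun _ P _ =>
    ⟨P.simple_X, fun _ ha => P.simple_Y ha, fun Z _ => P.simple_classification Z, P.X_iso_X,
      fun a a' _ _ => P.Y_iso_Y a a', fun b ε a _ => P.X_not_iso_Y b ε a, P.isFPdim_X,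
      fun a _ => P.isFPdim_Y a, P.unit_iso, P.Y_two, P.X_tensor_X,
      fun b ε a _ => P.X_tensor_Y b ε a, fun a a' _ _ h => P.Y_tensor_Y_of_eq a a' h,
      fun a a' _ _ _ _ => P.Y_tensor_Y a a'⟩⟩
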